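/- Let $R$ be a commutative ring, $H$ an $R$-bialgebra, $A$ a right $H$-comodule algebra (an $R$-algebra with a coassociative counital coaction $a\mapsto\sum a_{0}\otimes a_{1}\in A\otimes_R H$ that is an algebra map) and $C$ a right $H$-module coalgebra (a coassociative counital $R$-coalgebra with a right $H$-module structure $C\otimes_R H\to C$ that is a coalgebra map); that is, $(H,A,C)$ is a right-right Doi-Koppinen structure. Let $\mathcal{M}(H)_A^C$ be the category of right $A$-modules $M$ with a right $C$-comodule structure $m\mapsto\sum m_0\otimes m_1$ such that $ma\mapsto\sum m_0a_0\otimes m_1a_1$ for all $m\in M$, $a\in A$, with the $A$-linear $C$-colinear maps. Let $\mathcal{C}=A\otimes_R C$ be the associated $A$-coring, with bimodule structure $b(a\otimes c)=ba\otimes c$, $(a\otimes c)b=\sum ab_0\otimes cb_1$, comultiplication $a\otimes c\mapsto\sum(a\otimes c_1)\otimes_A(1\otimes c_2)$ and counit $a\otimes c\mapsto a\varepsilon(c)$. Its left dual ${}^*\mathcal{C}$ (left $A$-linear maps $\mathcal{C}\to A$) is an $A$-ring with $(af)(w)=f(wa)$, $(fa)(w)=f(w)a$, $(f\star g)(w)=\sum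 g(w_1f(w_2))$ and unity $\varepsilon_{\mathcal{C}}$, and it acts on $\mathcal{C}$ from the right by $w\leftharpoonup f=\sum w_1f(w_2)$. Here an $A$-ring, not necessarily with unity, is an $A$-bimodule with an associative, $A$-bilinear and $A$-balanced multiplication. A right module over an $A$-ring $B$ is a right $A$-module with an associative, $A$-linear and $A$-balanced right action of $B$; $\mathcal{M}_B$ is the category of those with $MB=M$. For a right $B$-module $K$, $\sigma[K_B]\subseteq\mathcal{M}_B$ is the full subcategory of the $K$-subgenerated modules, i.e. those isomorphic to a submodule of an epimorphic image of a direct sum of copies of $K$. A measuring left $A$-pairing $(B,\mathcal{C})$ is given by a morphism of $A$-rings $\kappa:B\to{}^*\mathcal{C}$ that maps the unity of $B$, if there is one, to that of ${}^*\mathcal{C}$; it is an $\alpha$-pairing if for every right $A$-module $M$ the map $M\otimes_A\mathcal{C}\to\mathrm{Hom}_{-A}(B,M)$, $m\otimes w\mapsto[x\mapsto m\,\kappa(x)(w)]$, is injective. Density refers to the finite topology (pointwise convergence with discrete values). Let $\#^{op}(C,A)=\mathrm{Hom}_R(C,A)$ be the $A$-ring with $(af)(c)=\sum a_0f(ca_1)$,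 $(fa)(c)=f(c)a$, $(f\cdot g)(c)=\sum f(c_2)_0\,g(c_1f(c_2)_1)$; it acts on $\mathcal{C}$ through $\varphi:\#^{op}(C,A)\to{}^*\mathcal{C}$, $f\mapsto[a\otimes c\mapsto af(c)]$, and on $M\in\mathcal{M}(H)_A^C$ by $mf=\sum m_0f(m_1)$. The dual $C^*=\mathrm{Hom}_R(C,R)$ has the convolution product $(f\star g)(c)=\sum f(c_1)g(c_2)$ and the left $H$-action $(hf)(c)=f(ch)$. For a left $H$-module subalgebra $T\subseteq C^*$ (an $R$-submodule closed under $\star$ and under $H$, not necessarily containing $\varepsilon_C$) let $A\#^{op}T=A\otimes_R T$ be the $A$-ring with $b(a\#f)=\sum b_0a\#b_1f$, $(a\#f)b=ab\#f$, $(a\#f)(b\#g)=\sum a_0b\#(a_1g)\star f$; there is a morphism of $A$-rings $\beta:A\#^{op}T\to\#^{op}(C,A)$, $a\#f\mapsto[c\mapsto af(c)]$, and $A\#^{op}T$ acts on $\mathcal{C}$ through $\kappa=\varphi\circ\beta$. 1. If ${}_RC$ is flat, then $\mathcal{M}(H)_A^C$ is a Grothendieck category with enough injective objects. 2. Let ${}_RC$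 be locally projective: for every $R$-linear epimorphism $\pi:L\to N$, every $R$-linear $g:C\to N$ and every finitely generated submodule $F\subseteq C$ there is an $R$-linear $g':C\to L$ with $\pi\circ g'=g$ on $F$. Let $T\subseteq C^*$ be a dense left $H$-module subalgebra that is $A$-pure, i.e. $A\otimes_RT\to A\otimes_RC^*$ is injective. Then $\beta(A\#^{op}T)\subseteq\#^{op}(C,A)$ is dense, $(A\#^{op}T,\mathcal{C})$ with $\kappa$ is a measuring left $\alpha$-pairing, and $$\mathcal{M}(H)_A^C\simeq\sigma[\mathcal{C}_{\#^{op}(C,A)}]=\sigma[\mathcal{C}_{A\#^{op}T}]:$$ the functor $M\mapsto M$ with $mf=\sum m_0f(m_1)$ is an isomorphism of categories onto $\sigma[\mathcal{C}_{\#^{op}(C,A)}]$, and restriction of scalars along $\beta$ is an isomorphism of categories $\sigma[\mathcal{C}_{\#^{op}(C,A)}]\to\sigma[\mathcal{C}_{A\#^{op}T}]$. 3. If ${}_RC$ is finitely generated and projective, then the same functors give isomorphisms of categories $$\mathcal{M}(H)_A^C\simeq\mathcal{M}_{\#^{op}(C,A)}\simeq\mathcal{M}_{A\#^{op}C^*}.$$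 -/

import Mathlib

open TensorProduct MulOpposite CategoryTheory

universe u

set_option linter.unusedSectionVars false

noncomputable section

/-! ### Tensor products over a noncommutative algebra

Here `A` is an algebra over a commutative ring `R`. Right `A`-modules are modules over `Aᵐᵒᵖ`. -/

section ATensor

variable (R A M N : Type*) [CommRing R] [Ring A] [Algebra R A]
  [AddCommGroup M] [Module R M] [Module Aᵐᵒᵖ M] [AddCommGroup N] [Module R N] [Module A N]

/-- The relations `m a ⊗ n = m ⊗ a n` in `M ⊗[R] N`. -/
def ATensor.relations : Submodule R (M ⊗[R] N) :=
  Submodule.span R (Set.range fun p : M × A × N =>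
    (op p.2.1 • p.1) ⊗ₜ[R] p.2.2 - p.1 ⊗ₜ[R] (p.2.1 • p.2.2))

/-- The tensor product `M ⊗_A N` of a right `A`-module and a left `A`-module. -/
def ATensor : Type _ := (M ⊗[R] N) ⧸ ATensor.relations R A M N

instance : AddCommGroup (ATensor R A M N) :=
  inferInstanceAs (AddCommGroup ((M ⊗[R] N) ⧸ ATensor.relations R A M N))

instance : Module R (ATensor R A M N) :=
  inferInstanceAs (Module R ((M ⊗[R] N) ⧸ ATensor.relations R A M N))

end ATensor

namespace ATensor

variable {R A M N P M' N' L W : Type*} [CommRing R] [Ring A] [Algebra R A]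
  [AddCommGroup M] [Module R M] [Module Aᵐᵒᵖ M] [AddCommGroup N] [Module R N] [Module A N]
  [AddCommGroup M'] [Module R M'] [Module Aᵐᵒᵖ M'] [AddCommGroup N'] [Module R N'] [Module A N']
  [AddCommGroup P] [Module R P]

variable (R A) in
/-- The pure tensor `m ⊗ n` in `M ⊗_A N`. -/
def tmul (m : M) (n : N) : ATensor R A M N := Submodule.Quotient.mk (m ⊗ₜ[R] n)

variable (R A M N) in
/-- The canonical bilinear map `M × N → M ⊗_A N`. -/
def mk : M →ₗ[R] N →ₗ[R] ATensor R A M N :=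
  LinearMap.compr₂ (TensorProduct.mk R M N) (Submodule.mkQ (relations R A M N))

@[simp] theorem mk_apply (m : M) (n : N) : mk R A M N m n = tmul R A m n := rfl

theorem tmul_add (m : M) (n n' : N) :
    tmul R A m (n + n') = tmul R A m n + tmul R A m n' := (mk R A M N m).map_add n n'

theorem add_tmul (m m' : M) (n : N) :
    tmul R A (m + m') n = tmul R A m n + tmul R A m' n := by
  simp [← mk_apply]

@[simp] theorem zero_tmul (n : N) : tmul R A (0 : M) n = 0 := by
  simp [← mk_apply]

@[simp] theorem tmul_zero (m : M) : tmul R A m (0 : N) = 0 :=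
  (mk R A M N m).map_zero

theorem rsmul_tmul (r : R) (m : M) (n : N) : tmul R A (r • m) n = r • tmul R A m n := by
  simp [← mk_apply]

theorem tmul_rsmul (r : R) (m : M) (n : N) : tmul R A m (r • n) = r • tmul R A m n :=
  (mk R A M N m).map_smul r n

theorem smul_tmul (a : A) (m : M) (n : N) :
    tmul R A (op a • m) n = tmul R A m (a • n) :=
  (Submodule.Quotient.eq _).2 (Submodule.subset_span ⟨(m, a, n), rfl⟩)

theorem induction {p : ATensor R A M N → Prop} (t : ATensor R A M N)
    (h0 : p 0) (h1 : ∀ m n, p (tmul R A m n)) (h2 : ∀ s t, p s → p t → p (s + t)) : p t := by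
  obtain ⟨t, rfl⟩ := Submodule.Quotient.mk_surjective _ t
  induction t with
  | zero => exact h0
  | tmul m n => exact h1 m n
  | add s t hs ht => exact h2 _ _ hs ht

/-- The linear map `M ⊗_A N → P` given by a balanced bilinear map. -/
def lift (f : M →ₗ[R] N →ₗ[R] P) (h : ∀ m (a : A) n, f (op a • m) n = f m (a • n)) :
    ATensor R A M N →ₗ[R] P :=
  Submodule.liftQ _ (TensorProduct.lift f) (by
    rw [relations, Submodule.span_le]
    rintro _ ⟨p, rfl⟩
    simp [h])

@[simp] theorem lift_tmul (f : M →ₗ[R] N →ₗ[R] P)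
    (h : ∀ m (a : A) n, f (op a • m) n = f m (a • n)) (m : M) (n : N) :
    lift f h (tmul R A m n) = f m n := rfl

theorem hom_ext {f g : ATensor R A M N →ₗ[R] P}
    (h : ∀ m n, f (tmul R A m n) = g (tmul R A m n)) : f = g := by
  ext t
  induction t using ATensor.induction with
  | h0 => simp
  | h1 m n => exact h m n
  | h2 s t hs ht => simp [hs, ht]

/-- The map `f ⊗ g` for a right `A`-linear `f` and a left `A`-linear `g`. -/
def map (f : M →ₗ[R] M') (hf : ∀ (a : A) m, f (op a • m) = op a • f m)
    (g : N →ₗ[R] N') (hg : ∀ (a : A) n, g (a • n) = a • g n) :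
    ATensor R A M N →ₗ[R] ATensor R A M' N' :=
  lift ((mk R A M' N').compl₁₂ f g) (fun m a n => by simp [hf, hg, smul_tmul])

@[simp] theorem map_tmul (f : M →ₗ[R] M') (hf : ∀ (a : A) m, f (op a • m) = op a • f m)
    (g : N →ₗ[R] N') (hg : ∀ (a : A) n, g (a • n) = a • g n) (m : M) (n : N) :
    map f hf g hg (tmul R A m n) = tmul R A (f m) (g n) := rfl

section Bimodule

variable [Module A M] [IsScalarTower R A M] [SMulCommClass A Aᵐᵒᵖ M]

/-- For an `A`-bimodule `M`, the left `A`-action `a (m ⊗ n) = a m ⊗ n`. -/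
instance : SMul A (ATensor R A M N) where
  smul a := map (Algebra.lsmul R R M a) (fun b m => smul_comm a (op b) m)
    LinearMap.id (fun _ _ => rfl)

@[simp] theorem smul_tmul_left (a : A) (m : M) (n : N) :
    a • tmul R A m n = tmul R A (a • m) n := rfl

theorem lsmul_add (a : A) (s t : ATensor R A M N) : a • (s + t) = a • s + a • t :=
  LinearMap.map_add (map (Algebra.lsmul R R M a) _ LinearMap.id _) s t

theorem lsmul_zero (a : A) : a • (0 : ATensor R A M N) = 0 :=
  LinearMap.map_zero (map (Algebra.lsmul R R M a) _ LinearMap.id _)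

theorem lsmul_rsmul (a : A) (r : R) (t : ATensor R A M N) : a • r • t = r • a • t :=
  LinearMap.map_smul (map (Algebra.lsmul R R M a) _ LinearMap.id _) r t

instance : Module A (ATensor R A M N) where
  smul_zero := lsmul_zero
  smul_add := lsmul_add
  one_smul t := by
    induction t using ATensor.induction with
    | h0 => exact lsmul_zero _
    | h1 m n => simp
    | h2 s t hs ht => rw [lsmul_add, hs, ht]
  mul_smul a b t := by
    induction t using ATensor.induction with
    | h0 => simp [lsmul_zero]
    | h1 m n => simp [mul_smul]
    | h2 s t hs ht => simp [lsmul_add, hs, ht]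
  add_smul a b t := by
    induction t using ATensor.induction with
    | h0 => simp [lsmul_zero]
    | h1 m n => simp [add_smul, add_tmul]
    | h2 s t hs ht => simp only [lsmul_add, hs, ht]; abel
  zero_smul t := by
    induction t using ATensor.induction with
    | h0 => exact lsmul_zero _
    | h1 m n => simp
    | h2 s t hs ht => rw [lsmul_add, hs, ht, add_zero]

instance : IsScalarTower R A (ATensor R A M N) where
  smul_assoc r a t := by
    induction t using ATensor.induction with
    | h0 => simp
    | h1 m n => simp [rsmul_tmul]
    | h2 s t hs ht => simp only [smul_add, hs, ht]

end Bimodule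

section Bimodule

variable [Module Aᵐᵒᵖ N] [IsScalarTower R Aᵐᵒᵖ N] [SMulCommClass A Aᵐᵒᵖ N]

/-- For an `A`-bimodule `N`, the right `A`-action `(m ⊗ n) a = m ⊗ n a`. -/
instance : SMul Aᵐᵒᵖ (ATensor R A M N) where
  smul a := map LinearMap.id (fun _ _ => rfl)
    (Algebra.lsmul R R N a) (fun b n => (smul_comm b a n).symm)

@[simp] theorem op_smul_tmul (a : Aᵐᵒᵖ) (m : M) (n : N) :
    a • tmul R A m n = tmul R A m (a • n) := rfl

theorem rsmul_add (a : Aᵐᵒᵖ) (s t : ATensor R A M N) : a • (s + t) = a • s + a • t :=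
  LinearMap.map_add (map LinearMap.id _ (Algebra.lsmul R R N a) _) s t

theorem rsmul_zero (a : Aᵐᵒᵖ) : a • (0 : ATensor R A M N) = 0 :=
  LinearMap.map_zero (map LinearMap.id _ (Algebra.lsmul R R N a) _)

instance : Module Aᵐᵒᵖ (ATensor R A M N) where
  smul_zero := rsmul_zero
  smul_add := rsmul_add
  one_smul t := by
    induction t using ATensor.induction with
    | h0 => exact rsmul_zero _
    | h1 m n => simp
    | h2 s t hs ht => rw [rsmul_add, hs, ht]
  mul_smul a b t := by
    induction t using ATensor.induction with
    | h0 => simp [rsmul_zero]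
    | h1 m n => simp [mul_smul]
    | h2 s t hs ht => simp [rsmul_add, hs, ht]
  add_smul a b t := by
    induction t using ATensor.induction with
    | h0 => simp [rsmul_zero]
    | h1 m n => simp [add_smul, tmul_add]
    | h2 s t hs ht => simp only [rsmul_add, hs, ht]; abel
  zero_smul t := by
    induction t using ATensor.induction with
    | h0 => exact rsmul_zero _
    | h1 m n => simp
    | h2 s t hs ht => rw [rsmul_add, hs, ht, add_zero]

instance : IsScalarTower R Aᵐᵒᵖ (ATensor R A M N) where
  smul_assoc r a t := by
    induction t using ATensor.induction with
    | h0 => simp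
    | h1 m n => simp [tmul_rsmul]
    | h2 s t hs ht => simp only [smul_add, hs, ht]

end Bimodule

variable [AddCommGroup W] [Module R W] [Module A W] [Module Aᵐᵒᵖ W]
  [IsScalarTower R A W] [IsScalarTower R Aᵐᵒᵖ W] [SMulCommClass A Aᵐᵒᵖ W]

/-- The map `m ⊗ w ↦ m ⊗ (w ⊗ n)`, linear in `n`. -/
def assocAux : N →ₗ[R] ATensor R A M W →ₗ[R] ATensor R A M (ATensor R A W N) where
  toFun n := lift ((mk R A M (ATensor R A W N)).compl₁₂ LinearMap.id ((mk R A W N).flip n))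
    (fun m a w => smul_tmul a m (tmul R A w n))
  map_add' n n' := hom_ext fun m w => by
    change tmul R A m (tmul R A w (n + n')) =
      tmul R A m (tmul R A w n) + tmul R A m (tmul R A w n')
    rw [tmul_add, tmul_add]
  map_smul' r n := hom_ext fun m w => by
    change tmul R A m (tmul R A w (r • n)) = r • tmul R A m (tmul R A w n)
    rw [tmul_rsmul, tmul_rsmul]

@[simp] theorem assocAux_tmul (n : N) (m : M) (w : W) :
    assocAux n (tmul R A m w) = tmul R A m (tmul R A w n) := rfl

/-- The canonical map `(M ⊗_A W) ⊗_A N → M ⊗_A (W ⊗_A N)` for an `A`-bimodule `W`. -/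
def assoc : ATensor R A (ATensor R A M W) N →ₗ[R] ATensor R A M (ATensor R A W N) :=
  lift (LinearMap.flip assocAux) (fun t a n => by
    induction t using ATensor.induction with
    | h0 => simp
    | h1 m w =>
      simp only [LinearMap.flip_apply, op_smul_tmul, assocAux_tmul, smul_tmul]
    | h2 s t hs ht => simp only [smul_add, map_add, LinearMap.add_apply, hs, ht])

@[simp] theorem assoc_tmul (m : M) (w : W) (n : N) :
    assoc (tmul R A (tmul R A m w) n) = tmul R A m (tmul R A w n) := rfl

end ATensor
/-! ### `A`-rings and their modules -/

/-- An associative `A`-ring, not necessarily with unity: an `A`-bimodule `B` with an associative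
multiplication that is `A`-bilinear and `A`-balanced. -/
class IsARing (R A B : Type*) [CommRing R] [Ring A] [Algebra R A] [NonUnitalRing B]
    [Module R B] [Module A B] [Module Aᵐᵒᵖ B] : Prop
    extends IsScalarTower R A B, SMulCommClass A Aᵐᵒᵖ B where
  isScalarTower_op : IsScalarTower R Aᵐᵒᵖ B
  smul_mul : ∀ (a : A) (x y : B), (a • x) * y = a • (x * y)
  mul_op_smul : ∀ (a : A) (x y : B), x * (op a • y) = op a • (x * y)
  op_smul_mul : ∀ (a : A) (x y : B), (op a • x) * y = x * (a • y)

attribute [instance] IsARing.isScalarTower_op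

/-- A morphism of (not necessarily unital) `A`-rings. -/
structure ARingHom (R A B B' : Type*) [CommRing R] [Ring A] [Algebra R A]
    [NonUnitalRing B] [Module R B] [Module A B] [Module Aᵐᵒᵖ B]
    [NonUnitalRing B'] [Module R B'] [Module A B'] [Module Aᵐᵒᵖ B'] where
  toLinearMap : B →ₗ[R] B'
  map_smul : ∀ (a : A) x, toLinearMap (a • x) = a • toLinearMap x
  map_op_smul : ∀ (a : A) x, toLinearMap (op a • x) = op a • toLinearMap x
  map_mul : ∀ x y, toLinearMap (x * y) = toLinearMap x * toLinearMap y

/-- Composition of morphisms of `A`-rings. -/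
def ARingHom.comp {R A B B' B'' : Type*} [CommRing R] [Ring A] [Algebra R A]
    [NonUnitalRing B] [Module R B] [Module A B] [Module Aᵐᵒᵖ B]
    [NonUnitalRing B'] [Module R B'] [Module A B'] [Module Aᵐᵒᵖ B']
    [NonUnitalRing B''] [Module R B''] [Module A B''] [Module Aᵐᵒᵖ B'']
    (g : ARingHom R A B' B'') (f : ARingHom R A B B') : ARingHom R A B B'' where
  toLinearMap := g.toLinearMap ∘ₗ f.toLinearMap
  map_smul a x := by simp [f.map_smul, g.map_smul]
  map_op_smul a x := by simp [f.map_op_smul, g.map_op_smul]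
  map_mul x y := by simp [f.map_mul, g.map_mul]

/-- A right module over an `A`-ring `B`: a right `A`-module `M` with an associative
`A`-linear and `A`-balanced action `M × B → M`. No unitality is required here. -/
structure AMod (R A B : Type u) [CommRing R] [Ring A] [Algebra R A] [NonUnitalRing B]
    [Module R B] [Module A B] [Module Aᵐᵒᵖ B] [IsARing R A B] where
  carrier : Type u
  [addCommGroup : AddCommGroup carrier]
  [module : Module R carrier]
  [opModule : Module Aᵐᵒᵖ carrier]
  [isScalarTower : IsScalarTower R Aᵐᵒᵖ carrier]
  /-- the action `(m, x) ↦ m x` -/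
  act : carrier →ₗ[R] B →ₗ[R] carrier
  act_act : ∀ m x y, act (act m x) y = act m (x * y)
  op_smul_act : ∀ (a : A) m x, act (op a • m) x = act m (a • x)
  act_op_smul : ∀ (a : A) m x, act m (op a • x) = op a • act m x

namespace AMod

attribute [instance] AMod.addCommGroup AMod.module AMod.opModule AMod.isScalarTower

variable {R A B B' : Type u} [CommRing R] [Ring A] [Algebra R A]
  [NonUnitalRing B] [Module R B] [Module A B] [Module Aᵐᵒᵖ B] [IsARing R A B]
  [NonUnitalRing B'] [Module R B'] [Module A B'] [Module Aᵐᵒᵖ B'] [IsARing R A B']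

/-- Morphisms: right `A`-linear maps that commute with the action of `B`. -/
@[ext] structure Hom (M N : AMod R A B) where
  toLinearMap : M.carrier →ₗ[Aᵐᵒᵖ] N.carrier
  map_act : ∀ m x, toLinearMap (M.act m x) = N.act (toLinearMap m) x

instance : Category.{u} (AMod R A B) where
  Hom M N := Hom M N
  id M := ⟨LinearMap.id, fun _ _ => rfl⟩
  comp f g := ⟨g.toLinearMap ∘ₗ f.toLinearMap, fun m x => by simp [f.map_act, g.map_act]⟩

/-- `M` is unital if `M B = M`. -/
def IsUnital (M : AMod R A B) : Prop :=
  AddSubgroup.closure {n : M.carrier | ∃ m x, M.act m x = n} = ⊤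

/-- The direct sum of copies of `K` indexed by `I`. -/
def copower (K : AMod R A B) (I : Type u) : AMod R A B where
  carrier := I →₀ K.carrier
  act := LinearMap.mk₂ R (fun m x => Finsupp.mapRange.linearMap (K.act.flip x) m)
    (fun m m' x => LinearMap.map_add _ _ _) (fun r m x => by simp)
    (fun m x x' => by ext i; simp) (fun r m x => by ext i; simp)
  act_act m x y := by ext i; simp [K.act_act]
  op_smul_act a m x := by ext i; simp [K.op_smul_act]
  act_op_smul a m x := by ext i; simp [K.act_op_smul]

/-- `N` is `K`-subgenerated: it is isomorphic to a submodule of a `K`-generated module `L`, that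
is, of an epimorphic image `L` of a direct sum of copies of `K`. -/
def IsSubgenerated (K N : AMod R A B) : Prop :=
  ∃ (I : Type u) (L : AMod R A B) (p : copower K I ⟶ L) (i : N ⟶ L),
    Function.Surjective p.toLinearMap ∧ Function.Injective i.toLinearMap

variable (R A B) in
/-- The (full) subcategory `M_B` of unital right `B`-modules. -/
def unital : ObjectProperty (AMod R A B) := fun N => N.IsUnital

/-- The (full) subcategory `σ[K]` of `K`-subgenerated unital right `B`-modules. -/
def sigma (K : AMod R A B) : ObjectProperty (AMod R A B) :=
  fun N => N.IsUnital ∧ IsSubgenerated K N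

/-- Restriction of scalars along a morphism of `A`-rings. -/
def restrict (f : ARingHom R A B B') : AMod R A B' ⥤ AMod R A B where
  obj M :=
    { carrier := M.carrier
      act := M.act.compl₂ f.toLinearMap
      act_act := fun m x y => by simp [M.act_act, f.map_mul]
      op_smul_act := fun a m x => by simp [M.op_smul_act, f.map_smul]
      act_op_smul := fun a m x => by simp [M.act_op_smul, f.map_op_smul] }
  map g := ⟨g.toLinearMap, fun m x => g.map_act m (f.toLinearMap x)⟩

end AMod

/-! ### Corings, their left dual rings, and measuring pairings -/

section Coring

variable (R A W : Type*) [CommRing R] [Ring A] [Algebra R A]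
  [AddCommGroup W] [Module R W] [Module A W] [Module Aᵐᵒᵖ W]
  [IsScalarTower R A W] [IsScalarTower R Aᵐᵒᵖ W] [SMulCommClass A Aᵐᵒᵖ W]

variable {R A W} in
/-- The bilinear map `(x, y) ↦ e(x) y`. -/
def Coring.contractLeft (e : W →ₗ[R] A) : W →ₗ[R] W →ₗ[R] W :=
  (Algebra.lsmul R R W).toLinearMap ∘ₗ e

variable {R A W} in
/-- The bilinear map `(x, y) ↦ x e(y)`. -/
def Coring.contractRight (e : W →ₗ[R] A) : W →ₗ[R] W →ₗ[R] W :=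
  ((Algebra.lsmul R R W).toLinearMap ∘ₗ (opLinearEquiv R).toLinearMap ∘ₗ e).flip

variable {R A W} in
@[simp] theorem Coring.contractLeft_apply (e : W →ₗ[R] A) (x y : W) :
    contractLeft e x y = e x • y := rfl

variable {R A W} in
@[simp] theorem Coring.contractRight_apply (e : W →ₗ[R] A) (x y : W) :
    contractRight e x y = op (e y) • x := rfl

variable {R A W} in
theorem Coring.contractLeft_balanced (e : W →ₗ[R] A) (h : ∀ (a : A) w, e (op a • w) = e w * a)
    (x : W) (a : A) (y : W) : contractLeft e (op a • x) y = contractLeft e x (a • y) := by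
  simp [h, mul_smul]

variable {R A W} in
theorem Coring.contractRight_balanced (e : W →ₗ[R] A) (h : ∀ (a : A) w, e (a • w) = a * e w)
    (x : W) (a : A) (y : W) : contractRight e (op a • x) y = contractRight e x (a • y) := by
  simp [h, mul_smul]

/-- A (coassociative, counital) `A`-coring structure on the `A`-bimodule `W`. -/
class Coring where
  comul : W →ₗ[R] ATensor R A W W
  counit : W →ₗ[R] A
  comul_smul : ∀ (a : A) w, comul (a • w) = a • comul w
  comul_op_smul : ∀ (a : A) w, comul (op a • w) = op a • comul w
  counit_smul : ∀ (a : A) w, counit (a • w) = a * counit w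
  counit_op_smul : ∀ (a : A) w, counit (op a • w) = counit w * a
  coassoc : ∀ w,
    ATensor.assoc (ATensor.map comul comul_op_smul LinearMap.id (fun _ _ => rfl) (comul w)) =
      ATensor.map LinearMap.id (fun _ _ => rfl) comul comul_smul (comul w)
  /-- `∑ ε(w₁) w₂ = w` -/
  counit_comul : ∀ w,
    ATensor.lift (Coring.contractLeft counit)
      (Coring.contractLeft_balanced counit counit_op_smul) (comul w) = w
  /-- `∑ w₁ ε(w₂) = w` -/
  comul_counit : ∀ w,
    ATensor.lift (Coring.contractRight counit)
      (Coring.contractRight_balanced counit counit_smul) (comul w) = w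

/-- The left dual `*W` of left `A`-linear maps `W → A`. -/
def LeftDual (_R : Type*) (A W : Type*) [Ring A] [AddCommGroup W] [Module A W] : Type _ := W →ₗ[A] A

end Coring

namespace LeftDual

variable {R A W : Type*} [CommRing R] [Ring A] [Algebra R A]
  [AddCommGroup W] [Module R W] [Module A W] [Module Aᵐᵒᵖ W]
  [IsScalarTower R A W] [IsScalarTower R Aᵐᵒᵖ W] [SMulCommClass A Aᵐᵒᵖ W]

instance : AddCommGroup (LeftDual R A W) := inferInstanceAs (AddCommGroup (W →ₗ[A] A))
instance : Module R (LeftDual R A W) := inferInstanceAs (Module R (W →ₗ[A] A))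
instance : FunLike (LeftDual R A W) W A := inferInstanceAs (FunLike (W →ₗ[A] A) W A)
instance : LinearMapClass (LeftDual R A W) A W A :=
  inferInstanceAs (LinearMapClass (W →ₗ[A] A) A W A)

@[ext] theorem ext {f g : LeftDual R A W} (h : ∀ w, f w = g w) : f = g := LinearMap.ext h

@[simp] theorem add_apply (f g : LeftDual R A W) (w : W) : (f + g) w = f w + g w := rfl
@[simp] theorem zero_apply (w : W) : (0 : LeftDual R A W) w = 0 := rfl
@[simp] theorem rsmul_apply (r : R) (f : LeftDual R A W) (w : W) : (r • f) w = r • f w := rfl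

/-- The right `A`-action `(f a)(w) = f(w) a`. -/
instance : Module Aᵐᵒᵖ (LeftDual R A W) := inferInstanceAs (Module Aᵐᵒᵖ (W →ₗ[A] A))

@[simp] theorem op_smul_apply (a : A) (f : LeftDual R A W) (w : W) : (op a • f) w = f w * a := rfl

/-- The left `A`-action `(a f)(w) = f(w a)`. -/
instance : Module A (LeftDual R A W) where
  smul a f := ((f : W →ₗ[A] A) ∘ₗ
    { toFun := fun w => op a • w
      map_add' := smul_add _
      map_smul' := fun b w => (smul_comm b (op a) w).symm } : W →ₗ[A] A)
  one_smul f := ext fun w => congrArg f (one_smul _ w)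
  mul_smul a b f := ext fun w => congrArg f (mul_smul (op b) (op a) w)
  smul_zero _ := rfl
  smul_add _ _ _ := rfl
  add_smul a b f := ext fun w => (congrArg f (add_smul (op a) (op b) w)).trans (map_add f _ _)
  zero_smul f := ext fun w => (congrArg f (zero_smul Aᵐᵒᵖ w)).trans (map_zero f)

@[simp] theorem smul_apply (a : A) (f : LeftDual R A W) (w : W) : (a • f) w = f (op a • w) := rfl

theorem map_rsmul (f : LeftDual R A W) (r : R) (w : W) : f (r • w) = r • f w :=
  LinearMap.map_smul_of_tower (f : W →ₗ[A] A) r w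

/-- The map `∑ u ⊗ v ↦ ∑ u f(v)` from `W ⊗_A W` to `W`. -/
def contract (f : LeftDual R A W) : ATensor R A W W →ₗ[R] W :=
  ATensor.lift (Coring.contractRight ((f : W →ₗ[A] A).restrictScalars R))
    (Coring.contractRight_balanced _ (fun a w => map_smul f a w))

@[simp] theorem contract_tmul (f : LeftDual R A W) (u v : W) :
    contract f (ATensor.tmul R A u v) = op (f v) • u := rfl

theorem contract_smul (f : LeftDual R A W) (a : A) (t : ATensor R A W W) :
    contract f (a • t) = a • contract f t := by
  induction t using ATensor.induction with
  | h0 => simp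
  | h1 u v => simp [smul_comm]
  | h2 s t hs ht => simp [hs, ht]

variable [Coring R A W]

/-- The right action `w ↼ f = ∑ w₁ f(w₂)` of `*W` on `W`. -/
def act (f : LeftDual R A W) : W →ₗ[R] W :=
  contract f ∘ₗ Coring.comul (A := A)

theorem act_apply (f : LeftDual R A W) (w : W) : act f w = contract f (Coring.comul w) := rfl

theorem act_smul (f : LeftDual R A W) (a : A) (w : W) : act f (a • w) = a • act f w := by
  rw [act_apply, Coring.comul_smul, contract_smul, act_apply]

/-- The multiplication `(f ⋆ g)(w) = ∑ g(w₁ f(w₂))` of `*W`. -/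
instance : Mul (LeftDual R A W) where
  mul f g :=
    ({ toFun := fun w => g (act f w)
       map_add' := fun w w' => by simp
       map_smul' := fun a w => by simp [act_smul] } : W →ₗ[A] A)

theorem mul_apply (f g : LeftDual R A W) (w : W) : (f * g) w = g (act f w) := rfl

theorem act_op_smul (f : LeftDual R A W) (a : A) (w : W) :
    act f (op a • w) = act (a • f) w := by
  rw [act_apply, act_apply, Coring.comul_op_smul]
  induction Coring.comul (R := R) (A := A) w using ATensor.induction with
  | h0 => simp
  | h1 u v => simp
  | h2 s t hs ht => simp only [smul_add, map_add, hs, ht]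

theorem op_smul_act (f : LeftDual R A W) (a : A) (w : W) :
    act (op a • f) w = op a • act f w := by
  rw [act_apply, act_apply]
  induction Coring.comul (R := R) (A := A) w using ATensor.induction with
  | h0 => simp
  | h1 u v => simp [mul_smul]
  | h2 s t hs ht => simp only [smul_add, map_add, hs, ht]

theorem act_add (f g : LeftDual R A W) (w : W) : act (f + g) w = act f w + act g w := by
  rw [act_apply, act_apply, act_apply]
  induction Coring.comul (R := R) (A := A) w using ATensor.induction with
  | h0 => simp
  | h1 u v => simp [add_smul]
  | h2 s t hs ht => simp only [map_add, hs, ht]; abel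

theorem act_rsmul (r : R) (f : LeftDual R A W) (w : W) : act (r • f) w = r • act f w := by
  rw [act_apply, act_apply]
  induction Coring.comul (R := R) (A := A) w using ATensor.induction with
  | h0 => simp
  | h1 u v => simp
  | h2 s t hs ht => simp only [map_add, smul_add, hs, ht]

theorem act_act (f g : LeftDual R A W) (w : W) : act g (act f w) = act (f * g) w := by
  have h := congrArg (contract g ∘ₗ ATensor.map LinearMap.id (fun _ _ => rfl) (contract f)
    (contract_smul f)) (Coring.coassoc (R := R) (A := A) w)
  rw [act_apply, act_apply, act_apply]
  trans
  · have key : ∀ t : ATensor R A W W, contract g (Coring.comul (contract f t)) =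
        (contract g ∘ₗ ATensor.map LinearMap.id (fun _ _ => rfl) (contract f) (contract_smul f))
          (ATensor.assoc (ATensor.map Coring.comul Coring.comul_op_smul LinearMap.id
            (fun _ _ => rfl) t)) := by
      intro t
      induction t using ATensor.induction with
      | h0 => simp
      | h1 u v =>
        simp only [contract_tmul, Coring.comul_op_smul, ATensor.map_tmul, LinearMap.id_apply]
        induction Coring.comul (R := R) (A := A) u using ATensor.induction with
        | h0 => simp
        | h1 x y => simp
        | h2 s t hs ht => simp only [smul_add, map_add, ATensor.add_tmul, hs, ht]
      | h2 s t hs ht => simp only [map_add, hs, ht]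
    exact key _
  · refine h.trans ?_
    induction Coring.comul (R := R) (A := A) w using ATensor.induction with
    | h0 => simp
    | h1 u v => rfl
    | h2 s t hs ht => simp only [map_add, hs, ht]

instance : NonUnitalRing (LeftDual R A W) where
  left_distrib f g h := rfl
  right_distrib f g h := ext fun w => by simp [mul_apply, act_add]
  zero_mul f := ext fun w => by
    rw [mul_apply, show (0 : LeftDual R A W) = (0 : R) • 0 by simp, act_rsmul]
    simp
  mul_zero f := rfl
  mul_assoc f g h := ext fun w => by simp only [mul_apply, act_act]

instance : IsARing R A (LeftDual R A W) where
  smul_assoc r a f := ext fun w => by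
    simp only [smul_apply, rsmul_apply, op_smul, smul_assoc, map_rsmul]
  isScalarTower_op := inferInstanceAs (IsScalarTower R Aᵐᵒᵖ (W →ₗ[A] A))
  smul_comm a b f := rfl
  smul_mul a f g := ext fun w => by simp [mul_apply, act_op_smul]
  mul_op_smul a f g := rfl
  op_smul_mul a f g := ext fun w => by simp [mul_apply, op_smul_act]

variable (R A W) in
/-- The counit of a coring, as an element of its left dual; it is the unity of `*W`. -/
def counit : LeftDual R A W :=
  ({ toFun := Coring.counit (R := R) (A := A)
     map_add' := map_add _
     map_smul' := Coring.counit_smul } : W →ₗ[A] A)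

end LeftDual

/-- The right `*W`-module `W` of a coring `W`, with `w ↼ f = ∑ w₁ f(w₂)`. -/
def Coring.regular (R A W : Type u) [CommRing R] [Ring A] [Algebra R A]
    [AddCommGroup W] [Module R W] [Module A W] [Module Aᵐᵒᵖ W]
    [IsScalarTower R A W] [IsScalarTower R Aᵐᵒᵖ W] [SMulCommClass A Aᵐᵒᵖ W] [Coring R A W] :
    AMod R A (LeftDual R A W) where
  carrier := W
  act := LinearMap.mk₂ R (fun w f => LeftDual.act f w) (fun _ _ _ => map_add _ _ _)
    (fun _ _ _ => LinearMap.map_smul _ _ _) (fun w f g => LeftDual.act_add f g w)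
    (fun r w f => LeftDual.act_rsmul r f w)
  act_act w f g := LeftDual.act_act f g w
  op_smul_act a w f := LeftDual.act_op_smul f a w
  act_op_smul a w f := LeftDual.op_smul_act f a w

section Pairing

variable {R A B W : Type u} [CommRing R] [Ring A] [Algebra R A]
  [NonUnitalRing B] [Module R B] [Module A B] [Module Aᵐᵒᵖ B] [IsARing R A B]
  [AddCommGroup W] [Module R W] [Module A W] [Module Aᵐᵒᵖ W]
  [IsScalarTower R A W] [IsScalarTower R Aᵐᵒᵖ W] [SMulCommClass A Aᵐᵒᵖ W] [Coring R A W]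

/-- A measuring left `A`-pairing `(B, W)` is given by a morphism of `A`-rings `κ : B → *W`
that sends the unity of `B`, if there is one, to the unity `ε` of `*W`. -/
structure IsMeasuringPairing (κ : B → LeftDual R A W) : Prop where
  isARingHom : ∃ f : ARingHom R A B (LeftDual R A W), ∀ x, f.toLinearMap x = κ x
  map_unity : ∀ e : B, (∀ x, e * x = x ∧ x * e = x) → κ e = LeftDual.counit R A W

/-- The bilinear map `(m, w) ↦ m ⟨x, w⟩`, where `⟨x, w⟩ = κ(x)(w)`. -/
def alphaAux (κ : B → LeftDual R A W) (M : Type u) [AddCommGroup M] [Module R M]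
    [Module Aᵐᵒᵖ M] [IsScalarTower R Aᵐᵒᵖ M] (x : B) : M →ₗ[R] W →ₗ[R] M :=
  LinearMap.mk₂ R (fun (m : M) (w : W) => op (κ x w) • m) (fun _ _ _ => smul_add _ _ _)
    (fun r m w => smul_comm _ _ _) (fun m w w' => by simp [add_smul])
    (fun r m w => by rw [LeftDual.map_rsmul, op_smul, smul_assoc])

theorem alphaAux_balanced (κ : B → LeftDual R A W) (M : Type u) [AddCommGroup M] [Module R M]
    [Module Aᵐᵒᵖ M] [IsScalarTower R Aᵐᵒᵖ M] (x : B) (m : M) (a : A) (w : W) :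
    alphaAux κ M x (op a • m) w = alphaAux κ M x m (a • w) := by
  simp [alphaAux, mul_smul]

/-- The map `α_M : M ⊗_A W → Hom_{-A}(B, M)`, `m ⊗ w ↦ [x ↦ m ⟨x, w⟩]`, evaluated at `x`. -/
def alphaMap (κ : B → LeftDual R A W) (M : Type u) [AddCommGroup M] [Module R M]
    [Module Aᵐᵒᵖ M] [IsScalarTower R Aᵐᵒᵖ M] (t : ATensor R A M W) (x : B) : M :=
  ATensor.lift (alphaAux κ M x) (alphaAux_balanced κ M x) t

/-- The left `α`-condition: `α_M` is injective for every right `A`-module `M`. -/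
def AlphaCondition (κ : B → LeftDual R A W) : Prop :=
  ∀ (M : Type u) [AddCommGroup M] [Module R M] [Module Aᵐᵒᵖ M] [IsScalarTower R Aᵐᵒᵖ M],
    Function.Injective (alphaMap κ M)

end Pairing
/-! ### Doi-Koppinen structures -/

section DoiKoppinen

variable (R H A C : Type u) [CommRing R] [Ring H] [Bialgebra R H] [Ring A] [Algebra R A]
  [AddCommGroup C] [Module R C] [Coalgebra R C]

/-- A right-right Doi-Koppinen structure `(H, A, C)`: a bialgebra `H`, a right `H`-comodule
algebra `A` and a right `H`-module coalgebra `C`. -/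
structure DoiKoppinen where
  /-- the coaction `a ↦ ∑ a₀ ⊗ a₁`, an algebra morphism -/
  coact : A →ₐ[R] A ⊗[R] H
  coact_coassoc : ∀ a, TensorProduct.assoc R A H H (coact.toLinearMap.rTensor H (coact a)) =
    (Coalgebra.comul (R := R) (A := H)).lTensor A (coact a)
  coact_counit : ∀ a, (Coalgebra.counit (R := R) (A := H)).lTensor A (coact a) = a ⊗ₜ[R] (1 : R)
  /-- the action `c ⊗ h ↦ c h`, a coalgebra morphism -/
  act : C ⊗[R] H →ₗc[R] C
  act_one : ∀ c, act (c ⊗ₜ 1) = c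
  act_mul : ∀ c (h k : H), act (c ⊗ₜ (h * k)) = act (act (c ⊗ₜ h) ⊗ₜ k)

end DoiKoppinen

/-- For a right `A`-module `M`, the action `m ⊗ a ↦ m a`. -/
def rightMul (R A M : Type*) [CommRing R] [Ring A] [Algebra R A] [AddCommGroup M] [Module R M]
    [Module Aᵐᵒᵖ M] [IsScalarTower R Aᵐᵒᵖ M] : M ⊗[R] A →ₗ[R] M :=
  TensorProduct.lift
    ((Algebra.lsmul R R M).toLinearMap ∘ₗ (opLinearEquiv R : A ≃ₗ[R] Aᵐᵒᵖ).toLinearMap).flip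

@[simp] theorem rightMul_tmul (R A M : Type*) [CommRing R] [Ring A] [Algebra R A]
    [AddCommGroup M] [Module R M] [Module Aᵐᵒᵖ M] [IsScalarTower R Aᵐᵒᵖ M] (m : M) (a : A) :
    rightMul R A M (m ⊗ₜ a) = op a • m := rfl

/-- The left `A`-linear map `A ⊗ C → N`, `a ⊗ c ↦ a f(c)`, given by an `R`-linear `f : C → N`. -/
def extendLeft {R A C N : Type*} [CommRing R] [Ring A] [Algebra R A] [AddCommGroup C] [Module R C]
    [AddCommGroup N] [Module R N] [Module A N] [IsScalarTower R A N] (f : C →ₗ[R] N) :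
    A ⊗[R] C →ₗ[A] N where
  toFun := TensorProduct.lift ((Algebra.lsmul R R N).toLinearMap.compl₂ f)
  map_add' := map_add _
  map_smul' a t := by
    induction t with
    | zero => simp
    | add s t hs ht => simp only [smul_add, map_add, hs, ht]
    | tmul b c => simp [smul_tmul']

@[simp] theorem extendLeft_tmul {R A C N : Type*} [CommRing R] [Ring A] [Algebra R A]
    [AddCommGroup C] [Module R C] [AddCommGroup N] [Module R N] [Module A N] [IsScalarTower R A N]
    (f : C →ₗ[R] N) (a : A) (c : C) : extendLeft f (a ⊗ₜ[R] c) = a • f c := rfl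

theorem extendLeft_rsmul {R A C N : Type*} [CommRing R] [Ring A] [Algebra R A]
    [AddCommGroup C] [Module R C] [AddCommGroup N] [Module R N] [Module A N] [IsScalarTower R A N]
    (f : C →ₗ[R] N) (r : R) (t : A ⊗[R] C) : extendLeft f (r • t) = r • extendLeft f t :=
  LinearMap.map_smul_of_tower _ r t

namespace DoiKoppinen

variable {R H A C : Type u} [CommRing R] [Ring H] [Bialgebra R H] [Ring A] [Algebra R A]
  [AddCommGroup C] [Module R C] [Coalgebra R C] (D : DoiKoppinen R H A C)

/-- For a right `A`-module `M`, the map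
`(m ⊗ c) ⊗ (a ⊗ h) ↦ m a ⊗ c h` from `(M ⊗ C) ⊗ (A ⊗ H)` to `M ⊗ C`. -/
def diag (M : Type*) [AddCommGroup M] [Module R M] [Module Aᵐᵒᵖ M] [IsScalarTower R Aᵐᵒᵖ M] :
    (M ⊗[R] C) ⊗[R] (A ⊗[R] H) →ₗ[R] M ⊗[R] C :=
  TensorProduct.map (rightMul R A M) D.act.toLinearMap ∘ₗ
    (TensorProduct.tensorTensorTensorComm R M C A H).toLinearMap

@[simp] theorem diag_tmul (M : Type*) [AddCommGroup M] [Module R M] [Module Aᵐᵒᵖ M]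
    [IsScalarTower R Aᵐᵒᵖ M] (m : M) (c : C) (a : A) (h : H) :
    D.diag M ((m ⊗ₜ c) ⊗ₜ (a ⊗ₜ h)) = (op a • m) ⊗ₜ[R] D.act (c ⊗ₜ h) := rfl

/-- The map `c ↦ c h` for a fixed `h`, linear in `h`. -/
def actH : H →ₗ[R] C →ₗ[R] C := (TensorProduct.curry D.act.toLinearMap).flip

@[simp] theorem actH_apply (h : H) (c : C) : D.actH h c = D.act (c ⊗ₜ h) := rfl

/-- The entwining map `ψ(c ⊗ a) = ∑ a₀ ⊗ c a₁`. -/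
def psi : C →ₗ[R] A →ₗ[R] A ⊗[R] C :=
  LinearMap.mk₂ R (fun c a => (D.actH.flip c).lTensor A (D.coact a))
    (fun c c' a => by simp [LinearMap.lTensor_add]) (fun r c a => by simp [LinearMap.lTensor_smul])
    (fun c a a' => by simp) (fun r c a => by simp)

theorem psi_apply (c : C) (a : A) : D.psi c a = (D.actH.flip c).lTensor A (D.coact a) := rfl

theorem psi_one (c : C) : D.psi c 1 = 1 ⊗ₜ c := by
  rw [psi_apply, map_one]
  exact congrArg (fun x => (1 : A) ⊗ₜ[R] x) (D.act_one c)

/-- `a ⊗ c ↦ ∑ a b₀ ⊗ c b₁`, the right action of `b` on `A ⊗ C`. -/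
def coringAct (b : A) : A ⊗[R] C →ₗ[A] A ⊗[R] C := extendLeft (D.psi.flip b)

@[simp] theorem coringAct_tmul (b a : A) (c : C) :
    D.coringAct b (a ⊗ₜ c) = a • D.psi c b := rfl

theorem psi_mul (c : C) (a b : A) : D.psi c (a * b) = D.coringAct b (D.psi c a) := by
  rw [psi_apply, psi_apply, map_mul]
  induction D.coact a with
  | zero => simp
  | add s t hs ht => simp only [add_mul, map_add, hs, ht]
  | tmul x h =>
    rw [LinearMap.lTensor_tmul, coringAct_tmul, psi_apply]
    induction D.coact b with
    | zero => simp
    | add s t hs ht => simp only [mul_add, map_add, smul_add, hs, ht]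
    | tmul y k => simp [D.act_mul, smul_tmul']

theorem coringAct_one (t : A ⊗[R] C) : D.coringAct 1 t = t := by
  induction t with
  | zero => simp
  | add s t hs ht => simp only [map_add, hs, ht]
  | tmul a c => simp [psi_one, smul_tmul']

theorem coringAct_mul (a b : A) (t : A ⊗[R] C) :
    D.coringAct (a * b) t = D.coringAct b (D.coringAct a t) := by
  induction t with
  | zero => simp
  | add s t hs ht => simp only [map_add, hs, ht]
  | tmul x c => simp [psi_mul]

theorem coringAct_add (a b : A) (t : A ⊗[R] C) :
    D.coringAct (a + b) t = D.coringAct a t + D.coringAct b t := by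
  induction t with
  | zero => simp
  | add s t hs ht => simp only [map_add, hs, ht]; abel
  | tmul x c => simp

theorem coringAct_rsmul (r : R) (a : A) (t : A ⊗[R] C) :
    D.coringAct (r • a) t = r • D.coringAct a t := by
  induction t with
  | zero => simp
  | add s t hs ht => simp only [map_add, smul_add, hs, ht]
  | tmul x c => rw [coringAct_tmul, coringAct_tmul, LinearMap.map_smul, smul_comm]

theorem coringAct_zero (t : A ⊗[R] C) : D.coringAct 0 t = 0 := by
  rw [← zero_smul R (0 : A), coringAct_rsmul, zero_smul]

/-- `∑ a_ψ ε(c^ψ) = ε(c) a`. -/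
theorem psi_counit (c : C) (a : A) :
    extendLeft (Algebra.linearMap R A ∘ₗ Coalgebra.counit) (D.psi c a) =
      Coalgebra.counit (R := R) c • a := by
  have h1 : ∀ t : A ⊗[R] H, extendLeft (Algebra.linearMap R A ∘ₗ Coalgebra.counit)
      ((D.actH.flip c).lTensor A t) = Coalgebra.counit (R := R) c •
        TensorProduct.rid R A ((Coalgebra.counit (R := R) (A := H)).lTensor A t) := by
    intro t
    induction t with
    | zero => simp
    | add s t hs ht => simp only [map_add, smul_add, hs, ht]
    | tmul x h =>
      have : Coalgebra.counit (R := R) (D.act (c ⊗ₜ h)) =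
          Coalgebra.counit (R := R) c * Coalgebra.counit (R := R) h := by
        rw [CoalgHomClass.counit_comp_apply]; simp [mul_comm]
      simp [this, Algebra.algebraMap_eq_smul_one, smul_smul]
  rw [psi_apply, h1, D.coact_counit]; simp

theorem comul_act (c : C) (h : H) : Coalgebra.comul (R := R) (D.act (c ⊗ₜ h)) =
    TensorProduct.map D.act.toLinearMap D.act.toLinearMap
      (TensorProduct.tensorTensorTensorComm R C C H H
        (Coalgebra.comul (R := R) c ⊗ₜ Coalgebra.comul (R := R) h)) :=
  (LinearMap.congr_fun D.act.map_comp_comul (c ⊗ₜ h)).symm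

/-- The map `c₁ ⊗ c₂ ↦ ∑ a_ψΨ ⊗ c₁^Ψ ⊗ c₂^ψ`. -/
def psiTwice (a : A) : C ⊗[R] C →ₗ[R] A ⊗[R] (C ⊗[R] C) :=
  TensorProduct.lift (LinearMap.mk₂ R
    (fun c₁ c₂ => TensorProduct.assoc R A C C ((D.psi c₁).rTensor C (D.psi c₂ a)))
    (fun _ _ _ => by simp [LinearMap.rTensor_add]) (fun _ _ _ => by simp [LinearMap.rTensor_smul])
    (fun _ _ _ => by simp) (fun _ _ _ => by simp))

@[simp] theorem psiTwice_tmul (a : A) (c₁ c₂ : C) : D.psiTwice a (c₁ ⊗ₜ c₂) =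
    TensorProduct.assoc R A C C ((D.psi c₁).rTensor C (D.psi c₂ a)) := rfl

/-- `∑ a_ψ ⊗ Δ(c^ψ) = ∑ a_ψΨ ⊗ c₁^Ψ ⊗ c₂^ψ`. -/
theorem psi_comul (c : C) (a : A) :
    (Coalgebra.comul (R := R) (A := C)).lTensor A (D.psi c a) =
      D.psiTwice a (Coalgebra.comul c) := by
  have h1 : ∀ (c₁ c₂ : C) (t : A ⊗[R] H),
      TensorProduct.assoc R A C C ((D.psi c₁).rTensor C ((D.actH.flip c₂).lTensor A t)) =
      (TensorProduct.map (D.actH.flip c₁) (D.actH.flip c₂)).lTensor A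
        (TensorProduct.assoc R A H H (D.coact.toLinearMap.rTensor H t)) := by
    intro c₁ c₂ t
    induction t with
    | zero => simp
    | add s t hs ht => simp only [map_add, hs, ht]
    | tmul x h =>
      simp only [LinearMap.lTensor_tmul, LinearMap.rTensor_tmul, psi_apply, AlgHom.toLinearMap_apply]
      induction D.coact x with
      | zero => simp
      | add s t hs ht => simp only [map_add, add_tmul, hs, ht]
      | tmul y k => simp
  let Φ : C ⊗[R] C →ₗ[R] H ⊗[R] H →ₗ[R] C ⊗[R] C :=
    TensorProduct.homTensorHomMap (RingHom.id R) H H C C ∘ₗ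
      TensorProduct.map D.actH.flip D.actH.flip
  have hΦ : ∀ c₁ c₂, Φ (c₁ ⊗ₜ c₂) = TensorProduct.map (D.actH.flip c₁) (D.actH.flip c₂) :=
    fun _ _ => rfl
  have h2 : ∀ (h : H), Coalgebra.comul (R := R) (D.act (c ⊗ₜ h)) =
      Φ (Coalgebra.comul c) (Coalgebra.comul h) := by
    intro h
    rw [comul_act]
    induction Coalgebra.comul (R := R) c with
    | zero => simp
    | add s t hs ht => simp only [add_tmul, map_add, LinearMap.add_apply, hs, ht]
    | tmul x y =>
      induction Coalgebra.comul (R := R) h with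
      | zero => simp
      | add s t hs ht => simp only [tmul_add, map_add, hs, ht]
      | tmul x y => rfl
  have h3 : ∀ t : A ⊗[R] H,
      (Coalgebra.comul (R := R) (A := C)).lTensor A ((D.actH.flip c).lTensor A t) =
      (Φ (Coalgebra.comul c)).lTensor A ((Coalgebra.comul (R := R) (A := H)).lTensor A t) := by
    intro t
    induction t with
    | zero => simp
    | add s t hs ht => simp only [map_add, hs, ht]
    | tmul x h => simp [h2]
  have h4 : ∀ u : C ⊗[R] C, D.psiTwice a u =
      (Φ u).lTensor A (TensorProduct.assoc R A H H (D.coact.toLinearMap.rTensor H (D.coact a))) := by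
    intro u
    induction u with
    | zero => simp
    | add s t hs ht => simp only [map_add, LinearMap.lTensor_add, LinearMap.add_apply, hs, ht]
    | tmul x y => rw [psiTwice_tmul, psi_apply D y, h1, hΦ]
  rw [psi_apply, h3, h4, D.coact_coassoc]

end DoiKoppinen
/-! ### The coring `A ⊗ C` -/

section DKCoring

variable {R H A C : Type u} [CommRing R] [Ring H] [Bialgebra R H] [Ring A] [Algebra R A]
  [AddCommGroup C] [Module R C] [Coalgebra R C]

/-- The `A`-bimodule `A ⊗ C`, with `b (a ⊗ c) = b a ⊗ c` and `(a ⊗ c) b = ∑ a b₀ ⊗ c b₁`. -/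
def DKCoring (_D : DoiKoppinen R H A C) : Type u := A ⊗[R] C

namespace DKCoring

variable (D : DoiKoppinen R H A C)

instance : AddCommGroup (DKCoring D) := inferInstanceAs (AddCommGroup (A ⊗[R] C))
instance : Module R (DKCoring D) := inferInstanceAs (Module R (A ⊗[R] C))
instance : Module A (DKCoring D) := inferInstanceAs (Module A (A ⊗[R] C))
instance : IsScalarTower R A (DKCoring D) := inferInstanceAs (IsScalarTower R A (A ⊗[R] C))

/-- The identification of `A ⊗ C` with its underlying left `A`-module. -/
def ofTensor : A ⊗[R] C ≃ₗ[A] DKCoring D := LinearEquiv.refl A (A ⊗[R] C)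

theorem ofTensor_rsmul (r : R) (t : A ⊗[R] C) : ofTensor D (r • t) = r • ofTensor D t := rfl

/-- The element `a ⊗ c`, bilinear in `a` and `c`. -/
def tmul : A →ₗ[R] C →ₗ[R] DKCoring D := TensorProduct.mk R A C

theorem ofTensor_tmul (a : A) (c : C) : ofTensor D (a ⊗ₜ[R] c) = tmul D a c := rfl

variable {D} in
theorem induction {p : DKCoring D → Prop} (w : DKCoring D) (h0 : p 0)
    (h1 : ∀ a c, p (tmul D a c)) (h2 : ∀ s t, p s → p t → p (s + t)) : p w :=
  TensorProduct.induction_on (motive := p) w h0 h1 h2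

theorem smul_tmul (a b : A) (c : C) : a • tmul D b c = tmul D (a * b) c := rfl

instance : Module Aᵐᵒᵖ (DKCoring D) where
  smul b w := D.coringAct b.unop w
  one_smul w := D.coringAct_one w
  mul_smul a b w := D.coringAct_mul b.unop a.unop w
  smul_zero b := LinearMap.map_zero (D.coringAct b.unop)
  smul_add b := LinearMap.map_add (D.coringAct b.unop)
  add_smul a b w := D.coringAct_add a.unop b.unop w
  zero_smul w := D.coringAct_zero w

theorem op_smul_tmul (b a : A) (c : C) :
    op b • tmul D a c = a • ofTensor D (D.psi c b) := rfl

instance : SMulCommClass A Aᵐᵒᵖ (DKCoring D) where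
  smul_comm a b w := ((D.coringAct b.unop).map_smul a w).symm

instance : IsScalarTower R Aᵐᵒᵖ (DKCoring D) where
  smul_assoc r b w := D.coringAct_rsmul r b.unop w

/-- The map `c₁ ⊗ c₂ ↦ (a ⊗ c₁) ⊗_A (1 ⊗ c₂)`, linear in `a`. -/
def split (a : A) : C ⊗[R] C →ₗ[R] ATensor R A (DKCoring D) (DKCoring D) :=
  TensorProduct.lift ((ATensor.mk R A (DKCoring D) (DKCoring D)).compl₁₂ (tmul D a) (tmul D 1))

@[simp] theorem split_tmul (a : A) (c₁ c₂ : C) :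
    split D a (c₁ ⊗ₜ c₂) = ATensor.tmul R A (tmul D a c₁) (tmul D 1 c₂) := rfl

theorem split_add (a b : A) (u : C ⊗[R] C) : split D (a + b) u = split D a u + split D b u := by
  induction u with
  | zero => simp
  | add s t hs ht => simp only [map_add, hs, ht]; abel
  | tmul x y => simp [ATensor.add_tmul]

theorem split_rsmul (r : R) (a : A) (u : C ⊗[R] C) : split D (r • a) u = r • split D a u := by
  induction u with
  | zero => simp
  | add s t hs ht => simp only [map_add, smul_add, hs, ht]
  | tmul x y => simp [ATensor.rsmul_tmul]

theorem smul_split (a b : A) (u : C ⊗[R] C) : a • split D b u = split D (a * b) u := by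
  induction u with
  | zero => simp
  | add s t hs ht => simp only [map_add, smul_add, hs, ht]
  | tmul x y => simp [smul_tmul]

/-- `Δ(a ⊗ c) = ∑ (a ⊗ c₁) ⊗_A (1 ⊗ c₂)`. -/
def comul : DKCoring D →ₗ[R] ATensor R A (DKCoring D) (DKCoring D) :=
  TensorProduct.lift (LinearMap.mk₂ R (fun a c => split D a (Coalgebra.comul c))
    (fun _ _ _ => split_add D _ _ _) (fun _ _ _ => split_rsmul D _ _ _)
    (fun _ _ _ => by simp) (fun _ _ _ => by simp))

theorem comul_tmul (a : A) (c : C) : comul D (tmul D a c) = split D a (Coalgebra.comul c) := rfl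

/-- `ε(a ⊗ c) = a ε(c)`. -/
def counit : DKCoring D →ₗ[R] A :=
  (extendLeft (Algebra.linearMap R A ∘ₗ Coalgebra.counit (R := R) (A := C))).restrictScalars R

theorem counit_tmul (a : A) (c : C) :
    counit D (tmul D a c) = a * algebraMap R A (Coalgebra.counit c) := rfl

theorem comul_smul (a : A) (w : DKCoring D) : comul D (a • w) = a • comul D w := by
  induction w using DKCoring.induction with
  | h0 => simp
  | h1 b c => rw [smul_tmul, comul_tmul, comul_tmul, smul_split]
  | h2 s t hs ht => simp only [smul_add, map_add, hs, ht]

theorem comul_psi (b : A) (c : C) :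
    comul D (ofTensor D (D.psi c b)) = op b • split D 1 (Coalgebra.comul c) := by
  have h1 : ∀ t : A ⊗[R] C, comul D (ofTensor D t) =
      extendLeft (split D 1) ((Coalgebra.comul (R := R) (A := C)).lTensor A t) := by
    intro t
    induction t with
    | zero => simp
    | add s t hs ht => simp only [map_add, hs, ht]
    | tmul x d => rw [LinearMap.lTensor_tmul, extendLeft_tmul, smul_split, mul_one, ofTensor_tmul,
        comul_tmul]
  have h2 : ∀ (c₁ : C) (t : A ⊗[R] C), extendLeft (split D 1)
      (TensorProduct.assoc R A C C ((D.psi c₁).rTensor C t)) =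
      ATensor.tmul R A (tmul D 1 c₁) (ofTensor D t) := by
    intro c₁ t
    induction t with
    | zero => simp
    | add s t hs ht => simp only [map_add, ATensor.tmul_add, hs, ht]
    | tmul x d =>
      have h := ATensor.smul_tmul (R := R) x (tmul D 1 c₁) (tmul D 1 d)
      rw [op_smul_tmul, one_smul, smul_tmul, mul_one] at h
      rw [ofTensor_tmul, ← h, LinearMap.rTensor_tmul]
      induction D.psi c₁ x with
      | zero => simp
      | add s t hs ht => simp only [add_tmul, map_add, ATensor.add_tmul, hs, ht]
      | tmul y e =>
        rw [TensorProduct.assoc_tmul, extendLeft_tmul, smul_split, mul_one, split_tmul,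
          ofTensor_tmul]
  rw [h1, D.psi_comul]
  induction Coalgebra.comul (R := R) c with
  | zero => simp
  | add s t hs ht => simp only [map_add, smul_add, hs, ht]
  | tmul x y =>
    rw [D.psiTwice_tmul, h2, split_tmul, ATensor.op_smul_tmul, op_smul_tmul, one_smul]

theorem comul_op_smul (b : A) (w : DKCoring D) : comul D (op b • w) = op b • comul D w := by
  induction w using DKCoring.induction with
  | h0 => simp
  | h1 a c =>
    rw [op_smul_tmul, comul_smul, comul_psi, comul_tmul, ← mul_one a, ← smul_split, mul_one]
    induction Coalgebra.comul (R := R) c with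
    | zero => simp
    | add s t hs ht => simp only [map_add, smul_add, hs, ht]
    | tmul x y => simp
  | h2 s t hs ht => simp only [smul_add, map_add, hs, ht]

theorem counit_smul (a : A) (w : DKCoring D) : counit D (a • w) = a * counit D w :=
  (extendLeft (Algebra.linearMap R A ∘ₗ Coalgebra.counit (R := R) (A := C))).map_smul a w

theorem counit_op_smul (b : A) (w : DKCoring D) : counit D (op b • w) = counit D w * b := by
  induction w using DKCoring.induction with
  | h0 => simp
  | h1 a c =>
    rw [op_smul_tmul, counit_smul, counit_tmul, mul_assoc]
    congr 1
    exact (D.psi_counit c b).trans (Algebra.smul_def _ _)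
  | h2 s t hs ht => simp only [smul_add, map_add, add_mul, hs, ht]

theorem coassoc (w : DKCoring D) :
    ATensor.assoc (ATensor.map (comul D) (comul_op_smul D) LinearMap.id (fun _ _ => rfl)
      (comul D w)) =
    ATensor.map LinearMap.id (fun _ _ => rfl) (comul D) (comul_smul D) (comul D w) := by
  induction w using DKCoring.induction with
  | h0 => simp
  | h2 s t hs ht => simp only [map_add, hs, ht]
  | h1 a c =>
    rw [comul_tmul]
    let Ψ : C ⊗[R] (C ⊗[R] C) →ₗ[R]
        ATensor R A (DKCoring D) (ATensor R A (DKCoring D) (DKCoring D)) :=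
      TensorProduct.lift ((ATensor.mk R A (DKCoring D) (ATensor R A (DKCoring D) (DKCoring D))).compl₁₂
        (tmul D a) (split D 1))
    have h1 : ∀ u : C ⊗[R] C,
        ATensor.assoc (ATensor.map (comul D) (comul_op_smul D) LinearMap.id (fun _ _ => rfl)
          (split D a u)) =
        Ψ (TensorProduct.assoc R C C C ((Coalgebra.comul (R := R) (A := C)).rTensor C u)) := by
      intro u
      induction u with
      | zero => simp
      | add s t hs ht => simp only [map_add, hs, ht]
      | tmul x y =>
        rw [split_tmul, ATensor.map_tmul, comul_tmul, LinearMap.rTensor_tmul]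
        induction Coalgebra.comul (R := R) x with
        | zero => simp
        | add s t hs ht => simp only [map_add, ATensor.add_tmul, add_tmul, hs, ht]
        | tmul p q => rfl
    have h2 : ∀ u : C ⊗[R] C,
        ATensor.map LinearMap.id (fun _ _ => rfl) (comul D) (comul_smul D) (split D a u) =
        Ψ ((Coalgebra.comul (R := R) (A := C)).lTensor C u) := by
      intro u
      induction u with
      | zero => simp
      | add s t hs ht => simp only [map_add, hs, ht]
      | tmul x y => rfl
    rw [h1, h2, Coalgebra.coassoc_apply]

instance : Coring R A (DKCoring D) where
  comul := comul D
  counit := counit D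
  comul_smul := comul_smul D
  comul_op_smul := comul_op_smul D
  counit_smul := counit_smul D
  counit_op_smul := counit_op_smul D
  coassoc := coassoc D
  counit_comul w := by
    induction w using DKCoring.induction with
    | h0 => simp
    | h2 s t hs ht => simp only [map_add, hs, ht]
    | h1 a c =>
      have h1 : ∀ u : C ⊗[R] C, ATensor.lift (Coring.contractLeft (counit D))
          (Coring.contractLeft_balanced _ (counit_op_smul D)) (split D a u) =
          tmul D a (TensorProduct.lid R C ((Coalgebra.counit (R := R) (A := C)).rTensor C u)) := by
        intro u
        induction u with
        | zero => simp
        | add s t hs ht => simp only [map_add, hs, ht]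
        | tmul x y =>
          simp only [split_tmul, ATensor.lift_tmul, Coring.contractLeft_apply, counit_tmul,
            smul_tmul, mul_one, LinearMap.rTensor_tmul, TensorProduct.lid_tmul, map_smul]
          rw [← Algebra.commutes, ← Algebra.smul_def, map_smul, LinearMap.smul_apply]
      rw [comul_tmul, h1, Coalgebra.rTensor_counit_comul]
      simp
  comul_counit w := by
    induction w using DKCoring.induction with
    | h0 => simp
    | h2 s t hs ht => simp only [map_add, hs, ht]
    | h1 a c =>
      have h1 : ∀ u : C ⊗[R] C, ATensor.lift (Coring.contractRight (counit D))
          (Coring.contractRight_balanced _ (counit_smul D)) (split D a u) =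
          tmul D a (TensorProduct.rid R C ((Coalgebra.counit (R := R) (A := C)).lTensor C u)) := by
        intro u
        induction u with
        | zero => simp
        | add s t hs ht => simp only [map_add, hs, ht]
        | tmul x y =>
          simp only [split_tmul, ATensor.lift_tmul, Coring.contractRight_apply, counit_tmul,
            one_mul, LinearMap.lTensor_tmul, TensorProduct.rid_tmul, map_smul]
          rw [Algebra.algebraMap_eq_smul_one, op_smul, smul_assoc, op_one, one_smul]
      rw [comul_tmul, h1, Coalgebra.lTensor_counit_comul]
      simp

end DKCoring

end DKCoring
/-! ### The `A`-ring `#ᵒᵖ(C, A)` -/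

section OpHom

variable {R H A C : Type u} [CommRing R] [Ring H] [Bialgebra R H] [Ring A] [Algebra R A]
  [AddCommGroup C] [Module R C] [Coalgebra R C]

/-- The `A`-ring `#ᵒᵖ(C, A) = Hom_R(C, A)` of a Doi-Koppinen structure. -/
def OpHom (_D : DoiKoppinen R H A C) : Type u := C →ₗ[R] A

namespace OpHom

variable (D : DoiKoppinen R H A C)

instance : AddCommGroup (OpHom D) := inferInstanceAs (AddCommGroup (C →ₗ[R] A))
instance : Module R (OpHom D) := inferInstanceAs (Module R (C →ₗ[R] A))
instance : FunLike (OpHom D) C A := inferInstanceAs (FunLike (C →ₗ[R] A) C A)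
instance : LinearMapClass (OpHom D) R C A := inferInstanceAs (LinearMapClass (C →ₗ[R] A) R C A)

/-- The right `A`-action `(f a)(c) = f(c) a`. -/
instance : Module Aᵐᵒᵖ (OpHom D) := inferInstanceAs (Module Aᵐᵒᵖ (C →ₗ[R] A))

/-- The underlying `R`-linear map. -/
def toLin : OpHom D ≃ₗ[R] (C →ₗ[R] A) := LinearEquiv.refl R (C →ₗ[R] A)

variable {D}

@[simp] theorem toLin_apply (f : OpHom D) (c : C) : toLin D f c = f c := rfl

@[simp] theorem toLin_symm_apply (f : C →ₗ[R] A) (c : C) : (toLin D).symm f c = f c := rfl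

@[ext] theorem ext {f g : OpHom D} (h : ∀ c, f c = g c) : f = g := LinearMap.ext h

@[simp] theorem add_apply (f g : OpHom D) (c : C) : (f + g) c = f c + g c := rfl
@[simp] theorem zero_apply (c : C) : (0 : OpHom D) c = 0 := rfl
@[simp] theorem rsmul_apply (r : R) (f : OpHom D) (c : C) : (r • f) c = r • f c := rfl
@[simp] theorem op_smul_apply (a : A) (f : OpHom D) (c : C) : (op a • f) c = f c * a := rfl

/-- The left `A`-action `(a f)(c) = ∑ a₀ f(c a₁)`. -/
instance : SMul A (OpHom D) where
  smul a f := (toLin D).symm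
    ((extendLeft (toLin D f)).restrictScalars R ∘ₗ D.psi.flip a)

theorem smul_apply (a : A) (f : OpHom D) (c : C) :
    (a • f) c = extendLeft (toLin D f) (D.psi c a) := rfl

/-- The map `c₁ ⊗ c₂ ↦ ∑ f(c₂)₀ ⊗ c₁ f(c₂)₁`. -/
def conv (f : OpHom D) : C ⊗[R] C →ₗ[R] A ⊗[R] C :=
  TensorProduct.lift (D.psi.compl₂ (toLin D f))

@[simp] theorem conv_tmul (f : OpHom D) (c₁ c₂ : C) : conv f (c₁ ⊗ₜ c₂) = D.psi c₁ (f c₂) := rfl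

/-- The multiplication `(f g)(c) = ∑ f(c₂)₀ g(c₁ f(c₂)₁)`. -/
instance : Mul (OpHom D) where
  mul f g := (toLin D).symm
    ((extendLeft (toLin D g)).restrictScalars R ∘ₗ conv f ∘ₗ Coalgebra.comul)

theorem mul_apply (f g : OpHom D) (c : C) :
    (f * g) c = extendLeft (toLin D g) (conv f (Coalgebra.comul c)) := rfl

/-- The isomorphism `φ : #ᵒᵖ(C, A) → *(A ⊗ C)`, `f ↦ [a ⊗ c ↦ a f(c)]`. -/
def phi (f : OpHom D) : LeftDual R A (DKCoring D) :=
  (extendLeft (toLin D f) ∘ₗ (DKCoring.ofTensor D).symm.toLinearMap : DKCoring D →ₗ[A] A)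

@[simp] theorem phi_ofTensor (f : OpHom D) (t : A ⊗[R] C) :
    phi f (DKCoring.ofTensor D t) = extendLeft (toLin D f) t := rfl

@[simp] theorem phi_tmul (f : OpHom D) (a : A) (c : C) :
    phi f (DKCoring.tmul D a c) = a * f c := rfl

theorem phi_injective : Function.Injective (phi (D := D)) := fun f g h => ext fun c => by
  simpa using congrArg (fun k => k (DKCoring.tmul D 1 c)) h

theorem dual_ext {f g : LeftDual R A (DKCoring D)}
    (h : ∀ c, f (DKCoring.tmul D 1 c) = g (DKCoring.tmul D 1 c)) : f = g := by
  ext w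
  induction w using DKCoring.induction with
  | h0 => rw [map_zero, map_zero]
  | h1 a c =>
    have : DKCoring.tmul D a c = a • DKCoring.tmul D 1 c := by
      rw [DKCoring.smul_tmul, mul_one]
    rw [this, map_smul, map_smul, h]
  | h2 s t hs ht => rw [map_add, map_add, hs, ht]

theorem phi_add (f g : OpHom D) : phi (f + g) = phi f + phi g :=
  dual_ext fun c => by simp

theorem phi_rsmul (r : R) (f : OpHom D) : phi (r • f) = r • phi f :=
  dual_ext fun c => by simp

theorem phi_zero : phi (0 : OpHom D) = 0 := dual_ext fun c => by simp

theorem phi_op_smul (a : A) (f : OpHom D) : phi (op a • f) = op a • phi f :=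
  dual_ext fun c => by simp

theorem phi_smul (a : A) (f : OpHom D) : phi (a • f) = a • phi f :=
  dual_ext fun c => by
    rw [LeftDual.smul_apply, DKCoring.op_smul_tmul, one_smul, phi_ofTensor, phi_tmul, one_mul,
      smul_apply]

theorem act_phi (f : OpHom D) (c : C) :
    LeftDual.act (phi f) (DKCoring.tmul D 1 c) =
      DKCoring.ofTensor D (conv f (Coalgebra.comul c)) := by
  have h : LeftDual.act (phi f) (DKCoring.tmul D 1 c) =
      LeftDual.contract (phi f) (DKCoring.split D 1 (Coalgebra.comul c)) := rfl
  rw [h]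
  induction Coalgebra.comul (R := R) c with
  | zero => simp
  | add s t hs ht => simp only [map_add, hs, ht]
  | tmul x y =>
    rw [DKCoring.split_tmul, LeftDual.contract_tmul, phi_tmul, one_mul, DKCoring.op_smul_tmul,
      one_smul, conv_tmul]

theorem phi_mul (f g : OpHom D) : phi (f * g) = phi f * phi g :=
  dual_ext fun c => by
    rw [LeftDual.mul_apply, act_phi, phi_ofTensor, phi_tmul, one_mul, mul_apply]

instance : Module A (OpHom D) where
  one_smul f := phi_injective (by rw [phi_smul, one_smul])
  mul_smul a b f := phi_injective (by simp only [phi_smul, mul_smul])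
  smul_zero a := phi_injective (by rw [phi_smul, phi_zero, smul_zero])
  smul_add a f g := phi_injective (by simp only [phi_smul, phi_add, smul_add])
  add_smul a b f := phi_injective (by simp only [phi_smul, phi_add, add_smul])
  zero_smul f := phi_injective (by rw [phi_smul, phi_zero, zero_smul])

instance : NonUnitalRing (OpHom D) where
  left_distrib f g h := phi_injective (by simp only [phi_mul, phi_add, mul_add])
  right_distrib f g h := phi_injective (by simp only [phi_mul, phi_add, add_mul])
  zero_mul f := phi_injective (by rw [phi_mul, phi_zero, zero_mul])
  mul_zero f := phi_injective (by rw [phi_mul, phi_zero, mul_zero])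
  mul_assoc f g h := phi_injective (by simp only [phi_mul, mul_assoc])

instance : IsARing R A (OpHom D) where
  smul_assoc r a f := phi_injective (by simp only [phi_smul, phi_rsmul, smul_assoc])
  isScalarTower_op := inferInstanceAs (IsScalarTower R Aᵐᵒᵖ (C →ₗ[R] A))
  smul_comm a b f := phi_injective (by
    rw [← op_unop b, phi_smul, phi_op_smul, phi_op_smul, phi_smul, smul_comm])
  smul_mul a f g := phi_injective (by
    simp only [phi_smul, phi_mul, IsARing.smul_mul (R := R)])
  mul_op_smul a f g := phi_injective (by
    simp only [phi_op_smul, phi_mul, IsARing.mul_op_smul (R := R)])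
  op_smul_mul a f g := phi_injective (by
    simp only [phi_smul, phi_op_smul, phi_mul, IsARing.op_smul_mul (R := R)])

variable (D) in
/-- `φ` as a morphism of `A`-rings. -/
def phiHom : ARingHom R A (OpHom D) (LeftDual R A (DKCoring D)) where
  toLinearMap :=
    { toFun := phi
      map_add' := phi_add
      map_smul' := phi_rsmul }
  map_smul := phi_smul
  map_op_smul := phi_op_smul
  map_mul := phi_mul

end OpHom

end OpHom
/-! ### The `A`-ring `A #ᵒᵖ T` -/

section OpSmash

variable {R H A C : Type u} [CommRing R] [Ring H] [Bialgebra R H] [Ring A] [Algebra R A]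
  [AddCommGroup C] [Module R C] [Coalgebra R C]

/-- The convolution product `(f ⋆ g)(c) = ∑ f(c₁) g(c₂)` on the dual `C*` of a coalgebra. -/
def convolution (R C : Type u) [CommRing R] [AddCommGroup C] [Module R C] [Coalgebra R C] :
    Module.Dual R C →ₗ[R] Module.Dual R C →ₗ[R] Module.Dual R C :=
  LinearMap.mk₂ R (fun f g => LinearMap.mul' R R ∘ₗ TensorProduct.map f g ∘ₗ Coalgebra.comul)
    (fun f f' g => by ext; simp [TensorProduct.map_add_left])
    (fun r f g => by ext; simp [TensorProduct.map_smul_left])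
    (fun f g g' => by ext; simp [TensorProduct.map_add_right])
    (fun r f g => by ext; simp [TensorProduct.map_smul_right])

theorem convolution_apply (f g : Module.Dual R C) (c : C) :
    convolution R C f g c =
      LinearMap.mul' R R (TensorProduct.map f g (Coalgebra.comul c)) := rfl

theorem convolution_assoc (f g k : Module.Dual R C) :
    convolution R C (convolution R C f g) k = convolution R C f (convolution R C g k) := by
  let Φ : C ⊗[R] (C ⊗[R] C) →ₗ[R] R :=
    LinearMap.mul' R R ∘ₗ TensorProduct.map f (LinearMap.mul' R R ∘ₗ TensorProduct.map g k)
  have h1 : ∀ t : C ⊗[R] C, LinearMap.mul' R R (TensorProduct.map (convolution R C f g) k t) =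
      Φ (TensorProduct.assoc R C C C ((Coalgebra.comul (R := R) (A := C)).rTensor C t)) := by
    intro t
    induction t with
    | zero => simp
    | add s t hs ht => simp only [map_add, hs, ht]
    | tmul x y =>
      rw [TensorProduct.map_tmul, LinearMap.mul'_apply, LinearMap.rTensor_tmul, convolution_apply]
      induction Coalgebra.comul (R := R) x with
      | zero => simp
      | add s t hs ht => simp only [map_add, add_mul, add_tmul, hs, ht]
      | tmul p q => simp [Φ, mul_assoc]
  have h2 : ∀ t : C ⊗[R] C, LinearMap.mul' R R (TensorProduct.map f (convolution R C g k) t) =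
      Φ ((Coalgebra.comul (R := R) (A := C)).lTensor C t) := by
    intro t
    induction t with
    | zero => simp
    | add s t hs ht => simp only [map_add, hs, ht]
    | tmul x y => rfl
  ext c
  rw [convolution_apply, convolution_apply, h1, h2, Coalgebra.coassoc_apply]

namespace DoiKoppinen

variable (D : DoiKoppinen R H A C)

/-- The left action `(h f)(c) = f(c h)` of `H` on `C*`. -/
def dualAct : H →ₗ[R] Module.Dual R C →ₗ[R] Module.Dual R C :=
  LinearMap.mk₂ R (fun h f => f ∘ₗ D.actH h)
    (fun _ _ _ => by ext; simp) (fun _ _ _ => by ext; simp)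
    (fun _ _ _ => rfl) (fun _ _ _ => rfl)

@[simp] theorem dualAct_apply (h : H) (f : Module.Dual R C) (c : C) :
    D.dualAct h f c = f (D.act (c ⊗ₜ h)) := rfl

theorem dualAct_one (f : Module.Dual R C) : D.dualAct 1 f = f := by
  ext c; simp [D.act_one]

theorem dualAct_mul (h k : H) (f : Module.Dual R C) :
    D.dualAct (h * k) f = D.dualAct h (D.dualAct k f) := by
  ext c; simp [D.act_mul]

/-- `h (f ⋆ g) = ∑ (h₁ f) ⋆ (h₂ g)`. -/
theorem dualAct_convolution (h : H) (f g : Module.Dual R C) :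
    D.dualAct h (convolution R C f g) =
      TensorProduct.lift ((convolution R C).compl₁₂ (D.dualAct.flip f) (D.dualAct.flip g))
        (Coalgebra.comul h) := by
  ext c
  rw [dualAct_apply, convolution_apply, comul_act]
  induction Coalgebra.comul (R := R) h with
  | zero => simp
  | add s t hs ht => simp only [tmul_add, map_add, LinearMap.add_apply, hs, ht]
  | tmul p q =>
    rw [TensorProduct.lift.tmul, LinearMap.compl₁₂_apply, convolution_apply]
    induction Coalgebra.comul (R := R) c with
    | zero => simp
    | add s t hs ht => simp only [add_tmul, map_add, hs, ht]
    | tmul x y => rfl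

end DoiKoppinen

/-- A left `H`-module subalgebra `T ⊆ C*` (not necessarily containing the unity `ε` of `C*`). -/
structure HSubalgebra (D : DoiKoppinen R H A C) extends Submodule R (Module.Dual R C) where
  convolution_mem : ∀ f ∈ carrier, ∀ g ∈ carrier, convolution R C f g ∈ carrier
  dualAct_mem : ∀ (h : H), ∀ f ∈ carrier, D.dualAct h f ∈ carrier

namespace HSubalgebra

variable {D : DoiKoppinen R H A C}

variable (D) in
/-- The whole dual `C*`. -/
def whole : HSubalgebra D where
  toSubmodule := ⊤
  convolution_mem _ _ _ _ := trivial
  dualAct_mem _ _ _ := trivial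

variable (T : HSubalgebra D)

/-- The product of `T`. -/
def mul : T.toSubmodule →ₗ[R] T.toSubmodule →ₗ[R] T.toSubmodule :=
  LinearMap.mk₂ R (fun f g => ⟨convolution R C f g, T.convolution_mem f f.2 g g.2⟩)
    (fun _ _ _ => Subtype.ext (by simp)) (fun _ _ _ => Subtype.ext (by simp))
    (fun _ _ _ => Subtype.ext (by simp)) (fun _ _ _ => Subtype.ext (by simp))

/-- The action of `H` on `T`. -/
def act : H →ₗ[R] T.toSubmodule →ₗ[R] T.toSubmodule :=
  LinearMap.mk₂ R (fun h f => ⟨D.dualAct h f, T.dualAct_mem h f f.2⟩)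
    (fun _ _ _ => Subtype.ext (by simp)) (fun _ _ _ => Subtype.ext (by simp))
    (fun _ _ _ => Subtype.ext (by simp)) (fun _ _ _ => Subtype.ext (by simp))

@[simp] theorem coe_mul (f g : T.toSubmodule) :
    (T.mul f g : Module.Dual R C) = convolution R C f g := rfl

@[simp] theorem coe_act (h : H) (f : T.toSubmodule) :
    (T.act h f : Module.Dual R C) = D.dualAct h f := rfl

theorem mul_assoc (f g k : T.toSubmodule) : T.mul (T.mul f g) k = T.mul f (T.mul g k) :=
  Subtype.ext (convolution_assoc _ _ _)

theorem act_one (f : T.toSubmodule) : T.act 1 f = f := Subtype.ext (D.dualAct_one _)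

theorem act_mul (h k : H) (f : T.toSubmodule) : T.act (h * k) f = T.act h (T.act k f) :=
  Subtype.ext (D.dualAct_mul _ _ _)

theorem act_convolution (h : H) (f g : T.toSubmodule) : T.act h (T.mul f g) =
    TensorProduct.lift (T.mul.compl₁₂ (T.act.flip f) (T.act.flip g)) (Coalgebra.comul h) := by
  apply Subtype.ext
  rw [coe_act, coe_mul, D.dualAct_convolution]
  induction Coalgebra.comul (R := R) h with
  | zero => simp
  | add s t hs ht => simp only [map_add, Submodule.coe_add, hs, ht]
  | tmul p q => rfl

end HSubalgebra

/-- The `A`-ring `A #ᵒᵖ T = A ⊗ T` of a left `H`-module subalgebra `T ⊆ C*`. -/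
def OpSmash {D : DoiKoppinen R H A C} (T : HSubalgebra D) : Type u := A ⊗[R] T.toSubmodule

namespace OpSmash

variable {D : DoiKoppinen R H A C} (T : HSubalgebra D)

instance : AddCommGroup (OpSmash T) := inferInstanceAs (AddCommGroup (A ⊗[R] T.toSubmodule))
instance : Module R (OpSmash T) := inferInstanceAs (Module R (A ⊗[R] T.toSubmodule))

/-- The action `(x ⊗ h) (a ⊗ f) = x a ⊗ h f` of `A ⊗ H` on `A ⊗ T`. -/
def tensorAct : A ⊗[R] H →ₗ[R] A ⊗[R] T.toSubmodule →ₗ[R] A ⊗[R] T.toSubmodule :=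
  TensorProduct.homTensorHomMap (RingHom.id R) A T.toSubmodule A T.toSubmodule ∘ₗ
    TensorProduct.map (LinearMap.mul R A) T.act

@[simp] theorem tensorAct_tmul (x : A) (h : H) (a : A) (f : T.toSubmodule) :
    tensorAct T (x ⊗ₜ h) (a ⊗ₜ f) = (x * a) ⊗ₜ[R] T.act h f := rfl

theorem tensorAct_one (t : A ⊗[R] T.toSubmodule) : tensorAct T 1 t = t := by
  induction t with
  | zero => simp
  | add s t hs ht => simp only [map_add, hs, ht]
  | tmul a f => rw [Algebra.TensorProduct.one_def, tensorAct_tmul, one_mul, T.act_one]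

theorem tensorAct_mul (s s' : A ⊗[R] H) (t : A ⊗[R] T.toSubmodule) :
    tensorAct T (s * s') t = tensorAct T s (tensorAct T s' t) := by
  induction t with
  | zero => simp
  | add u v hu hv => simp only [map_add, hu, hv]
  | tmul a f =>
    induction s with
    | zero => simp
    | add u v hu hv => simp only [add_mul, map_add, LinearMap.add_apply, hu, hv]
    | tmul x h =>
      induction s' with
      | zero => simp
      | add u v hu hv => simp only [mul_add, map_add, LinearMap.add_apply, hu, hv]
      | tmul y k => simp [T.act_mul, _root_.mul_assoc]

/-- The left action `ã (a # f) = ∑ ã₀ a # ã₁ f` of `A` on `A ⊗ T`. -/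
def lact : A →ₗ[R] A ⊗[R] T.toSubmodule →ₗ[R] A ⊗[R] T.toSubmodule :=
  tensorAct T ∘ₗ D.coact.toLinearMap

theorem lact_apply (a : A) (t : A ⊗[R] T.toSubmodule) :
    lact T a t = tensorAct T (D.coact a) t := rfl

theorem lact_one (t : A ⊗[R] T.toSubmodule) : lact T 1 t = t := by
  rw [lact_apply, map_one, tensorAct_one]

theorem lact_mul (a b : A) (t : A ⊗[R] T.toSubmodule) :
    lact T (a * b) t = lact T a (lact T b t) := by
  rw [lact_apply, map_mul, tensorAct_mul, lact_apply, lact_apply]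

/-- The right action `(a # f) ã = a ã # f` of `A` on `A ⊗ T`. -/
def ract (b : A) : A ⊗[R] T.toSubmodule →ₗ[R] A ⊗[R] T.toSubmodule :=
  (LinearMap.mulRight R b).rTensor T.toSubmodule

@[simp] theorem ract_tmul (b a : A) (f : T.toSubmodule) :
    ract T b (a ⊗ₜ f) = (a * b) ⊗ₜ[R] f := rfl

theorem ract_one (t : A ⊗[R] T.toSubmodule) : ract T 1 t = t := by
  induction t with
  | zero => simp
  | add s t hs ht => simp only [map_add, hs, ht]
  | tmul a f => simp

theorem ract_mul (a b : A) (t : A ⊗[R] T.toSubmodule) :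
    ract T (a * b) t = ract T b (ract T a t) := by
  induction t with
  | zero => simp
  | add s t hs ht => simp only [map_add, hs, ht]
  | tmul x f => simp [_root_.mul_assoc]

theorem ract_add (a b : A) (t : A ⊗[R] T.toSubmodule) :
    ract T (a + b) t = ract T a t + ract T b t := by
  induction t with
  | zero => simp
  | add s t hs ht => simp only [map_add, hs, ht]; abel
  | tmul x f => simp [mul_add, add_tmul]

theorem ract_rsmul (r : R) (a : A) (t : A ⊗[R] T.toSubmodule) :
    ract T (r • a) t = r • ract T a t := by
  induction t with
  | zero => simp
  | add s t hs ht => simp only [map_add, smul_add, hs, ht]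
  | tmul x f => simp [smul_tmul']

theorem ract_zero (t : A ⊗[R] T.toSubmodule) : ract T 0 t = 0 := by
  rw [← zero_smul R (0 : A), ract_rsmul, zero_smul]

theorem lact_ract (a b : A) (t : A ⊗[R] T.toSubmodule) :
    lact T a (ract T b t) = ract T b (lact T a t) := by
  rw [lact_apply, lact_apply]
  induction t with
  | zero => simp
  | add s t hs ht => simp only [map_add, hs, ht]
  | tmul x f =>
    induction D.coact a with
    | zero => simp
    | add s t hs ht => simp only [map_add, LinearMap.add_apply, hs, ht]
    | tmul y h => simp [_root_.mul_assoc]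

/-- The map `a # g ↦ a # g ⋆ f`, linear in `f`. -/
def convRight : T.toSubmodule →ₗ[R] A ⊗[R] T.toSubmodule →ₗ[R] A ⊗[R] T.toSubmodule :=
  LinearMap.lTensorHom A ∘ₗ T.mul.flip

@[simp] theorem convRight_tmul (f : T.toSubmodule) (a : A) (g : T.toSubmodule) :
    convRight T f (a ⊗ₜ g) = a ⊗ₜ[R] T.mul g f := rfl

theorem convRight_mul (g f : T.toSubmodule) (t : A ⊗[R] T.toSubmodule) :
    convRight T (T.mul g f) t = convRight T f (convRight T g t) := by
  induction t with
  | zero => simp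
  | add s t hs ht => simp only [map_add, hs, ht]
  | tmul a k => simp [T.mul_assoc]

theorem convRight_ract (f : T.toSubmodule) (b : A) (t : A ⊗[R] T.toSubmodule) :
    convRight T f (ract T b t) = ract T b (convRight T f t) := by
  induction t with
  | zero => simp
  | add s t hs ht => simp only [map_add, hs, ht]
  | tmul a k => simp

/-- The multiplication `(a # f) (b # g) = ∑ a₀ b # (a₁ g) ⋆ f`. -/
def mulMap : A ⊗[R] T.toSubmodule →ₗ[R] A ⊗[R] T.toSubmodule →ₗ[R] A ⊗[R] T.toSubmodule :=
  TensorProduct.lift (LinearMap.mk₂ R (fun a f => convRight T f ∘ₗ lact T a)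
    (fun _ _ _ => by simp [LinearMap.comp_add]) (fun _ _ _ => by simp [LinearMap.comp_smul])
    (fun _ _ _ => by simp [LinearMap.add_comp]) (fun _ _ _ => by simp [LinearMap.smul_comp]))

theorem mulMap_tmul (a : A) (f : T.toSubmodule) (t : A ⊗[R] T.toSubmodule) :
    mulMap T (a ⊗ₜ f) t = convRight T f (lact T a t) := rfl

theorem mulMap_convRight (f : T.toSubmodule) (s t : A ⊗[R] T.toSubmodule) :
    mulMap T (convRight T f s) t = convRight T f (mulMap T s t) := by
  induction s with
  | zero => simp
  | add u v hu hv => simp only [map_add, LinearMap.add_apply, hu, hv]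
  | tmul a g => rw [convRight_tmul, mulMap_tmul, mulMap_tmul, convRight_mul]

theorem mulMap_ract (a : A) (s t : A ⊗[R] T.toSubmodule) :
    mulMap T s (ract T a t) = ract T a (mulMap T s t) := by
  induction s with
  | zero => simp
  | add u v hu hv => simp only [map_add, LinearMap.add_apply, hu, hv]
  | tmul b g => rw [mulMap_tmul, mulMap_tmul, lact_ract, convRight_ract]

theorem mulMap_ract_left (a : A) (s t : A ⊗[R] T.toSubmodule) :
    mulMap T (ract T a s) t = mulMap T s (lact T a t) := by
  induction s with
  | zero => simp
  | add u v hu hv => simp only [map_add, LinearMap.add_apply, hu, hv]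
  | tmul b g => rw [ract_tmul, mulMap_tmul, mulMap_tmul, lact_mul]

/-- `a (t ⋆ g) = ∑ (a₀ t) ⋆ (a₁ g)`. -/
theorem lact_convRight (a : A) (g : T.toSubmodule) (t : A ⊗[R] T.toSubmodule) :
    lact T a (convRight T g t) =
      TensorProduct.lift ((LinearMap.llcomp R (A ⊗[R] T.toSubmodule) (A ⊗[R] T.toSubmodule)
        (A ⊗[R] T.toSubmodule)).flip.compl₁₂ (lact T) (convRight T ∘ₗ T.act.flip g))
          (D.coact a) t := by
  induction t with
  | zero => simp
  | add u v hu hv => simp only [map_add, hu, hv]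
  | tmul b k =>
    let Φ : A ⊗[R] (H ⊗[R] H) →ₗ[R] A ⊗[R] T.toSubmodule :=
      TensorProduct.map (LinearMap.mulRight R b)
        (TensorProduct.lift (T.mul.compl₁₂ (T.act.flip k) (T.act.flip g)))
    have h1 : ∀ s : A ⊗[R] H, tensorAct T s (convRight T g (b ⊗ₜ k)) =
        Φ ((Coalgebra.comul (R := R) (A := H)).lTensor A s) := by
      intro s
      induction s with
      | zero => simp
      | add u v hu hv => simp only [map_add, LinearMap.add_apply, hu, hv]
      | tmul x h =>
        rw [convRight_tmul, tensorAct_tmul, T.act_convolution]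
        rfl
    have h2 : ∀ s : A ⊗[R] H,
        TensorProduct.lift ((LinearMap.llcomp R (A ⊗[R] T.toSubmodule) (A ⊗[R] T.toSubmodule)
          (A ⊗[R] T.toSubmodule)).flip.compl₁₂ (lact T) (convRight T ∘ₗ T.act.flip g))
            s (b ⊗ₜ k) =
        Φ (TensorProduct.assoc R A H H (D.coact.toLinearMap.rTensor H s)) := by
      intro s
      induction s with
      | zero => simp
      | add u v hu hv => simp only [map_add, LinearMap.add_apply, hu, hv]
      | tmul x h =>
        change convRight T (T.act h g) (tensorAct T (D.coact x) (b ⊗ₜ k)) = _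
        rw [LinearMap.rTensor_tmul, AlgHom.toLinearMap_apply]
        induction D.coact x with
        | zero => simp
        | add u v hu hv => simp only [map_add, LinearMap.add_apply, add_tmul, hu, hv]
        | tmul y l => rfl
    rw [lact_apply, h1, h2, D.coact_coassoc]

theorem mulMap_lact (a : A) (s t : A ⊗[R] T.toSubmodule) :
    mulMap T (lact T a s) t = lact T a (mulMap T s t) := by
  induction s with
  | zero => simp
  | add u v hu hv => simp only [map_add, LinearMap.add_apply, hu, hv]
  | tmul b g =>
    rw [mulMap_tmul, lact_convRight, lact_apply]
    induction D.coact a with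
    | zero => simp
    | add u v hu hv => simp only [map_add, LinearMap.add_apply, hu, hv]
    | tmul x h =>
      rw [tensorAct_tmul, mulMap_tmul, lact_mul]
      rfl

theorem mulMap_assoc (s t u : A ⊗[R] T.toSubmodule) :
    mulMap T (mulMap T s t) u = mulMap T s (mulMap T t u) := by
  induction s with
  | zero => simp
  | add u v hu hv => simp only [map_add, LinearMap.add_apply, hu, hv]
  | tmul a f => rw [mulMap_tmul, mulMap_tmul, mulMap_convRight, mulMap_lact]

instance : NonUnitalRing (OpSmash T) where
  mul := fun s t => mulMap T s t
  left_distrib s := map_add (mulMap T s)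
  right_distrib s t u := LinearMap.congr_fun (map_add (mulMap T) s t) u
  zero_mul t := LinearMap.congr_fun (map_zero (mulMap T)) t
  mul_zero s := map_zero (mulMap T s)
  mul_assoc := mulMap_assoc T

instance : Module A (OpSmash T) where
  smul a t := lact T a t
  one_smul := lact_one T
  mul_smul := lact_mul T
  smul_zero a := map_zero (lact T a)
  smul_add a := map_add (lact T a)
  add_smul a b t := LinearMap.congr_fun (map_add (lact T) a b) t
  zero_smul t := LinearMap.congr_fun (map_zero (lact T)) t

instance : Module Aᵐᵒᵖ (OpSmash T) where
  smul a t := ract T a.unop t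
  one_smul := ract_one T
  mul_smul a b := ract_mul T b.unop a.unop
  smul_zero a := map_zero (ract T a.unop)
  smul_add a := map_add (ract T a.unop)
  add_smul a b := ract_add T a.unop b.unop
  zero_smul := ract_zero T

instance : IsARing R A (OpSmash T) where
  smul_assoc r a t := LinearMap.congr_fun (map_smul (lact T) r a) t
  isScalarTower_op := ⟨fun r a t => ract_rsmul T r a.unop t⟩
  smul_comm a b t := lact_ract T a b.unop t
  smul_mul := mulMap_lact T
  mul_op_smul := mulMap_ract T
  op_smul_mul := mulMap_ract_left T

/-- The underlying linear map `a # f ↦ [c ↦ a f(c)]` of `β`. -/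
def betaLin : A ⊗[R] T.toSubmodule →ₗ[R] C →ₗ[R] A :=
  TensorProduct.lift (LinearMap.mk₂ R (fun a f => LinearMap.toSpanSingleton R A a ∘ₗ f.1)
    (fun _ _ _ => by ext; simp) (fun r _ _ => by ext; simp [smul_comm r])
    (fun _ _ _ => by ext; simp [add_smul]) (fun _ _ _ => by ext; simp [mul_smul]))

@[simp] theorem betaLin_tmul (a : A) (f : T.toSubmodule) (c : C) :
    betaLin T (a ⊗ₜ f) c = f.1 c • a := rfl

end OpSmash

end OpSmash
namespace OpSmash

variable {R H A C : Type u} [CommRing R] [Ring H] [Bialgebra R H] [Ring A] [Algebra R A]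
  [AddCommGroup C] [Module R C] [Coalgebra R C] {D : DoiKoppinen R H A C} (T : HSubalgebra D)

theorem betaLin_ract (a : A) (t : A ⊗[R] T.toSubmodule) (c : C) :
    betaLin T (ract T a t) c = betaLin T t c * a := by
  induction t with
  | zero => simp
  | add u v hu hv => simp only [map_add, LinearMap.add_apply, add_mul, hu, hv]
  | tmul b f => simp

theorem betaLin_lact (a : A) (t : A ⊗[R] T.toSubmodule) (c : C) :
    betaLin T (lact T a t) c = extendLeft (betaLin T t) (D.psi c a) := by
  rw [lact_apply, D.psi_apply]
  induction D.coact a with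
  | zero => simp
  | add u v hu hv => simp only [map_add, LinearMap.add_apply, hu, hv]
  | tmul x h =>
    rw [LinearMap.lTensor_tmul, extendLeft_tmul]
    induction t with
    | zero => simp
    | add u v hu hv => simp only [map_add, LinearMap.add_apply, smul_add, hu, hv]
    | tmul b f => simp

theorem betaLin_convRight (f : T.toSubmodule) (t : A ⊗[R] T.toSubmodule) (c : C) :
    betaLin T (convRight T f t) c =
      TensorProduct.lift ((LinearMap.lsmul R A).flip.compl₁₂ (betaLin T t) f.1)
        (Coalgebra.comul c) := by
  induction t with
  | zero =>
    rw [map_zero, map_zero, LinearMap.zero_apply]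
    induction Coalgebra.comul (R := R) c with
    | zero => simp
    | add s t hs ht => simp only [map_add, ← hs, ← ht]; abel
    | tmul x y => simp
  | add u v hu hv =>
    simp only [map_add, LinearMap.add_apply, hu, hv]
    induction Coalgebra.comul (R := R) c with
    | zero => simp
    | add s t hs ht => simp only [map_add, ← hs, ← ht]; abel
    | tmul x y => simp
  | tmul b g =>
    rw [convRight_tmul, betaLin_tmul]
    change convolution R C g.1 f.1 c • b = _
    rw [convolution_apply]
    induction Coalgebra.comul (R := R) c with
    | zero => simp
    | add s t hs ht => simp only [map_add, add_smul, hs, ht]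
    | tmul x y =>
      rw [TensorProduct.map_tmul, LinearMap.mul'_apply, mul_comm, mul_smul]
      rfl

theorem betaLin_mulMap (s t : A ⊗[R] T.toSubmodule) (c : C) :
    betaLin T (mulMap T s t) c =
      extendLeft (betaLin T t)
        (OpHom.conv ((OpHom.toLin D).symm (betaLin T s)) (Coalgebra.comul c)) := by
  induction s with
  | zero =>
    rw [map_zero, LinearMap.zero_apply, map_zero, LinearMap.zero_apply]
    induction Coalgebra.comul (R := R) c with
    | zero => simp
    | add s t hs ht => simp only [map_add, ← hs, ← ht]; abel
    | tmul x y => simp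
  | add u v hu hv =>
    simp only [map_add, LinearMap.add_apply, hu, hv]
    induction Coalgebra.comul (R := R) c with
    | zero => simp
    | add s t hs ht => simp only [map_add, ← hs, ← ht]; abel
    | tmul x y => simp
  | tmul a f =>
    rw [mulMap_tmul, betaLin_convRight]
    induction Coalgebra.comul (R := R) c with
    | zero => simp
    | add s t hs ht => simp only [map_add, hs, ht]
    | tmul x y =>
      rw [TensorProduct.lift.tmul, LinearMap.compl₁₂_apply, LinearMap.flip_apply,
        LinearMap.lsmul_apply, betaLin_lact, OpHom.conv_tmul, OpHom.toLin_symm_apply,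
        betaLin_tmul, map_smul, extendLeft_rsmul]

/-- The morphism of `A`-rings `β : A #ᵒᵖ T → #ᵒᵖ(C, A)`, `a # f ↦ [c ↦ a f(c)]`. -/
def beta : ARingHom R A (OpSmash T) (OpHom D) where
  toLinearMap := (OpHom.toLin D).symm.toLinearMap ∘ₗ betaLin T
  map_smul a t := OpHom.ext fun c => betaLin_lact T a t c
  map_op_smul a t := OpHom.ext fun c => betaLin_ract T a t c
  map_mul s t := OpHom.ext fun c => betaLin_mulMap T s t c

/-- The morphism of `A`-rings `κ = φ ∘ β : A #ᵒᵖ T → *(A ⊗ C)`,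
`a # f ↦ [ã ⊗ c ↦ ã a f(c)]`. -/
def kappa : ARingHom R A (OpSmash T) (LeftDual R A (DKCoring D)) :=
  (OpHom.phiHom D).comp (beta T)

end OpSmash

/-! ### Doi-Koppinen modules -/

section DKModule

variable {R H A C : Type u} [CommRing R] [Ring H] [Bialgebra R H] [Ring A] [Algebra R A]
  [AddCommGroup C] [Module R C] [Coalgebra R C]

/-- A right-right Doi-Koppinen module: a right `A`-module `M` with a right `C`-comodule structure
`ρ` such that `ρ(m a) = ∑ m₀ a₀ ⊗ m₁ a₁`. -/
structure DKModule (D : DoiKoppinen R H A C) where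
  carrier : Type u
  [addCommGroup : AddCommGroup carrier]
  [module : Module R carrier]
  [opModule : Module Aᵐᵒᵖ carrier]
  [isScalarTower : IsScalarTower R Aᵐᵒᵖ carrier]
  /-- the coaction `m ↦ ∑ m₀ ⊗ m₁` -/
  coact : carrier →ₗ[R] carrier ⊗[R] C
  coassoc : ∀ m, TensorProduct.assoc R carrier C C (coact.rTensor C (coact m)) =
    (Coalgebra.comul (R := R) (A := C)).lTensor carrier (coact m)
  counit : ∀ m, (Coalgebra.counit (R := R) (A := C)).lTensor carrier (coact m) = m ⊗ₜ[R] (1 : R)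
  coact_op_smul : ∀ (a : A) m, coact (op a • m) = D.diag carrier (coact m ⊗ₜ D.coact a)

namespace DKModule

attribute [instance] DKModule.addCommGroup DKModule.module DKModule.opModule
  DKModule.isScalarTower

variable {D : DoiKoppinen R H A C}

/-- Morphisms: right `A`-linear and `C`-colinear maps. -/
@[ext] structure Hom (M N : DKModule D) where
  toLinearMap : M.carrier →ₗ[Aᵐᵒᵖ] N.carrier
  map_coact : ∀ m, N.coact (toLinearMap m) =
    (toLinearMap.restrictScalars R).rTensor C (M.coact m)

/-- The category `M(H)_A^C` of Doi-Koppinen modules. -/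
instance : Category.{u} (DKModule D) where
  Hom M N := Hom M N
  id M := ⟨LinearMap.id, fun m => (LinearMap.congr_fun (LinearMap.rTensor_id C _) _).symm⟩
  comp f g := ⟨g.toLinearMap ∘ₗ f.toLinearMap, fun m => by
    rw [LinearMap.comp_apply, g.map_coact, f.map_coact, ← LinearMap.rTensor_comp_apply]
    rfl⟩

/-- For `f : C → A`, the map `m ⊗ c ↦ m f(c)`, linear in `f`. -/
def evalMap (M : DKModule D) : (C →ₗ[R] A) →ₗ[R] M.carrier ⊗[R] C →ₗ[R] M.carrier :=
  LinearMap.compRight R (rightMul R A M.carrier) ∘ₗ LinearMap.lTensorHom M.carrier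

@[simp] theorem evalMap_tmul (M : DKModule D) (f : C →ₗ[R] A) (m : M.carrier) (c : C) :
    M.evalMap f (m ⊗ₜ c) = op (f c) • m := rfl

/-- The action `m f = ∑ m₀ f(m₁)` of `#ᵒᵖ(C, A)` on a Doi-Koppinen module. -/
def opAct (M : DKModule D) : M.carrier →ₗ[R] OpHom D →ₗ[R] M.carrier :=
  LinearMap.mk₂ R (fun m f => M.evalMap (OpHom.toLin D f) (M.coact m))
    (fun _ _ _ => by simp) (fun _ _ _ => by simp) (fun _ _ _ => by simp) (fun _ _ _ => by simp)

theorem opAct_apply (M : DKModule D) (m : M.carrier) (f : OpHom D) :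
    M.opAct m f = M.evalMap (OpHom.toLin D f) (M.coact m) := rfl

theorem evalMap_op_smul (M : DKModule D) (a : A) (f : OpHom D) (t : M.carrier ⊗[R] C) :
    M.evalMap (OpHom.toLin D (op a • f)) t = op a • M.evalMap (OpHom.toLin D f) t := by
  induction t with
  | zero => simp
  | add u v hu hv => simp only [map_add, smul_add, hu, hv]
  | tmul m c => simp [mul_smul]

theorem evalMap_diag (M : DKModule D) (a : A) (f : OpHom D) (m : M.carrier) (c : C) :
    M.evalMap (OpHom.toLin D f) (D.diag M.carrier ((m ⊗ₜ c) ⊗ₜ D.coact a)) =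
      op (extendLeft (OpHom.toLin D f) (D.psi c a)) • m := by
  rw [D.psi_apply]
  induction D.coact a with
  | zero => simp
  | add u v hu hv => simp only [tmul_add, map_add, MulOpposite.op_add, add_smul, hu, hv]
  | tmul x h => simp [mul_smul]

theorem opAct_op_smul (M : DKModule D) (a : A) (m : M.carrier) (f : OpHom D) :
    M.opAct (op a • m) f = M.opAct m (a • f) := by
  rw [opAct_apply, opAct_apply, M.coact_op_smul]
  induction M.coact m with
  | zero => simp
  | add u v hu hv => simp only [add_tmul, map_add, hu, hv]
  | tmul m c => rw [evalMap_diag, evalMap_tmul, OpHom.toLin_apply, OpHom.smul_apply]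

theorem opAct_opAct (M : DKModule D) (m : M.carrier) (f g : OpHom D) :
    M.opAct (M.opAct m f) g = M.opAct m (f * g) := by
  let Φ : M.carrier ⊗[R] (C ⊗[R] C) →ₗ[R] M.carrier :=
    rightMul R A M.carrier ∘ₗ
      ((extendLeft (OpHom.toLin D g)).restrictScalars R ∘ₗ OpHom.conv f).lTensor M.carrier
  have h1 : ∀ t : M.carrier ⊗[R] C, M.opAct (M.evalMap (OpHom.toLin D f) t) g =
      Φ (TensorProduct.assoc R M.carrier C C (M.coact.rTensor C t)) := by
    intro t
    induction t with
    | zero => simp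
    | add u v hu hv => simp only [map_add, LinearMap.add_apply, hu, hv]
    | tmul n c =>
      rw [evalMap_tmul, opAct_op_smul, opAct_apply, LinearMap.rTensor_tmul]
      induction M.coact n with
      | zero => simp
      | add u v hu hv => simp only [add_tmul, map_add, hu, hv]
      | tmul n d => rfl
  have h2 : ∀ t : M.carrier ⊗[R] C, M.evalMap (OpHom.toLin D (f * g)) t =
      Φ ((Coalgebra.comul (R := R) (A := C)).lTensor M.carrier t) := by
    intro t
    induction t with
    | zero => simp
    | add u v hu hv => simp only [map_add, hu, hv]
    | tmul n c => rfl
  rw [opAct_apply M m f, opAct_apply M m, h1, h2, M.coassoc]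

end DKModule

/-- The functor from Doi-Koppinen modules to right `#ᵒᵖ(C, A)`-modules, `m f = ∑ m₀ f(m₁)`. -/
def DKModule.toOpHom (D : DoiKoppinen R H A C) : DKModule D ⥤ AMod R A (OpHom D) where
  obj M :=
    { carrier := M.carrier
      act := M.opAct
      act_act := M.opAct_opAct
      op_smul_act := M.opAct_op_smul
      act_op_smul := fun a m f => M.evalMap_op_smul a f (M.coact m) }
  map {M N} φ := ⟨φ.toLinearMap, fun m f => by
    change φ.toLinearMap (M.evalMap (OpHom.toLin D f) (M.coact m)) =
      N.evalMap (OpHom.toLin D f) (N.coact (φ.toLinearMap m))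
    rw [φ.map_coact]
    induction M.coact m with
    | zero => simp
    | add u v hu hv => simp only [map_add, hu, hv]
    | tmul n c => simp⟩

end DKModule
/-! ### Local projectivity, purity, density, and isomorphisms of categories -/

/-- An `R`-module `W` is locally projective if, for every epimorphism `π : L → N`, every
`g : W → N` and every finitely generated submodule `F ⊆ W`, there is some `g' : W → L` such that
`π ∘ g'` and `g` agree on `F`. -/
def LocallyProjective (R W : Type u) [CommRing R] [AddCommGroup W] [Module R W] : Prop :=
  ∀ (L N : Type u) [AddCommGroup L] [Module R L] [AddCommGroup N] [Module R N]
    (π : L →ₗ[R] N), Function.Surjective π → ∀ (g : W →ₗ[R] N) (F : Submodule R W), F.FG →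
      ∃ g' : W →ₗ[R] L, ∀ w ∈ F, π (g' w) = g w

/-- A submodule `K ⊆ W` is `A`-pure if the canonical map `A ⊗ K → A ⊗ W` is injective. -/
def IsPureFor {R W : Type*} (A : Type*) [CommRing R] [AddCommGroup A] [Module R A]
    [AddCommGroup W] [Module R W] (K : Submodule R W) : Prop :=
  Function.Injective (K.subtype.lTensor A)

/-- The finite topology on a set `F` of functions `X → Y`: the topology of pointwise convergence
with respect to the discrete topology on `Y`. -/
abbrev finiteTopology (F X Y : Type*) [FunLike F X Y] : TopologicalSpace F :=
  letI : TopologicalSpace Y := ⊥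
  TopologicalSpace.induced (fun f : F => (f : X → Y)) inferInstance

/-- Density in the finite topology. -/
def FiniteDense {F X Y : Type*} [FunLike F X Y] (S : Set F) : Prop :=
  letI := finiteTopology F X Y
  Dense S

/-- Density in the finite topology: on every finite set, every function agrees with some
function in `S`. -/
theorem finiteDense_iff {F X Y : Type*} [FunLike F X Y] (S : Set F) :
    FiniteDense S ↔ ∀ (f : F) (s : Finset X), ∃ g ∈ S, ∀ x ∈ s, g x = f x := by
  let : TopologicalSpace Y := ⊥
  have : DiscreteTopology Y := ⟨rfl⟩
  let : TopologicalSpace F := finiteTopology F X Y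
  have hc : ∀ x : X, Continuous fun f : F => f x := fun x =>
    (continuous_apply x).comp continuous_induced_dom
  change Dense S ↔ _
  constructor
  · intro h f s
    have ho : IsOpen {g : F | ∀ x ∈ s, g x = f x} := by
      have : {g : F | ∀ x ∈ s, g x = f x} = ⋂ x ∈ s, (fun g : F => g x) ⁻¹' {f x} := by
        ext g; simp
      rw [this]
      exact isOpen_biInter_finset fun x _ => (isOpen_discrete _).preimage (hc x)
    obtain ⟨g, hg, hgS⟩ := h.inter_open_nonempty _ ho ⟨f, fun _ _ => rfl⟩
    exact ⟨g, hgS, hg⟩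
  · intro h
    rw [dense_iff_inter_open]
    rintro U ⟨V, hV, rfl⟩ ⟨f, hf⟩
    obtain ⟨I, u, hu, hI⟩ := isOpen_pi_iff.1 hV f hf
    obtain ⟨g, hg, hgs⟩ := h f I
    exact ⟨g, hI fun x hx => by
      change g x ∈ u x
      rw [hgs x hx]
      exact (hu x hx).2, hg⟩

/-- A functor is an isomorphism of categories if it is bijective on objects and on morphisms. -/
def IsIsoOfCategories {𝒳 𝒴 : Type*} [Category 𝒳] [Category 𝒴] (G : 𝒳 ⥤ 𝒴) : Prop :=
  Function.Bijective G.obj ∧ ∀ X Y : 𝒳, Function.Bijective (G.map : (X ⟶ Y) → _)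

/-- The coring `A ⊗ C` as a right module over `#ᵒᵖ(C, A)`. -/
def DKCoring.opHomModule {R H A C : Type u} [CommRing R] [Ring H] [Bialgebra R H] [Ring A]
    [Algebra R A] [AddCommGroup C] [Module R C] [Coalgebra R C] (D : DoiKoppinen R H A C) :
    AMod R A (OpHom D) :=
  (AMod.restrict (OpHom.phiHom D)).obj (Coring.regular R A (DKCoring D))

/-- The coring `A ⊗ C` as a right module over `A #ᵒᵖ T`. -/
def DKCoring.opSmashModule {R H A C : Type u} [CommRing R] [Ring H] [Bialgebra R H] [Ring A]
    [Algebra R A] [AddCommGroup C] [Module R C] [Coalgebra R C] {D : DoiKoppinen R H A C}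
    (T : HSubalgebra D) : AMod R A (OpSmash T) :=
  (AMod.restrict (OpSmash.kappa T)).obj (Coring.regular R A (DKCoring D))

end

/-! A coaction on a right A-module M can be recovered from the operators m ↦ ∑ m₀ f(m₁) as soon as
the evaluations m ⊗ c ↦ m f(c) separate the elements of M ⊗ C. Local projectivity of C provides this
(`LocallyProjective.eq_of_evalAt`): after expanding the second tensor factors in a finite dual
basis, the coefficients of a tensor are its evaluations at scalar-valued maps. Each evaluation of a
tensor sees finitely many values of f, so a dense family of maps suffices. The comparison with
modules is therefore carried out for any morphism of A-rings β : B → #ᵒᵖ(C, A) with dense image; the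
identity of #ᵒᵖ(C, A) and the given β on A #ᵒᵖ T are two instances.

The bridge is the notion of a rational B-module (`AMod.IsRational`): every n has a tensor ∑ nᵢ ⊗ cᵢ
with n b = ∑ nᵢ β(b)(cᵢ) for all b and n = ∑ nᵢ ε(cᵢ). Rationality passes to direct sums of copies
and to quotients, and, by separation in (L/N) ⊗ C, to submodules. Since A ⊗ C embeds into the cofree
Doi-Koppinen module on A, every subgenerated module is rational. On a rational module the tensors
are unique, and the axioms of a Doi-Koppinen module other than the counit law, which is part of
rationality, are identities between tensors that can be tested by evaluation
(`AMod.IsRational.exists_dkModule`). Conversely, the coaction embeds a Doi-Koppinen module M into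
the cofree module M ⊗ C, which is a quotient of a direct sum of copies of A ⊗ C indexed by M. This
gives the isomorphism onto σ for every dense β, and restriction of scalars is an isomorphism by
cancellation. The α-condition is the same separation, because M ⊗_A (A ⊗ C) is M ⊗ C.

If C is finitely generated projective, a global finite dual basis makes β : A #ᵒᵖ C* → #ᵒᵖ(C, A)
bijective and expresses every b as ∑ xᵢ β(b)(dᵢ) with fixed xᵢ, so every unital module is rational.

For the Grothendieck property, M ↦ M ⊗ C is right adjoint to the forgetful functor to right
A-modules, and this adjunction is comonadic. If C is flat, the comonad is left exact, so the
forgetful functor creates finite limits as well as colimits, and the abelian structure and exactness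
of filtered colimits descend from right A-modules. For a separator, an element m is enlarged to a
countable set closed under taking the left components of coactions; by flatness the right
A-submodule generated by it is a Doi-Koppinen submodule. The countably generated Doi-Koppinen
modules form a set up to isomorphism, and their coproduct is a separator. -/

noncomputable section

/-! ### Evaluation of `M ⊗ C` at maps `C → A` -/

section EvalAt

variable {R A C : Type u} [CommRing R] [Ring A] [Algebra R A] [AddCommGroup C] [Module R C]

/-- For `f : C → A`, the map `M ⊗ C → M`, `m ⊗ c ↦ m f(c)`. -/
def evalAt (M : Type u) [AddCommGroup M] [Module R M] [Module Aᵐᵒᵖ M] [IsScalarTower R Aᵐᵒᵖ M]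
    (f : C →ₗ[R] A) : M ⊗[R] C →ₗ[R] M :=
  rightMul R A M ∘ₗ f.lTensor M

variable {M N : Type u} [AddCommGroup M] [Module R M] [Module Aᵐᵒᵖ M] [IsScalarTower R Aᵐᵒᵖ M]
  [AddCommGroup N] [Module R N] [Module Aᵐᵒᵖ N] [IsScalarTower R Aᵐᵒᵖ N]

@[simp] theorem evalAt_tmul (f : C →ₗ[R] A) (m : M) (c : C) :
    evalAt M f (m ⊗ₜ c) = op (f c) • m := rfl

theorem evalAt_map (φ : M →ₗ[Aᵐᵒᵖ] N) (f : C →ₗ[R] A) (t : M ⊗[R] C) :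
    evalAt N f ((φ.restrictScalars R).rTensor C t) = φ (evalAt M f t) := by
  induction t with
  | zero => simp
  | add s t hs ht => simp only [map_add, hs, ht]
  | tmul m c => simp

/-- The value of `evalAt M f` at a tensor depends only on finitely many values of `f`. -/
theorem exists_finset_evalAt_congr (t : M ⊗[R] C) :
    ∃ F : Finset C, ∀ f g : C →ₗ[R] A, (∀ c ∈ F, f c = g c) → evalAt M f t = evalAt M g t := by
  classical
  obtain ⟨S, rfl⟩ := TensorProduct.exists_finset t
  refine ⟨S.image Prod.snd, fun f g h => ?_⟩
  rw [map_sum, map_sum]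
  refine Finset.sum_congr rfl fun i hi => ?_
  rw [evalAt_tmul, evalAt_tmul, h _ (Finset.mem_image_of_mem _ hi)]

/-- A locally projective module has finite dual bases on finite subsets. -/
theorem LocallyProjective.exists_dualBasis (hC : LocallyProjective R C) (F : Finset C) :
    ∃ g : C →ₗ[R] (C →₀ R), ∀ c ∈ F, Finsupp.linearCombination R id (g c) = c := by
  -- The identity of C is lifted, on the span of F, along the canonical epimorphism from the free
  -- module on the set C.
  obtain ⟨g, hg⟩ := hC (C →₀ R) C (Finsupp.linearCombination R id)
    (Finsupp.linearCombination_id_surjective R C) LinearMap.id (Submodule.span R F)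
    ⟨F, rfl⟩
  exact ⟨g, fun c hc => hg c (Submodule.subset_span hc)⟩

/-- Over a locally projective `C`, the elements of `M ⊗ C` are separated by the evaluations at a
set of maps `C → A` that approximates the scalar maps on finite sets. -/
theorem LocallyProjective.eq_of_evalAt (hC : LocallyProjective R C) (S : Set (C →ₗ[R] A))
    (hS : ∀ (f : Module.Dual R C) (F : Finset C),
      ∃ g ∈ S, ∀ c ∈ F, g c = algebraMap R A (f c)) {s t : M ⊗[R] C}
    (h : ∀ g ∈ S, evalAt M g s = evalAt M g t) : s = t := by
  classical
  rw [← sub_eq_zero]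
  obtain ⟨I, hI⟩ := TensorProduct.exists_finset (s - t)
  obtain ⟨b, hb⟩ := hC.exists_dualBasis (I.image Prod.snd)
  -- The sum is the coefficient of d in s - t; it equals the evaluation at the d-th dual basis
  -- functional, which some g in S imitates on the finitely many right components.
  have key : ∀ d : C, ∑ i ∈ I, b i.2 d • i.1 = 0 := by
    intro d
    obtain ⟨g, hg, hgb⟩ := hS (Finsupp.lapply d ∘ₗ b) (I.image Prod.snd)
    have h0 : evalAt M g (s - t) = 0 := by rw [map_sub, h g hg, sub_self]
    rw [hI, map_sum] at h0
    rw [← h0]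
    refine Finset.sum_congr rfl fun i hi => ?_
    rw [evalAt_tmul, hgb _ (Finset.mem_image_of_mem _ hi), Algebra.algebraMap_eq_smul_one, op_smul,
      smul_assoc, op_one, one_smul]
    rfl
  let J := I.biUnion fun i => (b i.2).support
  have hsum : ∀ i ∈ I, i.1 ⊗ₜ[R] i.2 = ∑ d ∈ J, (b i.2 d • i.1) ⊗ₜ[R] d := by
    intro i hi
    conv_lhs => rw [← hb _ (Finset.mem_image_of_mem _ hi)]
    rw [Finsupp.linearCombination_apply, Finsupp.sum_of_support_subset (s := J) _
      (Finset.subset_biUnion_of_mem (fun i : M × C => (b i.2).support) hi) _ (by simp), tmul_sum]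
    exact Finset.sum_congr rfl fun d _ => by rw [tmul_smul, smul_tmul']; rfl
  rw [hI, Finset.sum_congr rfl hsum, Finset.sum_comm]
  refine Finset.sum_eq_zero fun d _ => ?_
  rw [← sum_tmul, key, zero_tmul]

end EvalAt

/-! ### Cofree Doi-Koppinen modules -/

section Cofree

variable {R H A C : Type u} [CommRing R] [Ring H] [Bialgebra R H] [Ring A] [Algebra R A]
  [AddCommGroup C] [Module R C] [Coalgebra R C] (D : DoiKoppinen R H A C)

/-- The right `A`-module `M ⊗ C` with `(m ⊗ c) a = ∑ m a₀ ⊗ c a₁`. -/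
def CofreeCarrier (_D : DoiKoppinen R H A C) (M : Type u) [AddCommGroup M] [Module R M] : Type u :=
  M ⊗[R] C

namespace CofreeCarrier

variable (M : Type u) [AddCommGroup M] [Module R M]

instance : AddCommGroup (CofreeCarrier D M) := inferInstanceAs (AddCommGroup (M ⊗[R] C))
instance : Module R (CofreeCarrier D M) := inferInstanceAs (Module R (M ⊗[R] C))

/-- The identification of `M ⊗ C` with its underlying `R`-module. -/
def ofTensor : M ⊗[R] C ≃ₗ[R] CofreeCarrier D M := LinearEquiv.refl R (M ⊗[R] C)

variable [Module Aᵐᵒᵖ M] [IsScalarTower R Aᵐᵒᵖ M]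

/-- The map `a ⊗ c ↦ m a ⊗ c`. -/
def mulTensor (m : M) : A ⊗[R] C →ₗ[R] M ⊗[R] C :=
  (rightMul R A M ∘ₗ TensorProduct.mk R M A m).rTensor C

variable {M}

@[simp] theorem mulTensor_tmul (m : M) (a : A) (c : C) :
    mulTensor (R := R) M m (a ⊗ₜ[R] c) = (op a • m) ⊗ₜ[R] c := rfl

theorem mulTensor_one_tmul (m : M) (c : C) :
    mulTensor (R := R) M m ((1 : A) ⊗ₜ[R] c) = m ⊗ₜ[R] c := by simp

theorem diag_coact (m : M) (c : C) (a : A) :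
    D.diag M ((m ⊗ₜ c) ⊗ₜ D.coact a) = mulTensor M m (D.psi c a) := by
  rw [D.psi_apply]
  induction D.coact a with
  | zero => simp
  | add s t hs ht => simp only [tmul_add, map_add, hs, ht]
  | tmul x h => simp

/-- The map a ⊗ c ↦ m a ⊗ c carries the right action on A ⊗ C to the diagonal action on M ⊗ C.
Associativity of the latter thereby reduces to `psi_mul`. -/
theorem diag_mulTensor (m : M) (t : A ⊗[R] C) (a : A) :
    D.diag M (mulTensor M m t ⊗ₜ D.coact a) = mulTensor M m (D.coringAct a t) := by
  induction t with
  | zero => simp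
  | add s t hs ht => simp only [add_tmul, map_add, hs, ht]
  | tmul b c =>
    rw [mulTensor_tmul, diag_coact, D.coringAct_tmul]
    induction D.psi c a with
    | zero => simp
    | add s t hs ht => simp only [smul_add, map_add, hs, ht]
    | tmul x d => simp [smul_tmul', mul_smul]

theorem diag_add_right (a b : A) (t : M ⊗[R] C) :
    D.diag M (t ⊗ₜ D.coact (a + b)) = D.diag M (t ⊗ₜ D.coact a) + D.diag M (t ⊗ₜ D.coact b) := by
  rw [map_add, tmul_add, map_add]

instance : Module Aᵐᵒᵖ (CofreeCarrier D M) where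
  smul a t := ofTensor D M (D.diag M ((ofTensor D M).symm t ⊗ₜ D.coact a.unop))
  one_smul t := by
    change D.diag M ((_ : M ⊗[R] C) ⊗ₜ D.coact 1) = _
    induction t using TensorProduct.induction_on with
    | zero => simp; rfl
    | tmul m c =>
      refine (diag_coact D m c 1).trans ?_
      rw [D.psi_one, mulTensor_one_tmul]
    | add s t hs ht => 
      refine (congrArg _ (add_tmul _ _ _)).trans ?_
      rw [map_add]
      exact congrArg₂ (· + ·) hs ht
  mul_smul a b t := by
    change D.diag M (_ ⊗ₜ D.coact (b.unop * a.unop)) =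
      D.diag M (D.diag M (_ ⊗ₜ D.coact b.unop) ⊗ₜ D.coact a.unop)
    generalize (ofTensor D M).symm t = t
    induction t with
    | zero => simp
    | tmul m c => rw [diag_coact, diag_coact, diag_mulTensor, D.psi_mul]
    | add s t hs ht => simp only [add_tmul, map_add, hs, ht]
  smul_zero a := by
    change D.diag M ((0 : M ⊗[R] C) ⊗ₜ _) = 0
    rw [zero_tmul, map_zero]
  smul_add a s t := by
    change D.diag M (((ofTensor D M).symm (s + t)) ⊗ₜ _) = _
    rw [map_add, add_tmul, map_add]
    rfl
  add_smul a b t := diag_add_right D _ _ _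
  zero_smul t := by
    change D.diag M (_ ⊗ₜ D.coact 0) = 0
    rw [map_zero, tmul_zero, map_zero]

theorem op_smul_ofTensor (a : A) (t : M ⊗[R] C) :
    op a • ofTensor D M t = ofTensor D M (D.diag M (t ⊗ₜ D.coact a)) := rfl

instance : IsScalarTower R Aᵐᵒᵖ (CofreeCarrier D M) where
  smul_assoc r a t := by
    change D.diag M (_ ⊗ₜ D.coact (r • a.unop)) = r • D.diag M (_ ⊗ₜ D.coact a.unop)
    rw [map_smul, tmul_smul, map_smul]

variable (M) in
/-- The coaction `m ⊗ c ↦ ∑ (m ⊗ c₁) ⊗ c₂`. -/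
def coact : CofreeCarrier D M →ₗ[R] CofreeCarrier D M ⊗[R] C :=
  (ofTensor D M).toLinearMap.rTensor C ∘ₗ (TensorProduct.assoc R M C C).symm.toLinearMap ∘ₗ
    (Coalgebra.comul (R := R) (A := C)).lTensor M ∘ₗ (ofTensor D M).symm.toLinearMap

/-- The map `c₁ ⊗ c₂ ↦ (m ⊗ c₁) ⊗ c₂`. -/
def pair (m : M) : C ⊗[R] C →ₗ[R] CofreeCarrier D M ⊗[R] C :=
  ((ofTensor D M).toLinearMap ∘ₗ TensorProduct.mk R M C m).rTensor C

@[simp] theorem pair_tmul (m : M) (c d : C) :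
    pair D m (c ⊗ₜ d) = ofTensor D M (m ⊗ₜ c) ⊗ₜ d := rfl

theorem coact_tmul (m : M) (c : C) :
    coact D M (ofTensor D M (m ⊗ₜ c)) = pair D m (Coalgebra.comul c) := by
  change (ofTensor D M).toLinearMap.rTensor C ((TensorProduct.assoc R M C C).symm
    (m ⊗ₜ Coalgebra.comul c)) = _
  induction Coalgebra.comul (R := R) c with
  | zero => simp
  | add s t hs ht => simp only [tmul_add, map_add, hs, ht]
  | tmul x y => rfl

theorem induction {p : CofreeCarrier D M → Prop} (t : CofreeCarrier D M) (h0 : p 0)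
    (h1 : ∀ m c, p (ofTensor D M (m ⊗ₜ c))) (h2 : ∀ s t, p s → p t → p (s + t)) : p t :=
  TensorProduct.induction_on (motive := p) t h0 h1 h2

theorem coact_coassoc (t : CofreeCarrier D M) :
    TensorProduct.assoc R _ C C ((coact D M).rTensor C (coact D M t)) =
      (Coalgebra.comul (R := R) (A := C)).lTensor _ (coact D M t) := by
  induction t using CofreeCarrier.induction with
  | h0 => simp
  | h2 s t hs ht => simp only [map_add, hs, ht]
  | h1 m c =>
    -- Both sides of coassociativity are the images under Ψ of the two sides of coassociativity of
    -- C.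
    let Ψ : C ⊗[R] (C ⊗[R] C) →ₗ[R] CofreeCarrier D M ⊗[R] (C ⊗[R] C) :=
      ((ofTensor D M).toLinearMap ∘ₗ TensorProduct.mk R M C m).rTensor (C ⊗[R] C)
    have h1 : ∀ u : C ⊗[R] C,
        TensorProduct.assoc R _ C C ((coact D M).rTensor C (pair D m u)) =
        Ψ (TensorProduct.assoc R C C C ((Coalgebra.comul (R := R) (A := C)).rTensor C u)) := by
      intro u
      induction u with
      | zero => simp
      | add s t hs ht => simp only [map_add, hs, ht]
      | tmul x y =>
        rw [pair_tmul, LinearMap.rTensor_tmul, LinearMap.rTensor_tmul, coact_tmul]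
        induction Coalgebra.comul (R := R) x with
        | zero => simp
        | add s t hs ht => simp only [map_add, add_tmul, hs, ht]
        | tmul p q => rfl
    have h2 : ∀ u : C ⊗[R] C, (Coalgebra.comul (R := R) (A := C)).lTensor _ (pair D m u) =
        Ψ ((Coalgebra.comul (R := R) (A := C)).lTensor C u) := by
      intro u
      induction u with
      | zero => simp
      | add s t hs ht => simp only [map_add, hs, ht]
      | tmul x y => rfl
    rw [coact_tmul, h1, h2, Coalgebra.coassoc_apply]

theorem coact_counit (t : CofreeCarrier D M) :
    (Coalgebra.counit (R := R) (A := C)).lTensor _ (coact D M t) = t ⊗ₜ[R] (1 : R) := by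
  induction t using CofreeCarrier.induction with
  | h0 => simp
  | h2 s t hs ht => simp only [map_add, add_tmul, hs, ht]
  | h1 m c =>
    have h1 : ∀ u : C ⊗[R] C, (Coalgebra.counit (R := R) (A := C)).lTensor _ (pair D m u) =
        ((ofTensor D M).toLinearMap ∘ₗ TensorProduct.mk R M C m).rTensor R
          ((Coalgebra.counit (R := R) (A := C)).lTensor C u) := by
      intro u
      induction u with
      | zero => simp
      | add s t hs ht => simp only [map_add, hs, ht]
      | tmul x y => rfl
    rw [coact_tmul, h1, Coalgebra.lTensor_counit_comul]
    rfl

/-- The coaction only touches the factor C, so on tensors of this form it is the comultiplication of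
C. This turns compatibility with the diagonal action into `psi_comul`. -/
theorem coact_mulTensor (m : M) (t : A ⊗[R] C) :
    coact D M (ofTensor D M (mulTensor M m t)) =
      ((ofTensor D M).toLinearMap ∘ₗ mulTensor M m).rTensor C
        ((TensorProduct.assoc R A C C).symm
          ((Coalgebra.comul (R := R) (A := C)).lTensor A t)) := by
  induction t with
  | zero => simp
  | add s t hs ht => simp only [map_add, hs, ht]
  | tmul a c =>
    rw [mulTensor_tmul, coact_tmul, LinearMap.lTensor_tmul]
    induction Coalgebra.comul (R := R) c with
    | zero => simp
    | add s t hs ht => simp only [tmul_add, map_add, hs, ht]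
    | tmul x y => rfl

theorem coact_op_smul (a : A) (t : CofreeCarrier D M) :
    coact D M (op a • t) = D.diag _ (coact D M t ⊗ₜ D.coact a) := by
  induction t using CofreeCarrier.induction with
  | h0 => simp
  | h2 s t hs ht => simp only [smul_add, map_add, add_tmul, hs, ht]
  | h1 m c =>
    rw [op_smul_ofTensor, diag_coact, coact_mulTensor, D.psi_comul, coact_tmul]
    induction Coalgebra.comul (R := R) c with
    | zero => simp
    | add s t hs ht => simp only [map_add, add_tmul, hs, ht]
    | tmul x y =>
      rw [pair_tmul, diag_coact, D.psiTwice_tmul, LinearEquiv.symm_apply_apply]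
      induction D.psi y a with
      | zero => simp
      | add s t hs ht => simp only [map_add, hs, ht]
      | tmul b d =>
        rw [LinearMap.rTensor_tmul, LinearMap.rTensor_tmul, mulTensor_tmul, op_smul_ofTensor,
          diag_coact]
        rfl

end CofreeCarrier

/-- The cofree Doi-Koppinen module `M ⊗ C` on a right `A`-module `M`. -/
abbrev DKModule.cofree (M : Type u) [AddCommGroup M] [Module R M] [Module Aᵐᵒᵖ M]
    [IsScalarTower R Aᵐᵒᵖ M] : DKModule D where
  carrier := CofreeCarrier D M
  coact := CofreeCarrier.coact D M
  coassoc := CofreeCarrier.coact_coassoc D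
  counit := CofreeCarrier.coact_counit D
  coact_op_smul := CofreeCarrier.coact_op_smul D

variable {D}

namespace DKModule

/-- The counit `C → A` of `C`, as an element of `#ᵒᵖ(C, A)`. -/
def unitMap (R A C : Type u) [CommRing R] [Ring A] [Algebra R A] [AddCommGroup C] [Module R C]
    [Coalgebra R C] : C →ₗ[R] A :=
  Algebra.linearMap R A ∘ₗ Coalgebra.counit

theorem evalAt_unitMap {M : Type u} [AddCommGroup M] [Module R M] [Module Aᵐᵒᵖ M]
    [IsScalarTower R Aᵐᵒᵖ M] (t : M ⊗[R] C) : evalAt M (unitMap R A C) t =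
      TensorProduct.rid R M ((Coalgebra.counit (R := R) (A := C)).lTensor M t) := by
  induction t with
  | zero => simp
  | add s t hs ht => simp only [map_add, hs, ht]
  | tmul m c =>
    rw [evalAt_tmul, unitMap, LinearMap.comp_apply, Algebra.linearMap_apply,
      Algebra.algebraMap_eq_smul_one, op_smul, smul_assoc, op_one, one_smul]
    rfl

theorem evalAt_unitMap_coact (M : DKModule D) (m : M.carrier) :
    evalAt M.carrier (unitMap R A C) (M.coact m) = m := by
  rw [evalAt_unitMap, M.counit]; simp

theorem opAct_eq_evalAt (M : DKModule D) (m : M.carrier) (f : OpHom D) :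
    M.opAct m f = evalAt M.carrier (OpHom.toLin D f) (M.coact m) := rfl

variable {M : Type u} [AddCommGroup M] [Module R M] [Module Aᵐᵒᵖ M] [IsScalarTower R Aᵐᵒᵖ M]

theorem diag_rTensor {N : Type u} [AddCommGroup N] [Module R N] [Module Aᵐᵒᵖ N]
    [IsScalarTower R Aᵐᵒᵖ N] (φ : M →ₗ[Aᵐᵒᵖ] N) (t : M ⊗[R] C) (a : A) :
    D.diag N ((φ.restrictScalars R).rTensor C t ⊗ₜ D.coact a) =
      (φ.restrictScalars R).rTensor C (D.diag M (t ⊗ₜ D.coact a)) := by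
  induction D.coact a with
  | zero => simp
  | add u v hu hv => simp only [tmul_add, map_add, hu, hv]
  | tmul x h =>
    induction t with
    | zero => simp
    | add u v hu hv => simp only [add_tmul, map_add, hu, hv]
    | tmul m c => simp

/-- Evaluation transposes the diagonal action of a into the left action of a on #ᵒᵖ(C, A). Hence the
Doi-Koppinen condition on a coaction corresponds to A-balancedness of the induced action. -/
theorem evalAt_diag (a : A) (f : OpHom D) (t : M ⊗[R] C) :
    evalAt M (OpHom.toLin D f) (D.diag M (t ⊗ₜ D.coact a)) =
      evalAt M (OpHom.toLin D (a • f)) t := by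
  induction t with
  | zero => simp
  | add u v hu hv => simp only [add_tmul, map_add, hu, hv]
  | tmul m c =>
    rw [CofreeCarrier.diag_coact, evalAt_tmul, OpHom.toLin_apply, OpHom.smul_apply]
    induction D.psi c a with
    | zero => simp
    | add u v hu hv => simp only [map_add, hu, hv, MulOpposite.op_add, add_smul]
    | tmul x d => simp [mul_smul]

/-- This is `evalAt_diag` for the map c ↦ ε(c)1, combined with the counit law of the entwining; it
makes m ⊗ c ↦ m ε(c) right A-linear. -/
theorem evalAt_unitMap_diag (t : M ⊗[R] C) (a : A) :
    evalAt M (unitMap R A C) (D.diag M (t ⊗ₜ D.coact a)) =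
      op a • evalAt M (unitMap R A C) t := by
  induction t with
  | zero => simp
  | add u v hu hv => simp only [add_tmul, map_add, smul_add, hu, hv]
  | tmul m c =>
    refine (evalAt_diag a ((OpHom.toLin D).symm (unitMap R A C)) (m ⊗ₜ c)).trans ?_
    rw [evalAt_tmul, evalAt_tmul, OpHom.toLin_apply, OpHom.smul_apply, smul_smul]
    congr 1
    refine congrArg op ((D.psi_counit c a).trans ?_)
    rw [Algebra.smul_def]; rfl

variable (D M) in
/-- The right `A`-linear map `m ⊗ c ↦ m ε(c)`. -/
def cofreeCounit : CofreeCarrier D M →ₗ[Aᵐᵒᵖ] M where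
  toFun t := evalAt M (unitMap R A C) ((CofreeCarrier.ofTensor D M).symm t)
  map_add' s t := by simp only [map_add]
  map_smul' a t := evalAt_unitMap_diag _ a.unop

theorem cofreeCounit_ofTensor (t : M ⊗[R] C) :
    cofreeCounit D M (CofreeCarrier.ofTensor D M t) = evalAt M (unitMap R A C) t := rfl

variable (M) in
/-- The morphism `X → M ⊗ C` induced by a right `A`-linear map `X → M`. -/
def toCofree (X : DKModule D) (φ : X.carrier →ₗ[Aᵐᵒᵖ] M) : X ⟶ cofree D M :=
  ⟨{ toFun := fun x => CofreeCarrier.ofTensor D M ((φ.restrictScalars R).rTensor C (X.coact x))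
     map_add' := fun x y => by simp only [map_add]
     map_smul' := fun a x => by
      rw [← op_unop a, X.coact_op_smul, ← diag_rTensor]
      rfl }, fun x => by
    have h1 : ∀ t : X.carrier ⊗[R] C, CofreeCarrier.coact D M
        (CofreeCarrier.ofTensor D M ((φ.restrictScalars R).rTensor C t)) =
        ((CofreeCarrier.ofTensor D M).toLinearMap ∘ₗ (φ.restrictScalars R).rTensor C).rTensor C
          ((TensorProduct.assoc R _ C C).symm
            ((Coalgebra.comul (R := R) (A := C)).lTensor _ t)) := by
      intro t
      induction t with
      | zero => simp
      | add u v hu hv => simp only [map_add, hu, hv]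
      | tmul m c =>
        rw [LinearMap.rTensor_tmul, CofreeCarrier.coact_tmul, LinearMap.lTensor_tmul]
        induction Coalgebra.comul (R := R) c with
        | zero => simp
        | add s t hs ht => simp only [tmul_add, map_add, hs, ht]
        | tmul x y => rfl
    refine (h1 _).trans ?_
    -- Colinearity of the induced morphism is coassociativity of the coaction of X.
    rw [← X.coassoc, LinearEquiv.symm_apply_apply, ← LinearMap.comp_apply, ← LinearMap.rTensor_comp]
    rfl⟩

theorem toCofree_apply (X : DKModule D) (φ : X.carrier →ₗ[Aᵐᵒᵖ] M) (x : X.carrier) :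
    (toCofree M X φ).toLinearMap x =
      CofreeCarrier.ofTensor D M ((φ.restrictScalars R).rTensor C (X.coact x)) := rfl

/-- This is the counit axiom of X. With φ the identity, it shows that the coaction embeds X into the
cofree module. -/
theorem cofreeCounit_toCofree (X : DKModule D) (φ : X.carrier →ₗ[Aᵐᵒᵖ] M) (x : X.carrier) :
    cofreeCounit D M ((toCofree M X φ).toLinearMap x) = φ x := by
  rw [toCofree_apply, cofreeCounit_ofTensor, evalAt_map, evalAt_unitMap_coact]

/-- `(∑ (m ⊗ c₁) ⊗ c₂) ↦ ∑ m ε(c₁) ⊗ c₂` recovers `m ⊗ c`. -/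
theorem rTensor_cofreeCounit_coact (t : CofreeCarrier D M) :
    ((cofreeCounit D M).restrictScalars R).rTensor C (CofreeCarrier.coact D M t) = (CofreeCarrier.ofTensor D M).symm t := by
  induction t using CofreeCarrier.induction with
  | h0 => simp
  | h2 s t hs ht => simp only [map_add, hs, ht]
  | h1 m c =>
    have h1 : ∀ u : C ⊗[R] C, ((cofreeCounit D M).restrictScalars R).rTensor C (CofreeCarrier.pair D m u) =
        m ⊗ₜ TensorProduct.lid R C ((Coalgebra.counit (R := R) (A := C)).rTensor C u) := by
      intro u
      induction u with
      | zero => simp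
      | add s t hs ht => simp only [map_add, tmul_add, hs, ht]
      | tmul x y =>
        rw [CofreeCarrier.pair_tmul, LinearMap.rTensor_tmul, LinearMap.restrictScalars_apply,
          cofreeCounit_ofTensor, evalAt_unitMap]
        simp [smul_tmul]
    rw [CofreeCarrier.coact_tmul, h1, Coalgebra.rTensor_counit_comul]
    simp

/-- A morphism into a cofree module is determined by its composition with `m ⊗ c ↦ m ε(c)`. -/
theorem eq_toCofree (X : DKModule D) (φ : X ⟶ cofree D M) (x : X.carrier) :
    φ.toLinearMap x = CofreeCarrier.ofTensor D M
      (((cofreeCounit D M ∘ₗ φ.toLinearMap).restrictScalars R).rTensor C (X.coact x)) := by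
  have h : φ.toLinearMap x = CofreeCarrier.ofTensor D M
      (((cofreeCounit D M).restrictScalars R).rTensor C
        ((φ.toLinearMap.restrictScalars R).rTensor C (X.coact x))) := by
    rw [← φ.map_coact]
    exact ((CofreeCarrier.ofTensor D M).eq_symm_apply).1 (rTensor_cofreeCounit_coact _).symm
  rw [h, ← LinearMap.rTensor_comp_apply]
  rfl

end DKModule

end Cofree

/-! ### Rational modules -/

section Rational

variable {R H A C : Type u} [CommRing R] [Ring H] [Bialgebra R H] [Ring A] [Algebra R A]
  [AddCommGroup C] [Module R C] [Coalgebra R C] {D : DoiKoppinen R H A C}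

namespace CofreeCarrier

variable {M : Type u} [AddCommGroup M] [Module R M] [Module Aᵐᵒᵖ M] [IsScalarTower R Aᵐᵒᵖ M]

theorem evalAt_pair (f : OpHom D) (m : M) (u : C ⊗[R] C) :
    evalAt (CofreeCarrier D M) (OpHom.toLin D f) (pair D m u) =
      ofTensor D M (mulTensor M m (OpHom.conv f u)) := by
  induction u with
  | zero => simp
  | add s t hs ht => simp only [map_add, hs, ht]
  | tmul x y =>
    rw [pair_tmul, evalAt_tmul, op_smul_ofTensor, diag_coact, OpHom.toLin_apply, OpHom.conv_tmul]

theorem evalAt_mulTensor (f : C →ₗ[R] A) (m : M) (s : A ⊗[R] C) :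
    evalAt M f (mulTensor M m s) = op (extendLeft f s) • m := by
  induction s with
  | zero => simp
  | add u v hu hv => simp only [map_add, hu, hv, MulOpposite.op_add, add_smul]
  | tmul x d => simp [mul_smul]

theorem opAct_tmul (f : OpHom D) (m : M) (c : C) :
    (DKModule.cofree D M).opAct (ofTensor D M (m ⊗ₜ c)) f =
      ofTensor D M (mulTensor M m (OpHom.conv f (Coalgebra.comul c))) := by
  rw [DKModule.opAct_eq_evalAt]
  refine Eq.trans ?_ (evalAt_pair f m _)
  exact congrArg _ (coact_tmul D m c)

/-- The action of f on M ⊗ C is thus characterised by evaluations through the product of #ᵒᵖ(C, A),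
without reference to the comultiplication of C. -/
theorem evalAt_opAct (t : M ⊗[R] C) (f g : OpHom D) :
    evalAt M (OpHom.toLin D g)
      ((ofTensor D M).symm ((DKModule.cofree D M).opAct (ofTensor D M t) f)) =
      evalAt M (OpHom.toLin D (f * g)) t := by
  induction t with
  | zero => simp
  | add u v hu hv => simp only [map_add, LinearMap.add_apply, hu, hv]
  | tmul m c =>
    rw [opAct_tmul, LinearEquiv.symm_apply_apply, evalAt_mulTensor, evalAt_tmul]
    rfl

end CofreeCarrier

/-- The counit of the cofree module is A-linear, so it may be applied before evaluating; applied to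
the left factor of the cofree coaction it gives back t. -/
theorem DKModule.cofreeCounit_opAct {M : Type u} [AddCommGroup M] [Module R M] [Module Aᵐᵒᵖ M]
    [IsScalarTower R Aᵐᵒᵖ M] (t : M ⊗[R] C) (f : OpHom D) :
    DKModule.cofreeCounit D M
      ((DKModule.cofree D M).opAct (CofreeCarrier.ofTensor D M t) f) =
        evalAt M (OpHom.toLin D f) t := by
  rw [opAct_eq_evalAt, ← evalAt_map]
  exact congrArg _ (rTensor_cofreeCounit_coact _)

namespace OpHom

variable (D) in
/-- The unity `c ↦ ε(c) 1` of `#ᵒᵖ(C, A)`. -/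
def unit : OpHom D := (toLin D).symm (DKModule.unitMap R A C)

theorem toLin_unit : toLin D (unit D) = DKModule.unitMap R A C := rfl

theorem evalAt_one_tmul (f : OpHom D) (c : C) :
    evalAt A (toLin D f) ((1 : A) ⊗ₜ c) = f c := by simp

/-- The value of f * `unit D` at c is obtained from 1 ⊗ c by acting with f and then applying the
counit of the cofree module on A, which returns f(c). -/
theorem mul_unit (f : OpHom D) : f * unit D = f := by
  ext c
  rw [← evalAt_one_tmul, ← CofreeCarrier.evalAt_opAct, toLin_unit, ← evalAt_one_tmul f]
  exact DKModule.cofreeCounit_opAct ((1 : A) ⊗ₜ c) f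

end OpHom

variable {B : Type u} [NonUnitalRing B] [Module R B] [Module A B] [Module Aᵐᵒᵖ B]
  [IsARing R A B] (β : ARingHom R A B (OpHom D))

/-- The value of `β` at `b`, as a linear map `C → A`. -/
def ARingHom.lin (b : B) : C →ₗ[R] A := OpHom.toLin D (β.toLinearMap b)

/-- Density approximates every scalar map c ↦ f(c)1 by values of β, so local projectivity applies.
All identities between tensors below are tested in this way. -/
theorem eq_of_evalAt_lin (hC : LocallyProjective R C)
    (hβ : FiniteDense (Set.range β.toLinearMap)) {M : Type u} [AddCommGroup M] [Module R M]
    [Module Aᵐᵒᵖ M] [IsScalarTower R Aᵐᵒᵖ M] {s t : M ⊗[R] C}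
    (h : ∀ b, evalAt M (β.lin b) s = evalAt M (β.lin b) t) : s = t := by
  refine hC.eq_of_evalAt (Set.range β.lin) (fun f F => ?_) (by rintro _ ⟨b, rfl⟩; exact h b)
  obtain ⟨_, ⟨b, rfl⟩, hb⟩ := (finiteDense_iff _).1 hβ
    ((OpHom.toLin D).symm (Algebra.linearMap R A ∘ₗ f)) F
  exact ⟨_, ⟨b, rfl⟩, hb⟩

/-- A fixed tensor only involves finitely many elements of C, and density realises any prescribed f
on those. -/
theorem exists_evalAt_lin (hβ : FiniteDense (Set.range β.toLinearMap)) {M : Type u}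
    [AddCommGroup M] [Module R M] [Module Aᵐᵒᵖ M] [IsScalarTower R Aᵐᵒᵖ M] (f : C →ₗ[R] A)
    (t : M ⊗[R] C) : ∃ b, evalAt M (β.lin b) t = evalAt M f t := by
  obtain ⟨F, hF⟩ := exists_finset_evalAt_congr (A := A) t
  obtain ⟨_, ⟨b, rfl⟩, hb⟩ := (finiteDense_iff _).1 hβ ((OpHom.toLin D).symm f) F
  exact ⟨b, hF _ _ hb⟩

variable {β} in
/-- If all evaluations of `t ∈ L ⊗ C` lie in the image of `N → L`, then `t` lies in the image of
`N ⊗ C`. -/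
theorem exists_rTensor_eq (hC : LocallyProjective R C)
    (hβ : FiniteDense (Set.range β.toLinearMap)) {L N P : Type u} [AddCommGroup L] [Module R L]
    [Module Aᵐᵒᵖ L] [IsScalarTower R Aᵐᵒᵖ L] [AddCommGroup N] [Module R N] [Module Aᵐᵒᵖ N]
    [IsScalarTower R Aᵐᵒᵖ N] [AddCommGroup P] [Module R P] [Module Aᵐᵒᵖ P]
    [IsScalarTower R Aᵐᵒᵖ P] (i : N →ₗ[Aᵐᵒᵖ] L) (π : L →ₗ[Aᵐᵒᵖ] P)
    (hex : Function.Exact i π) (hπ : Function.Surjective π) (t : L ⊗[R] C)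
    (h : ∀ b, ∃ n, i n = evalAt L (β.lin b) t) :
    ∃ s, (i.restrictScalars R).rTensor C s = t := by
  have hex' : Function.Exact (i.restrictScalars R) (π.restrictScalars R) := hex
  have hπ' : Function.Surjective (π.restrictScalars R) := hπ
  -- By right exactness it suffices that t vanishes in P ⊗ C, where the evaluations separate
  -- elements.
  refine (rTensor_exact C hex' hπ' t).1 (eq_of_evalAt_lin β hC hβ fun b => ?_)
  obtain ⟨n, hn⟩ := h b
  rw [evalAt_map, ← hn, map_zero]
  exact hex.apply_apply_eq_zero n

namespace AMod

/-- A `B`-module `N` is rational (along `β : B → #ᵒᵖ(C, A)`) if every `n` comes with some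
`∑ nᵢ ⊗ cᵢ` such that `n b = ∑ nᵢ β(b)(cᵢ)` for all `b`, and `n = ∑ nᵢ ε(cᵢ)`. -/
def IsRational (N : AMod R A B) : Prop :=
  ∀ n : N.carrier, ∃ t : N.carrier ⊗[R] C,
    (∀ b, N.act n b = evalAt N.carrier (β.lin b) t) ∧
      evalAt N.carrier (DKModule.unitMap R A C) t = n

variable {β}

theorem IsRational.of_surjective {L N : AMod R A B} (hL : IsRational β L) (p : L ⟶ N)
    (hp : Function.Surjective p.toLinearMap) : IsRational β N := fun n => by
  obtain ⟨l, rfl⟩ := hp n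
  obtain ⟨t, h1, h2⟩ := hL l
  refine ⟨(p.toLinearMap.restrictScalars R).rTensor C t, fun b => ?_, ?_⟩
  · rw [evalAt_map, ← h1, p.map_act]
  · rw [evalAt_map, h2]

/-- The tensor attached to the image of n lies a priori in L ⊗ C. Its evaluations are the images of
the elements n b, hence lie in the image of N, and so the tensor comes from N ⊗ C. -/
theorem IsRational.of_injective (hC : LocallyProjective R C)
    (hβ : FiniteDense (Set.range β.toLinearMap)) {L N : AMod R A B} (hL : IsRational β L)
    (i : N ⟶ L) (hi : Function.Injective i.toLinearMap) : IsRational β N := fun n => by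
  obtain ⟨t, h1, h2⟩ := hL (i.toLinearMap n)
  obtain ⟨s, rfl⟩ := exists_rTensor_eq hC hβ i.toLinearMap
    (Submodule.mkQ (LinearMap.range i.toLinearMap)) (LinearMap.exact_map_mkQ_range _)
    (Submodule.mkQ_surjective _) t fun b =>
    ⟨N.act n b, (i.map_act n b).trans (h1 b)⟩
  exact ⟨s, fun b => hi ((i.map_act n b).trans ((h1 b).trans (evalAt_map _ _ _))),
    hi ((evalAt_map _ _ _).symm.trans h2)⟩

/-- The underlying module of a direct sum of copies of `K`. -/
def copowerEquiv (K : AMod R A B) (I : Type u) :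
    (I →₀ K.carrier) ≃ₗ[Aᵐᵒᵖ] (copower K I).carrier := LinearEquiv.refl _ (I →₀ K.carrier)

/-- The inclusion of a summand into a direct sum of copies of `K`. -/
def copowerSingle (K : AMod R A B) {I : Type u} (j : I) : K ⟶ copower K I :=
  ⟨(copowerEquiv K I).toLinearMap ∘ₗ Finsupp.lsingle j, fun m x =>
    (Finsupp.mapRange_single (f := fun k => K.act k x) (hf := by simp) (a := j) (b := m)).symm⟩

theorem copower_induction {K : AMod R A B} {I : Type u} {p : (copower K I).carrier → Prop}
    (n : (copower K I).carrier) (h0 : p 0)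
    (h1 : ∀ (j : I) k, p ((copowerSingle K j).toLinearMap k))
    (h2 : ∀ s t, p s → p t → p (s + t)) : p n :=
  Finsupp.induction_linear (motive := p) n h0 h2 h1

/-- The morphism from a direct sum of copies of `K` given by a family of morphisms. -/
def copowerDesc {K L : AMod R A B} {I : Type u} (f : I → (K ⟶ L)) : copower K I ⟶ L :=
  have h : ∀ j k, (Finsupp.lsum ℕ fun j => (f j).toLinearMap)
      ((copowerEquiv K I).symm ((copowerSingle K j).toLinearMap k)) = (f j).toLinearMap k :=
    fun j k => Finsupp.lsum_single ℕ _ j k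
  ⟨(Finsupp.lsum ℕ fun j => (f j).toLinearMap) ∘ₗ (copowerEquiv K I).symm.toLinearMap, fun m x => by
    induction m using copower_induction with
    | h0 => simp
    | h2 s t hs ht => simp only [map_add, LinearMap.add_apply, hs, ht]
    | h1 j k =>
      rw [← (copowerSingle K j).map_act, LinearMap.comp_apply, LinearMap.comp_apply]
      exact (h _ _).trans (((f j).map_act k x).trans
        (congrArg (fun l => L.act l x) (h _ _).symm))⟩

theorem copowerDesc_single {K L : AMod R A B} {I : Type u} (f : I → (K ⟶ L)) (j : I)
    (k : K.carrier) : (copowerDesc f).toLinearMap ((copowerSingle K j).toLinearMap k) =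
      (f j).toLinearMap k :=
  Finsupp.lsum_single ℕ _ j k

/-- Every element is a finite sum of elements of summands, and the tensors can be pushed forward
along the inclusions and added. -/
theorem IsRational.copower {K : AMod R A B} (hK : IsRational β K) (I : Type u) :
    IsRational β (copower K I) := fun n => by
  induction n using copower_induction with
  | h0 => exact ⟨0, fun b => by simp, by simp⟩
  | h2 x y hx hy =>
    obtain ⟨s, hs, hs'⟩ := hx
    obtain ⟨t, ht, ht'⟩ := hy
    exact ⟨s + t, fun b => by rw [map_add, map_add, LinearMap.add_apply, hs, ht],
      by rw [map_add, hs', ht']⟩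
  | h1 j k =>
    obtain ⟨t, h1, h2⟩ := hK k
    refine ⟨((copowerSingle K j).toLinearMap.restrictScalars R).rTensor C t, fun b => ?_, ?_⟩
    · rw [evalAt_map, ← h1, (copowerSingle K j).map_act]
    · rw [evalAt_map, h2]

/-- Surjectivity on objects means equality of modules, not isomorphism; when the underlying A-module
is kept, only the action has to be compared. -/
theorem mk_act_eq (N : AMod R A B) (act : N.carrier →ₗ[R] B →ₗ[R] N.carrier) (h1 h2 h3)
    (h : act = N.act) : AMod.mk N.carrier act h1 h2 h3 = N := by
  subst h; rfl

end AMod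

/-- The functor from Doi-Koppinen modules to `B`-modules, `m b = ∑ m₀ β(b)(m₁)`. -/
abbrev DKModule.toAMod : DKModule D ⥤ AMod R A B := DKModule.toOpHom D ⋙ AMod.restrict β

variable {β}

theorem DKModule.isRational (M : DKModule D) :
    AMod.IsRational β ((DKModule.toAMod β).obj M) := fun m =>
  ⟨M.coact m, fun _ => rfl, M.evalAt_unitMap_coact m⟩

/-- The right `A`-linear map to the cofree module given by a coaction on a right `A`-module. -/
def coactionMap {N : Type u} [AddCommGroup N] [Module R N] [Module Aᵐᵒᵖ N]
    [IsScalarTower R Aᵐᵒᵖ N] (ρ : N →ₗ[R] N ⊗[R] C)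
    (hρ : ∀ (a : A) n, ρ (op a • n) = D.diag _ (ρ n ⊗ₜ D.coact a)) :
    N →ₗ[Aᵐᵒᵖ] CofreeCarrier D N where
  toFun n := CofreeCarrier.ofTensor D N (ρ n)
  map_add' m n := by simp only [map_add]
  map_smul' a n := congrArg (CofreeCarrier.ofTensor D N) (hρ a.unop n)

/-- Coassociativity of ρ is colinearity of ρ as a map into the cofree module, read through the
isomorphism (N ⊗ C) ⊗ C ≅ N ⊗ (C ⊗ C). -/
theorem coassoc_of_coactionMap {N : Type u} [AddCommGroup N] [Module R N] [Module Aᵐᵒᵖ N]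
    [IsScalarTower R Aᵐᵒᵖ N] (ρ : N →ₗ[R] N ⊗[R] C)
    (hρ : ∀ (a : A) n, ρ (op a • n) = D.diag _ (ρ n ⊗ₜ D.coact a)) (n : N)
    (h : CofreeCarrier.coact D N (coactionMap ρ hρ n) =
      ((coactionMap ρ hρ).restrictScalars R).rTensor C (ρ n)) :
    TensorProduct.assoc R N C C (ρ.rTensor C (ρ n)) =
      (Coalgebra.comul (R := R) (A := C)).lTensor N (ρ n) := by
  rw [← LinearEquiv.eq_symm_apply]
  apply (LinearEquiv.rTensor C (CofreeCarrier.ofTensor D N)).injective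
  refine Eq.trans ?_ h.symm
  exact (LinearMap.rTensor_comp_apply C (CofreeCarrier.ofTensor D N).toLinearMap ρ (ρ n)).symm

theorem counit_of_evalAt {N : Type u} [AddCommGroup N] [Module R N] [Module Aᵐᵒᵖ N]
    [IsScalarTower R Aᵐᵒᵖ N] {t : N ⊗[R] C} {n : N}
    (h : evalAt N (DKModule.unitMap R A C) t = n) :
    (Coalgebra.counit (R := R) (A := C)).lTensor N t = n ⊗ₜ[R] (1 : R) := by
  apply (TensorProduct.rid R N).injective
  rw [← DKModule.evalAt_unitMap (A := A), h]; simp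

/-- Every rational module is a Doi-Koppinen module. -/
theorem AMod.IsRational.exists_dkModule (hC : LocallyProjective R C)
    (hβ : FiniteDense (Set.range β.toLinearMap)) {N : AMod R A B} (hN : AMod.IsRational β N) :
    ∃ M : DKModule D, (DKModule.toAMod β).obj M = N := by
  choose ρ₀ hρ₀ hε₀ using hN
  obtain ⟨ρ, hρ, hε⟩ : ∃ ρ : N.carrier →ₗ[R] N.carrier ⊗[R] C,
      (∀ n b, N.act n b = evalAt N.carrier (β.lin b) (ρ n)) ∧
        ∀ n, evalAt N.carrier (DKModule.unitMap R A C) (ρ n) = n :=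
    ⟨{ toFun := ρ₀
       -- The chosen tensors depend additively and R-linearly on n because separation makes them
       -- unique.
       map_add' := fun m n => eq_of_evalAt_lin β hC hβ fun b => by
        rw [map_add, ← hρ₀, ← hρ₀, ← hρ₀, map_add, LinearMap.add_apply]
       map_smul' := fun r n => eq_of_evalAt_lin β hC hβ fun b => by
        rw [map_smul, ← hρ₀, RingHom.id_apply, ← hρ₀, map_smul, LinearMap.smul_apply] }, hρ₀, hε₀⟩
  have hdiag : ∀ (a : A) n, ρ (op a • n) = D.diag _ (ρ n ⊗ₜ D.coact a) := fun a n =>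
    eq_of_evalAt_lin β hC hβ fun b => by
      rw [← hρ, N.op_smul_act, hρ, ARingHom.lin, ARingHom.lin, DKModule.evalAt_diag, β.map_smul]
  -- The coaction is B-linear into the cofree module: evaluating at b', both sides give n (b b'), by
  -- associativity in N and `CofreeCarrier.evalAt_opAct`.
  have hσ : ∀ n b, coactionMap ρ hdiag (N.act n b) =
      (DKModule.cofree D N.carrier).opAct (coactionMap ρ hdiag n) (β.toLinearMap b) := fun n b =>
    (CofreeCarrier.ofTensor D N.carrier).symm.injective <| eq_of_evalAt_lin β hC hβ fun b' => by
      refine Eq.trans ?_ (CofreeCarrier.evalAt_opAct (ρ n) (β.toLinearMap b)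
        (β.toLinearMap b')).symm
      rw [← β.map_mul]
      refine Eq.trans ?_ (hρ n (b * b'))
      rw [← N.act_act]
      exact (hρ _ b').symm
  let M : DKModule D :=
    { carrier := N.carrier
      coact := ρ
      -- Evaluating the cofree coaction at b is acting by β(b), so the colinearity of ρ is its
      -- B-linearity.
      coassoc := fun n => coassoc_of_coactionMap ρ hdiag n <| eq_of_evalAt_lin β hC hβ fun b => by
        rw [evalAt_map, ← hρ, hσ]
        rfl
      counit := fun n => counit_of_evalAt (hε n)
      coact_op_smul := hdiag }
  exact ⟨M, AMod.mk_act_eq N _ _ _ _ (LinearMap.ext₂ fun n b => (hρ n b).symm)⟩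

/-! ### The functor from Doi-Koppinen modules to `B`-modules -/

namespace DKModule

/-- A B-linear map is colinear: the two tensors to be compared in N ⊗ C have the same evaluation at
every b. -/
theorem toAMod_map_bijective (hC : LocallyProjective R C)
    (hβ : FiniteDense (Set.range β.toLinearMap)) (M N : DKModule D) :
    Function.Bijective ((toAMod β).map : (M ⟶ N) → _) := by
  refine ⟨fun f g h => Hom.ext (congrArg AMod.Hom.toLinearMap h), fun φ => ⟨⟨φ.toLinearMap,
    fun m => eq_of_evalAt_lin β hC hβ fun b => ?_⟩, rfl⟩⟩
  let ψ : M.carrier →ₗ[Aᵐᵒᵖ] N.carrier := φ.toLinearMap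
  exact (φ.map_act m b).symm.trans (evalAt_map ψ _ _).symm

theorem toAMod_obj_injective (hC : LocallyProjective R C)
    (hβ : FiniteDense (Set.range β.toLinearMap)) :
    Function.Injective (toAMod (D := D) β).obj := fun M N h => by
  obtain ⟨M, ρ, h1, h2, h3⟩ := M
  obtain ⟨N, ρ', h1', h2', h3'⟩ := N
  -- Equality of the B-modules identifies the carriers with all their structure and the two actions;
  -- equal actions force equal coactions by separation.
  injection h with hMN h4 h5 h6 h7
  subst hMN
  obtain rfl := eq_of_heq h4
  obtain rfl := eq_of_heq h5
  obtain rfl := eq_of_heq h6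
  have : ρ = ρ' := LinearMap.ext fun m => eq_of_evalAt_lin β hC hβ fun b =>
    LinearMap.congr_fun₂ (eq_of_heq h7) m b
  subst this
  rfl

/-- Each m equals m b for some b: choose b so that β(b) agrees with c ↦ ε(c)1 on the right
components of the coaction of m. -/
theorem toAMod_isUnital (hβ : FiniteDense (Set.range β.toLinearMap)) (M : DKModule D) :
    ((toAMod β).obj M).IsUnital := by
  refine (AddSubgroup.eq_top_iff' _).2 fun m => AddSubgroup.subset_closure ?_
  obtain ⟨b, hb⟩ := exists_evalAt_lin β hβ (unitMap R A C) (M.coact m)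
  exact ⟨m, b, hb.trans (M.evalAt_unitMap_coact m)⟩

/-- The right `A`-linear map `A ⊗ C → M ⊗ C`, `a ⊗ c ↦ m a ⊗ c`. -/
def coringToCofreeLin {M : Type u} [AddCommGroup M] [Module R M] [Module Aᵐᵒᵖ M]
    [IsScalarTower R Aᵐᵒᵖ M] (m : M) : DKCoring D →ₗ[Aᵐᵒᵖ] CofreeCarrier D M where
  toFun w := CofreeCarrier.ofTensor D M
    (CofreeCarrier.mulTensor M m ((DKCoring.ofTensor D).symm w))
  map_add' v w := by simp only [map_add]
  map_smul' a w := congrArg (CofreeCarrier.ofTensor D M)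
    (CofreeCarrier.diag_mulTensor D m ((DKCoring.ofTensor D).symm w) a.unop).symm

theorem coringToCofreeLin_ofTensor {M : Type u} [AddCommGroup M] [Module R M] [Module Aᵐᵒᵖ M]
    [IsScalarTower R Aᵐᵒᵖ M] (m : M) (t : A ⊗[R] C) :
    coringToCofreeLin m (DKCoring.ofTensor D t) =
      CofreeCarrier.ofTensor D M (CofreeCarrier.mulTensor M m t) := rfl

theorem coringToCofreeLin_smul {M : Type u} [AddCommGroup M] [Module R M] [Module Aᵐᵒᵖ M]
    [IsScalarTower R Aᵐᵒᵖ M] (m : M) (a : A) (w : DKCoring D) :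
    coringToCofreeLin m (a • w) = coringToCofreeLin (op a • m) w := by
  induction w using DKCoring.induction with
  | h0 => simp
  | h2 s t hs ht => simp only [smul_add, map_add, hs, ht]
  | h1 b c =>
    rw [DKCoring.smul_tmul, ← DKCoring.ofTensor_tmul, ← DKCoring.ofTensor_tmul,
      coringToCofreeLin_ofTensor, coringToCofreeLin_ofTensor, CofreeCarrier.mulTensor_tmul,
      CofreeCarrier.mulTensor_tmul, MulOpposite.op_mul, mul_smul]

/-- Writing a ⊗ c = a (1 ⊗ c) absorbs a into m. On 1 ⊗ c both actions are computed by the same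
element ∑ f(c₂)₀ ⊗ c₁ f(c₂)₁. -/
theorem coringToCofreeLin_act {M : Type u} [AddCommGroup M] [Module R M] [Module Aᵐᵒᵖ M]
    [IsScalarTower R Aᵐᵒᵖ M] (m : M) (w : DKCoring D) (f : OpHom D) :
    coringToCofreeLin m (LeftDual.act (OpHom.phi f) w) =
      (cofree D M).opAct (coringToCofreeLin m w) f := by
  induction w using DKCoring.induction with
  | h0 => simp
  | h2 s t hs ht => simp only [map_add, LinearMap.add_apply, hs, ht]
  | h1 a c =>
    have h : DKCoring.tmul D a c = a • DKCoring.tmul D 1 c := by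
      rw [DKCoring.smul_tmul, mul_one]
    rw [h, LeftDual.act_smul, OpHom.act_phi, coringToCofreeLin_smul, coringToCofreeLin_smul,
      coringToCofreeLin_ofTensor, ← DKCoring.ofTensor_tmul, coringToCofreeLin_ofTensor,
      CofreeCarrier.mulTensor_one_tmul, CofreeCarrier.opAct_tmul]

/-- The morphism `A ⊗ C → M ⊗ C`, `a ⊗ c ↦ m a ⊗ c`, of modules over `#ᵒᵖ(C, A)`. -/
def coringToCofree {M : Type u} [AddCommGroup M] [Module R M] [Module Aᵐᵒᵖ M]
    [IsScalarTower R Aᵐᵒᵖ M] (m : M) :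
    DKCoring.opHomModule D ⟶ (toOpHom D).obj (cofree D M) :=
  ⟨coringToCofreeLin m, coringToCofreeLin_act m⟩

theorem coringToCofree_tmul {M : Type u} [AddCommGroup M] [Module R M] [Module Aᵐᵒᵖ M]
    [IsScalarTower R Aᵐᵒᵖ M] (m : M) (a : A) (c : C) :
    (coringToCofree (D := D) m).toLinearMap (DKCoring.tmul D a c) =
      CofreeCarrier.ofTensor D M ((op a • m) ⊗ₜ c) := rfl

theorem coringToCofree_one_injective :
    Function.Injective (coringToCofree (D := D) (1 : A)).toLinearMap := fun v w h => by
  have h1 : ∀ t : A ⊗[R] C, CofreeCarrier.mulTensor A (1 : A) t = t := fun t => by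
    induction t with
    | zero => simp
    | add s t hs ht => simp only [map_add, hs, ht]
    | tmul a c => simp
  have h2 := (CofreeCarrier.ofTensor D A).injective h
  rw [h1, h1] at h2
  exact (DKCoring.ofTensor D).symm.injective h2

/-- The coring embeds into the cofree module on A, which is rational as a Doi-Koppinen module. -/
theorem isRational_coring (hC : LocallyProjective R C)
    (hβ : FiniteDense (Set.range β.toLinearMap)) :
    AMod.IsRational β ((AMod.restrict β).obj (DKCoring.opHomModule D)) :=
  (isRational (cofree D A)).of_injective hC hβ ((AMod.restrict β).map (coringToCofree 1))
    coringToCofree_one_injective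

theorem isRational_of_isSubgenerated (hC : LocallyProjective R C)
    (hβ : FiniteDense (Set.range β.toLinearMap)) {N : AMod R A B}
    (hN : AMod.IsSubgenerated ((AMod.restrict β).obj (DKCoring.opHomModule D)) N) :
    AMod.IsRational β N := by
  obtain ⟨I, L, p, i, hp, hi⟩ := hN
  exact (((isRational_coring hC hβ).copower I).of_surjective p hp).of_injective hC hβ i hi

/-- The coaction embeds M into the cofree module M ⊗ C, and the maps a ⊗ c ↦ m a ⊗ c, for m in M,
together cover M ⊗ C. The index set of the direct sum is M itself. -/
theorem isSubgenerated_toAMod (M : DKModule D) :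
    AMod.IsSubgenerated ((AMod.restrict β).obj (DKCoring.opHomModule D)) ((toAMod β).obj M) := by
  refine ⟨M.carrier, (toAMod β).obj (cofree D M.carrier),
    AMod.copowerDesc fun m => (AMod.restrict β).map (coringToCofree m),
    (toAMod β).map (toCofree M.carrier M LinearMap.id), fun t => ?_, fun x y h => ?_⟩
  · induction t using CofreeCarrier.induction (D := D) (M := M.carrier) with
    | h0 => exact ⟨0, map_zero _⟩
    | h2 s t hs ht =>
      obtain ⟨x, rfl⟩ := hs
      obtain ⟨y, rfl⟩ := ht
      exact ⟨x + y, map_add _ _ _⟩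
    | h1 m c =>
      -- The tensor m ⊗ c is the image of 1 ⊗ c in the copy of A ⊗ C indexed by m.
      refine ⟨(AMod.copowerSingle _ m).toLinearMap (DKCoring.tmul D 1 c), ?_⟩
      refine (AMod.copowerDesc_single _ _ _).trans ?_
      exact (coringToCofree_tmul m 1 c).trans (by rw [op_one, one_smul])
  · exact (cofreeCounit_toCofree M LinearMap.id x).symm.trans
      ((congrArg (cofreeCounit D M.carrier) h).trans (cofreeCounit_toCofree M LinearMap.id y))

end DKModule

end Rational

/-! ### Isomorphisms of categories -/

namespace IsIsoOfCategories

variable {𝒳 𝒴 𝒵 : Type*} [Category 𝒳] [Category 𝒴] [Category 𝒵]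

theorem of_lift (F : 𝒳 ⥤ 𝒴) (P : ObjectProperty 𝒴) (h : ∀ X, P (F.obj X))
    (hinj : Function.Injective F.obj) (hsurj : ∀ Y, P Y → ∃ X, F.obj X = Y)
    (hmap : ∀ X Y : 𝒳, Function.Bijective (F.map : (X ⟶ Y) → _)) :
    IsIsoOfCategories (P.lift F h) := by
  refine ⟨⟨fun X Y hXY => hinj (congrArg ObjectProperty.FullSubcategory.obj hXY), ?_⟩,
    fun X Y => ⟨fun f g hfg => ?_, ?_⟩⟩
  · rintro ⟨Y, hY⟩
    obtain ⟨X, rfl⟩ := hsurj Y hY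
    exact ⟨X, rfl⟩
  · exact (hmap X Y).1 (congrArg
      (fun k : (P.lift F h).obj X ⟶ (P.lift F h).obj Y => InducedCategory.Hom.hom k) hfg)
  · rintro ⟨g⟩
    obtain ⟨f, rfl⟩ := (hmap X Y).2 g
    exact ⟨f, rfl⟩

/-- Cancellation for isomorphisms of categories: it yields the restriction functor from the two
functors that start at Doi-Koppinen modules. -/
theorem of_comp {G : 𝒳 ⥤ 𝒴} {K : 𝒴 ⥤ 𝒵} (hG : IsIsoOfCategories G)
    (hGK : IsIsoOfCategories (G ⋙ K)) : IsIsoOfCategories K := by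
  refine ⟨(Function.Bijective.of_comp_iff K.obj hG.1).1 hGK.1, fun X Y => ?_⟩
  obtain ⟨X, rfl⟩ := hG.1.2 X
  obtain ⟨Y, rfl⟩ := hG.1.2 Y
  exact (Function.Bijective.of_comp_iff _ (hG.2 X Y)).1 (hGK.2 X Y)

end IsIsoOfCategories

/-! ### Doi-Koppinen modules as σ[A ⊗ C] -/

section Comparison

variable {R H A C : Type u} [CommRing R] [Ring H] [Bialgebra R H] [Ring A] [Algebra R A]
  [AddCommGroup C] [Module R C] [Coalgebra R C] {D : DoiKoppinen R H A C}
  {B : Type u} [NonUnitalRing B] [Module R B] [Module A B] [Module Aᵐᵒᵖ B] [IsARing R A B]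

/-- The identity morphism of an `A`-ring. -/
def ARingHom.id (R A B : Type u) [CommRing R] [Ring A] [Algebra R A] [NonUnitalRing B]
    [Module R B] [Module A B] [Module Aᵐᵒᵖ B] : ARingHom R A B B where
  toLinearMap := LinearMap.id
  map_smul _ _ := rfl
  map_op_smul _ _ := rfl
  map_mul _ _ := rfl

theorem finiteDense_of_surjective (β : ARingHom R A B (OpHom D))
    (h : Function.Surjective β.toLinearMap) : FiniteDense (Set.range β.toLinearMap) :=
  (finiteDense_iff _).2 fun f _ => ⟨f, h f, fun _ _ => rfl⟩

/-- The comparison with modules over #ᵒᵖ(C, A) is the case of the identity morphism. -/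
theorem finiteDense_id : FiniteDense (Set.range (ARingHom.id R A (OpHom D)).toLinearMap) :=
  finiteDense_of_surjective _ Function.surjective_id

namespace DKModule

theorem sigma_toAMod {β : ARingHom R A B (OpHom D)}
    (hβ : FiniteDense (Set.range β.toLinearMap)) (M : DKModule D) :
    AMod.sigma ((AMod.restrict β).obj (DKCoring.opHomModule D)) ((toAMod β).obj M) :=
  ⟨toAMod_isUnital hβ M, isSubgenerated_toAMod M⟩

/-- Surjectivity on objects is the chain from subgenerated to rational to Doi-Koppinen; the rest is
separation of tensors. -/
theorem isIso_toAMod_sigma {β : ARingHom R A B (OpHom D)} (hC : LocallyProjective R C)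
    (hβ : FiniteDense (Set.range β.toLinearMap)) :
    IsIsoOfCategories ((AMod.sigma ((AMod.restrict β).obj (DKCoring.opHomModule D))).lift
      (toAMod β) (sigma_toAMod hβ)) :=
  .of_lift _ _ _ (toAMod_obj_injective hC hβ)
    (fun _ hN => (isRational_of_isSubgenerated hC hβ hN.2).exists_dkModule hC hβ)
    (toAMod_map_bijective hC hβ)

theorem sigma_toOpHom (M : DKModule D) :
    AMod.sigma (DKCoring.opHomModule D) ((toOpHom D).obj M) :=
  sigma_toAMod (finiteDense_id (D := D)) M

theorem isIso_toOpHom_sigma (hC : LocallyProjective R C) :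
    IsIsoOfCategories ((AMod.sigma (DKCoring.opHomModule D)).lift (toOpHom D) sigma_toOpHom) :=
  isIso_toAMod_sigma hC (finiteDense_id (D := D))

/-- Every module in the source comes from a Doi-Koppinen module M, and its restriction along β is
the B-module of the same M. -/
theorem sigma_restrict {β : ARingHom R A B (OpHom D)} (hC : LocallyProjective R C)
    (hβ : FiniteDense (Set.range β.toLinearMap))
    (N : (AMod.sigma (DKCoring.opHomModule D)).FullSubcategory) :
    AMod.sigma ((AMod.restrict β).obj (DKCoring.opHomModule D)) ((AMod.restrict β).obj N.obj) := by
  obtain ⟨M, rfl⟩ := (isIso_toOpHom_sigma hC).1.2 N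
  exact sigma_toAMod hβ M

theorem isIso_restrict_sigma {β : ARingHom R A B (OpHom D)} (hC : LocallyProjective R C)
    (hβ : FiniteDense (Set.range β.toLinearMap)) :
    IsIsoOfCategories ((AMod.sigma ((AMod.restrict β).obj (DKCoring.opHomModule D))).lift
      ((AMod.sigma (DKCoring.opHomModule D)).ι ⋙ AMod.restrict β) (sigma_restrict hC hβ)) :=
  .of_comp (isIso_toOpHom_sigma hC) (isIso_toAMod_sigma hC hβ)

/-! ### Finitely generated projective coalgebras -/

end DKModule

theorem LocallyProjective.of_projective (h : Module.Projective R C) : LocallyProjective R C :=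
  fun _ _ _ _ _ _ π hπ g _ _ =>
    (Module.projective_lifting_property π g hπ).imp fun _ hg' _ _ => LinearMap.congr_fun hg' _

/-- If `β` is bijective and `C` is finitely generated projective, then every unital module is
rational. -/
theorem AMod.IsUnital.isRational [Module.Finite R C] [Module.Projective R C]
    {β : ARingHom R A B (OpHom D)} (hβ : Function.Bijective β.toLinearMap) {N : AMod R A B}
    (hN : N.IsUnital) : AMod.IsRational β N := by
  obtain ⟨k, p, s, -, -, hps⟩ := Module.Finite.exists_comp_eq_id_of_projective R C
  let d : Fin k → C := fun i => p (Pi.single i 1)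
  have hd : ∀ c, c = ∑ i, s c i • d i := fun c => by
    conv_lhs => rw [← LinearMap.id_apply (R := R) c, ← hps, LinearMap.comp_apply,
      pi_eq_sum_univ' (s c), map_sum]
    exact Finset.sum_congr rfl fun i _ => map_smul _ _ _
  choose x hx using fun i : Fin k =>
    hβ.2 ((OpHom.toLin D).symm (Algebra.linearMap R A ∘ₗ LinearMap.proj i ∘ₗ s))
  -- The elements xᵢ correspond under β to the coordinate functionals, so a dual basis expansion of
  -- β(b) lifts to B by injectivity.
  have hb : ∀ b, b = ∑ i, op (β.lin b (d i)) • x i := fun b => hβ.1 <| by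
    rw [map_sum]
    refine OpHom.ext fun c => ?_
    have h1 : β.toLinearMap b c = ∑ i, s c i • β.lin b (d i) := by
      change β.lin b c = _
      conv_lhs => rw [hd c, map_sum]
      exact Finset.sum_congr rfl fun i _ => map_smul _ _ _
    rw [h1, ← OpHom.toLin_apply (∑ i, _), map_sum, LinearMap.sum_apply]
    refine Finset.sum_congr rfl fun i _ => ?_
    rw [β.map_op_smul, hx, OpHom.toLin_apply, OpHom.op_smul_apply, OpHom.toLin_symm_apply,
      Algebra.smul_def]
    rfl
  -- Since the action is right A-linear in B, one tensor ∑ n xᵢ ⊗ dᵢ computes n b for every b.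
  have key : ∀ n b, N.act n b = evalAt N.carrier (β.lin b) (∑ i, N.act n (x i) ⊗ₜ d i) := by
    intro n b
    conv_lhs => rw [hb b, map_sum]
    rw [map_sum]
    exact Finset.sum_congr rfl fun i _ => N.act_op_smul _ _ _
  -- A right unity of B acts as the identity on N B = N; this is where unitality gives the counit
  -- condition.
  obtain ⟨e, he⟩ := hβ.2 (OpHom.unit D)
  have he1 : ∀ b, b * e = b := fun b => hβ.1 <| by rw [β.map_mul, he, OpHom.mul_unit]
  refine fun n => ⟨_, key n, ?_⟩
  have hlin : β.lin e = DKModule.unitMap R A C := by rw [ARingHom.lin, he, OpHom.toLin_unit]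
  rw [← hlin, ← key]
  have hn : n ∈ AddSubgroup.closure {n : N.carrier | ∃ m x, N.act m x = n} := by
    rw [show AddSubgroup.closure _ = ⊤ from hN]; trivial
  induction hn using AddSubgroup.closure_induction with
  | mem n hn =>
    obtain ⟨m, b, rfl⟩ := hn
    rw [N.act_act, he1]
  | zero => simp
  | add m n _ _ hm hn => rw [map_add, LinearMap.add_apply, hm, hn]
  | neg n _ hn => rw [map_neg, LinearMap.neg_apply, hn]

namespace DKModule

theorem isIso_toAMod_unital [Module.Finite R C] [Module.Projective R C]
    {β : ARingHom R A B (OpHom D)} (hβ : Function.Bijective β.toLinearMap) :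
    IsIsoOfCategories ((AMod.unital R A B).lift (toAMod β)
      (toAMod_isUnital (finiteDense_of_surjective β hβ.2))) :=
  have hC : LocallyProjective R C := .of_projective inferInstance
  have hd := finiteDense_of_surjective β hβ.2
  .of_lift _ _ _ (toAMod_obj_injective hC hd)
    (fun _ hN => (hN.isRational hβ).exists_dkModule hC hd) (toAMod_map_bijective hC hd)

theorem unital_toOpHom (M : DKModule D) : AMod.unital R A (OpHom D) ((toOpHom D).obj M) :=
  toAMod_isUnital (finiteDense_id (D := D)) M

theorem isIso_toOpHom_unital [Module.Finite R C] [Module.Projective R C] :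
    IsIsoOfCategories ((AMod.unital R A (OpHom D)).lift (toOpHom D) unital_toOpHom) :=
  isIso_toAMod_unital (β := ARingHom.id R A (OpHom D)) Function.bijective_id

theorem unital_restrict [Module.Finite R C] [Module.Projective R C]
    {β : ARingHom R A B (OpHom D)} (hβ : Function.Bijective β.toLinearMap)
    (N : (AMod.unital R A (OpHom D)).FullSubcategory) :
    AMod.unital R A B ((AMod.restrict β).obj N.obj) := by
  obtain ⟨M, rfl⟩ := isIso_toOpHom_unital.1.2 N
  exact toAMod_isUnital (finiteDense_of_surjective β hβ.2) M

theorem isIso_restrict_unital [Module.Finite R C] [Module.Projective R C]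
    {β : ARingHom R A B (OpHom D)} (hβ : Function.Bijective β.toLinearMap) :
    IsIsoOfCategories ((AMod.unital R A B).lift
      ((AMod.unital R A (OpHom D)).ι ⋙ AMod.restrict β) (unital_restrict hβ)) :=
  .of_comp isIso_toOpHom_unital (isIso_toAMod_unital hβ)

end DKModule

end Comparison

/-! ### The morphism `β` and the pairing `κ` -/

namespace OpSmash

variable {R H A C : Type u} [CommRing R] [Ring H] [Bialgebra R H] [Ring A] [Algebra R A]
  [AddCommGroup C] [Module R C] [Coalgebra R C] {D : DoiKoppinen R H A C} (T : HSubalgebra D)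

/-- On a finite set F, local projectivity writes f as a finite sum of products of the values f(d)
with coordinate functionals; density replaces each functional by an element of T with the same
values on F. -/
theorem finiteDense_beta (hC : LocallyProjective R C)
    (hT : FiniteDense (T.toSubmodule : Set (Module.Dual R C))) :
    FiniteDense (Set.range (beta T).toLinearMap) := by
  classical
  rw [finiteDense_iff] at hT ⊢
  intro f F
  obtain ⟨g, hg⟩ := hC.exists_dualBasis F
  choose t ht htF using fun d : C => hT (Finsupp.lapply d ∘ₗ g) F
  let J := F.biUnion fun c => (g c).support
  refine ⟨_, ⟨(∑ d ∈ J, f d ⊗ₜ[R] (⟨t d, ht d⟩ : T.toSubmodule) : A ⊗[R] T.toSubmodule), rfl⟩,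
    fun c hc => ?_⟩
  have h1 : f c = ∑ d ∈ J, g c d • f d := by
    conv_lhs => rw [← hg c hc]
    rw [Finsupp.linearCombination_apply, Finsupp.sum_of_support_subset (s := J) _
      (Finset.subset_biUnion_of_mem (fun c => (g c).support) hc) _ (by simp), map_sum]
    exact Finset.sum_congr rfl fun d _ => map_smul _ _ _
  rw [h1]
  change betaLin T _ c = _
  rw [map_sum, LinearMap.sum_apply]
  refine Finset.sum_congr rfl fun d _ => ?_
  rw [betaLin_tmul]
  exact congrArg (· • f d) (htF d c hc)

/-- If `C` is finitely generated projective, then `β : A #ᵒᵖ C* → #ᵒᵖ(C, A)` is bijective. -/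
theorem beta_whole_bijective [Module.Finite R C] [Module.Projective R C] :
    Function.Bijective (beta (HSubalgebra.whole D)).toLinearMap := by
  obtain ⟨k, p, s, -, -, hps⟩ := Module.Finite.exists_comp_eq_id_of_projective R C
  let d : Fin k → C := fun i => p (Pi.single i 1)
  have hd : ∀ c, c = ∑ i, s c i • d i := fun c => by
    conv_lhs => rw [← LinearMap.id_apply (R := R) c, ← hps, LinearMap.comp_apply,
      pi_eq_sum_univ' (s c), map_sum]
    exact Finset.sum_congr rfl fun i _ => map_smul _ _ _
  let x : Fin k → (HSubalgebra.whole D).toSubmodule := fun i => ⟨LinearMap.proj i ∘ₗ s, trivial⟩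
  have hx : ∀ f : (HSubalgebra.whole D).toSubmodule, f = ∑ i, f.1 (d i) • x i := fun f => by
    refine Subtype.ext (LinearMap.ext fun c => ?_)
    rw [Submodule.coe_sum, LinearMap.sum_apply]
    conv_lhs => rw [hd c, map_sum]
    exact Finset.sum_congr rfl fun i _ => (map_smul _ _ _).trans (mul_comm _ _)
  -- Expanding in the dual functionals recovers t from the values of β(t) at the dᵢ; injectivity
  -- follows, and the same formula gives the preimage of any f.
  have key : ∀ t : A ⊗[R] (HSubalgebra.whole D).toSubmodule,
      t = ∑ i, betaLin (HSubalgebra.whole D) t (d i) ⊗ₜ[R] x i := fun t => by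
    induction t with
    | zero => simp
    | add u v hu hv =>
      simp only [map_add, LinearMap.add_apply, add_tmul, Finset.sum_add_distrib, ← hu, ← hv]
    | tmul a f =>
      conv_lhs => rw [hx f, tmul_sum]
      exact Finset.sum_congr rfl fun i _ => by rw [betaLin_tmul, smul_tmul]
  constructor
  · intro t t' h
    have h' : betaLin (HSubalgebra.whole D) t = betaLin (HSubalgebra.whole D) t' := h
    exact (key t).trans (by rw [h']; exact (key t').symm)
  · intro f
    refine ⟨(∑ i, f (d i) ⊗ₜ[R] x i : A ⊗[R] (HSubalgebra.whole D).toSubmodule),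
      OpHom.ext fun c => ?_⟩
    change betaLin _ _ c = _
    rw [map_sum, LinearMap.sum_apply]
    conv_rhs => rw [hd c, map_sum]
    exact Finset.sum_congr rfl fun i _ => (map_smul _ _ _).symm

/-- A unity e of A #ᵒᵖ T fixes 1 ⊗ c, because acting by e does not change any evaluation: e b = b.
Applying the counit of the cofree module on A gives κ(e)(1 ⊗ c) = ε(c)1. -/
theorem isMeasuringPairing_kappa (hC : LocallyProjective R C)
    (hβ : FiniteDense (Set.range (beta T).toLinearMap)) :
    IsMeasuringPairing (kappa T).toLinearMap where
  isARingHom := ⟨kappa T, fun _ => rfl⟩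
  map_unity e he := by
    refine OpHom.dual_ext fun c => ?_
    have h1 : (DKModule.cofree D A).opAct (CofreeCarrier.ofTensor D A ((1 : A) ⊗ₜ c))
        ((beta T).toLinearMap e) = CofreeCarrier.ofTensor D A ((1 : A) ⊗ₜ c) :=
      (CofreeCarrier.ofTensor D A).symm.injective <| eq_of_evalAt_lin (beta T) hC hβ fun b => by
        rw [ARingHom.lin, CofreeCarrier.evalAt_opAct, ← (beta T).map_mul, (he b).1]
        rfl
    have h2 := DKModule.cofreeCounit_opAct ((1 : A) ⊗ₜ[R] c) ((beta T).toLinearMap e)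
    rw [h1, DKModule.cofreeCounit_ofTensor] at h2
    exact h2.symm

/-- Under m ⊗ (a ⊗ c) ↦ m a ⊗ c, the map α_M becomes the family of evaluations on M ⊗ C, which
separates tensors. Only the injectivity of this identification is needed, so a one-sided inverse
suffices. -/
theorem alphaCondition_kappa (hC : LocallyProjective R C)
    (hβ : FiniteDense (Set.range (beta T).toLinearMap)) :
    AlphaCondition (kappa T).toLinearMap := by
  intro M _ _ _ _ s t h
  let f : M →ₗ[R] DKCoring D →ₗ[R] M ⊗[R] C :=
    (LinearMap.rTensorHom C ∘ₗ TensorProduct.curry (rightMul R A M)).compl₂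
      ((DKCoring.ofTensor D).symm.toLinearMap.restrictScalars R)
  have hf : ∀ m a c, f m (DKCoring.tmul D a c) = (op a • m) ⊗ₜ c := fun _ _ _ => rfl
  let p : ATensor R A M (DKCoring D) →ₗ[R] M ⊗[R] C := ATensor.lift f fun m a w => by
    induction w using DKCoring.induction with
    | h0 => simp
    | h2 s t hs ht => simp only [smul_add, map_add, hs, ht]
    | h1 b c => rw [DKCoring.smul_tmul, hf, hf, MulOpposite.op_mul, mul_smul]
  have hp : ∀ m a c, p (ATensor.tmul R A m (DKCoring.tmul D a c)) = (op a • m) ⊗ₜ c :=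
    fun _ _ _ => rfl
  let q : M ⊗[R] C →ₗ[R] ATensor R A M (DKCoring D) :=
    TensorProduct.lift ((ATensor.mk R A M (DKCoring D)).compl₂ (DKCoring.tmul D 1))
  have hqp : ∀ t, q (p t) = t := fun t => by
    induction t using ATensor.induction with
    | h0 => simp
    | h2 s t hs ht => simp only [map_add, hs, ht]
    | h1 m w =>
      induction w using DKCoring.induction with
      | h0 => simp
      | h2 s t hs ht => simp only [ATensor.tmul_add, map_add, hs, ht]
      | h1 a c =>
        rw [hp]
        change ATensor.tmul R A (op a • m) (DKCoring.tmul D 1 c) = _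
        rw [ATensor.smul_tmul, DKCoring.smul_tmul, mul_one]
  have hα : ∀ t b, alphaMap (kappa T).toLinearMap M t b =
      evalAt M ((beta T).lin b) (p t) := fun t b => by
    refine LinearMap.congr_fun (f := ATensor.lift (alphaAux (kappa T).toLinearMap M b)
      (alphaAux_balanced _ M b)) (g := evalAt M ((beta T).lin b) ∘ₗ p)
      (ATensor.hom_ext fun m w => ?_) t
    induction w using DKCoring.induction with
    | h0 => simp
    | h2 s t hs ht => simp only [ATensor.tmul_add, map_add, hs, ht]
    | h1 a c =>
      rw [LinearMap.comp_apply, hp, evalAt_tmul, smul_smul]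
      rfl
  rw [← hqp s, ← hqp t]
  congr 1
  refine eq_of_evalAt_lin (beta T) hC hβ fun b => ?_
  rw [← hα, ← hα, h]

end OpSmash

/-! ### The preadditive category of Doi-Koppinen modules -/

section Preadditive

variable {R H A C : Type u} [CommRing R] [Ring H] [Bialgebra R H] [Ring A] [Algebra R A]
  [AddCommGroup C] [Module R C] [Coalgebra R C] {D : DoiKoppinen R H A C}

namespace DKModule

/-- The additive subgroup of colinear maps among the right `A`-linear maps. -/
def colinearMaps (M N : DKModule D) : AddSubgroup (M.carrier →ₗ[Aᵐᵒᵖ] N.carrier) where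
  carrier := {f | ∀ m, N.coact (f m) = (f.restrictScalars R).rTensor C (M.coact m)}
  zero_mem' m := by
    have h : (0 : M.carrier →ₗ[Aᵐᵒᵖ] N.carrier).restrictScalars R = 0 := rfl
    rw [h, LinearMap.rTensor_zero]; simp
  add_mem' {f g} hf hg m := by
    have h : (f + g).restrictScalars R = f.restrictScalars R + g.restrictScalars R := rfl
    rw [h, LinearMap.rTensor_add, LinearMap.add_apply, LinearMap.add_apply, map_add]
    exact congrArg₂ (· + ·) (hf m) (hg m)
  neg_mem' {f} hf m := by
    have h : (-f).restrictScalars R = -f.restrictScalars R := rfl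
    rw [h, LinearMap.rTensor_neg, LinearMap.neg_apply, LinearMap.neg_apply, map_neg]
    exact congrArg Neg.neg (hf m)

/-- Morphisms of Doi-Koppinen modules are the colinear right `A`-linear maps. -/
def homEquivColinear (M N : DKModule D) : (M ⟶ N) ≃ colinearMaps M N where
  toFun f := ⟨f.toLinearMap, f.map_coact⟩
  invFun f := ⟨f.1, f.2⟩
  left_inv _ := rfl
  right_inv _ := rfl

instance (M N : DKModule D) : AddCommGroup (M ⟶ N) := (homEquivColinear M N).addCommGroup

theorem comp_toLinearMap {M N L : DKModule D} (f : M ⟶ N) (g : N ⟶ L) :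
    (f ≫ g).toLinearMap = g.toLinearMap ∘ₗ f.toLinearMap := rfl

instance : Preadditive (DKModule D) where
  add_comp _ _ _ f g h := Hom.ext (LinearMap.comp_add f.toLinearMap g.toLinearMap h.toLinearMap)
  comp_add _ _ _ f g h := Hom.ext (LinearMap.add_comp f.toLinearMap h.toLinearMap g.toLinearMap)

variable (D) in
/-- The forgetful functor to right `A`-modules. -/
def forgetA : DKModule D ⥤ ModuleCat.{u} Aᵐᵒᵖ where
  obj M := ModuleCat.of _ M.carrier
  map f := ModuleCat.ofHom f.toLinearMap

instance : (forgetA D).Additive where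
  map_add := ModuleCat.hom_ext rfl

instance : (forgetA D).Faithful where
  map_injective h := Hom.ext (ModuleCat.hom_ext_iff.1 h)

/-- A bijective morphism of Doi-Koppinen modules is an isomorphism. -/
def isoOfBijective {M N : DKModule D} (f : M ⟶ N) (hf : Function.Bijective f.toLinearMap) :
    M ≅ N where
  hom := f
  inv := ⟨(LinearEquiv.ofBijective f.toLinearMap hf).symm.toLinearMap, fun n => by
    obtain ⟨m, rfl⟩ := hf.2 n
    rw [f.map_coact, ← LinearMap.rTensor_comp_apply]
    have h : (LinearEquiv.ofBijective f.toLinearMap hf).symm.toLinearMap (f.toLinearMap m) = m :=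
      (LinearEquiv.ofBijective f.toLinearMap hf).symm_apply_apply m
    have h' : ((LinearEquiv.ofBijective f.toLinearMap hf).symm.toLinearMap.restrictScalars R) ∘ₗ
        f.toLinearMap.restrictScalars R = LinearMap.id := LinearMap.ext fun x =>
      (LinearEquiv.ofBijective f.toLinearMap hf).symm_apply_apply x
    rw [h, h', LinearMap.rTensor_id, LinearMap.id_apply]⟩
  hom_inv_id := Hom.ext <| LinearMap.ext fun x =>
    (LinearEquiv.ofBijective f.toLinearMap hf).symm_apply_apply x
  inv_hom_id := Hom.ext <| LinearMap.ext fun x =>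
    (LinearEquiv.ofBijective f.toLinearMap hf).apply_symm_apply x

instance : (forgetA D).ReflectsIsomorphisms where
  reflects f h := (isoOfBijective f ((ConcreteCategory.isIso_iff_bijective _).1 h)).isIso_hom

end DKModule

end Preadditive

/-! ### Comonadicity of the forgetful functor -/

section Comonadic

variable {R H A C : Type u} [CommRing R] [Ring H] [Bialgebra R H] [Ring A] [Algebra R A]
  [AddCommGroup C] [Module R C] [Coalgebra R C] {D : DoiKoppinen R H A C}

variable (R A) in
/-- A right `A`-module with its induced `R`-module structure. -/
def WithScalars (Y : Type u) : Type u := (fun _ _ => Y) R A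

namespace WithScalars

variable (Y : Type u) [AddCommGroup Y] [Module Aᵐᵒᵖ Y]

instance : AddCommGroup (WithScalars R A Y) := inferInstanceAs (AddCommGroup Y)
instance : Module Aᵐᵒᵖ (WithScalars R A Y) := inferInstanceAs (Module Aᵐᵒᵖ Y)
-- An object of `ModuleCat Aᵐᵒᵖ` comes without an action of R. Keeping R and A as arguments of the
-- type determines which algebra map induces one.
instance : Module R (WithScalars R A Y) := Module.compHom Y (algebraMap R Aᵐᵒᵖ)
instance : IsScalarTower R Aᵐᵒᵖ (WithScalars R A Y) where
  smul_assoc r a y := by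
    change (r • a) • (y : Y) = algebraMap R Aᵐᵒᵖ r • a • (y : Y)
    rw [Algebra.smul_def, mul_smul]

variable (R A) in
/-- The identity, as a right `A`-linear map. -/
def equiv : Y ≃ₗ[Aᵐᵒᵖ] WithScalars R A Y := LinearEquiv.refl Aᵐᵒᵖ Y

end WithScalars

namespace DKModule

variable (D) in
/-- The cofree module on an object of the category of right `A`-modules. -/
abbrev cofreeObj (Y : ModuleCat.{u} Aᵐᵒᵖ) : DKModule D := cofree D (WithScalars R A Y)

/-- The universal property of cofree modules. -/
def cofreeHomEquiv (X : DKModule D) (Y : ModuleCat.{u} Aᵐᵒᵖ) :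
    ((forgetA D).obj X ⟶ Y) ≃ (X ⟶ cofreeObj D Y) where
  toFun f := toCofree _ X ((WithScalars.equiv R A Y).toLinearMap ∘ₗ f.hom)
  invFun g := ModuleCat.ofHom ((WithScalars.equiv R A Y).symm.toLinearMap ∘ₗ
    cofreeCounit D (WithScalars R A Y) ∘ₗ g.toLinearMap)
  left_inv f := ModuleCat.hom_ext <| LinearMap.ext fun x =>
    cofreeCounit_toCofree X ((WithScalars.equiv R A Y).toLinearMap ∘ₗ f.hom) x
  right_inv g := Hom.ext <| LinearMap.ext fun x => (eq_toCofree X g x).symm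

theorem cofreeHomEquiv_apply (X : DKModule D) (Y : ModuleCat.{u} Aᵐᵒᵖ)
    (f : (forgetA D).obj X ⟶ Y) : cofreeHomEquiv X Y f =
      toCofree _ X ((WithScalars.equiv R A Y).toLinearMap ∘ₗ f.hom) := rfl

theorem cofreeHomEquiv_naturality (X' X : DKModule D) (Y : ModuleCat.{u} Aᵐᵒᵖ) (f : X' ⟶ X)
    (g : (forgetA D).obj X ⟶ Y) :
    cofreeHomEquiv X' Y ((forgetA D).map f ≫ g) = f ≫ cofreeHomEquiv X Y g := by
  refine Hom.ext <| LinearMap.ext fun x => ?_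
  rw [comp_toLinearMap, LinearMap.comp_apply, cofreeHomEquiv_apply, cofreeHomEquiv_apply,
    toCofree_apply, toCofree_apply, f.map_coact, ← LinearMap.rTensor_comp_apply]
  rfl

variable (D) in
/-- The functor `M ↦ M ⊗ C` from right `A`-modules to Doi-Koppinen modules. -/
def cofreeFunctor : ModuleCat.{u} Aᵐᵒᵖ ⥤ DKModule D :=
  Adjunction.rightAdjointOfEquiv cofreeHomEquiv cofreeHomEquiv_naturality

variable (D) in
/-- The forgetful functor is left adjoint to the cofree functor. -/
def cofreeAdjunction : forgetA D ⊣ cofreeFunctor D :=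
  Adjunction.adjunctionOfEquivRight cofreeHomEquiv cofreeHomEquiv_naturality

/-- The functor is built from its universal property, so its value on f is a composite of the cofree
coaction, the counit and f; the first two cancel and f ⊗ C remains. -/
theorem cofreeFunctor_map {Y Z : ModuleCat.{u} Aᵐᵒᵖ} (f : Y ⟶ Z)
    (t : WithScalars R A Y ⊗[R] C) :
    ((cofreeFunctor D).map f).toLinearMap (CofreeCarrier.ofTensor D _ t) =
      CofreeCarrier.ofTensor D _ (((WithScalars.equiv R A Z).toLinearMap ∘ₗ f.hom ∘ₗ
        (WithScalars.equiv R A Y).symm.toLinearMap).restrictScalars R |>.rTensor C t) := by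
  change CofreeCarrier.ofTensor D _ ((((WithScalars.equiv R A Z).toLinearMap ∘ₗ f.hom ∘ₗ
        (WithScalars.equiv R A Y).symm.toLinearMap) ∘ₗ
          cofreeCounit D (WithScalars R A Y)).restrictScalars R |>.rTensor C
            (CofreeCarrier.coact D _ (CofreeCarrier.ofTensor D _ t))) = _
  rw [LinearMap.restrictScalars_comp, LinearMap.rTensor_comp_apply, rTensor_cofreeCounit_coact,
    LinearEquiv.symm_apply_apply]

/-- The unit is the coaction, up to replacing the given R-action on X by the one induced from A. The
two agree, but not by definition. -/
theorem cofreeAdjunction_unit (X : DKModule D) (x : X.carrier) :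
    ((cofreeAdjunction D).unit.app X).toLinearMap x = CofreeCarrier.ofTensor D _
      (((WithScalars.equiv R A X.carrier).toLinearMap.restrictScalars R).rTensor C
        (X.coact x)) := by
  simp only [cofreeAdjunction, Adjunction.adjunctionOfEquivRight, Adjunction.mkOfHomEquiv]
  rfl

theorem cofreeAdjunction_counit (Y : ModuleCat.{u} Aᵐᵒᵖ)
    (t : CofreeCarrier D (WithScalars R A Y)) :
    ((cofreeAdjunction D).counit.app Y).hom t =
      (WithScalars.equiv R A Y).symm (cofreeCounit D (WithScalars R A Y) t) := by
  simp only [cofreeAdjunction, Adjunction.adjunctionOfEquivRight, Adjunction.mkOfHomEquiv]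
  rfl

end DKModule

end Comonadic

/-! ### The comparison functor is an equivalence -/

section Comonadic

variable {R H A C : Type u} [CommRing R] [Ring H] [Bialgebra R H] [Ring A] [Algebra R A]
  [AddCommGroup C] [Module R C] [Coalgebra R C] {D : DoiKoppinen R H A C}

namespace DKModule

/-- The map `Y ⊗ C → Y ⊗ C` for an `R`-module `Y` with compatible right `A`-action, which changes
the `R`-action on the left into the one induced from `A`. -/
def scalarsTensor (Y : Type u) [AddCommGroup Y] [Module R Y] [Module Aᵐᵒᵖ Y]
    [IsScalarTower R Aᵐᵒᵖ Y] : Y ⊗[R] C ≃ₗ[R] WithScalars R A Y ⊗[R] C :=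
  LinearEquiv.rTensor C ((WithScalars.equiv R A Y).restrictScalars R)

instance : (Comonad.comparison (cofreeAdjunction D)).Faithful :=
  Comonad.comparison_faithful_of_faithful _

theorem comparison_a (X : DKModule D) (x : X.carrier) :
    ((Comonad.comparison (cofreeAdjunction D)).obj X).a.hom x =
      CofreeCarrier.ofTensor D (WithScalars R A X.carrier)
        (scalarsTensor X.carrier (X.coact x) : WithScalars R A X.carrier ⊗[R] C) :=
  cofreeAdjunction_unit X x

theorem cofree_map_scalarsTensor {X Y : DKModule D}
    (f : X.carrier →ₗ[Aᵐᵒᵖ] Y.carrier) (t : X.carrier ⊗[R] C) :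
    ((cofreeFunctor D).map (ModuleCat.ofHom f : (forgetA D).obj X ⟶ (forgetA D).obj Y)).toLinearMap
      (CofreeCarrier.ofTensor D (WithScalars R A X.carrier)
        (scalarsTensor X.carrier t : WithScalars R A X.carrier ⊗[R] C)) =
      CofreeCarrier.ofTensor D (WithScalars R A Y.carrier)
        (scalarsTensor Y.carrier ((f.restrictScalars R).rTensor C t) :
          WithScalars R A Y.carrier ⊗[R] C) := by
  refine (cofreeFunctor_map _ _).trans (congrArg _ ?_)
  refine (LinearMap.rTensor_comp_apply C _
    ((WithScalars.equiv R A X.carrier).toLinearMap.restrictScalars R) t).symm.trans ?_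
  exact LinearMap.rTensor_comp_apply C
    ((WithScalars.equiv R A Y.carrier).toLinearMap.restrictScalars R) (f.restrictScalars R) t

instance : (Comonad.comparison (cofreeAdjunction D)).Full where
  map_surjective {X Y} g := by
    refine ⟨⟨g.f.hom, fun x => ?_⟩, Comonad.Coalgebra.Hom.ext (ModuleCat.hom_ext rfl)⟩
    -- The square of a coalgebra morphism for the comonad is colinearity, once the change of scalars
    -- is cancelled.
    have h := LinearMap.congr_fun (ModuleCat.hom_ext_iff.1 g.h) x
    apply (scalarsTensor (A := A) Y.carrier).injective
    apply (CofreeCarrier.ofTensor D _).injective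
    refine (comparison_a Y (g.f.hom x)).symm.trans (h.symm.trans ?_)
    refine Eq.trans ?_ (cofree_map_scalarsTensor (X := X) (Y := Y) g.f.hom (X.coact x))
    exact congrArg ((cofreeFunctor D).map g.f).toLinearMap (comparison_a X x)

/-- A coalgebra for the comonad is a right A-linear map from N to the cofree module on N. Its
linearity is the Doi-Koppinen condition, and its two axioms are the counit law and, by
`coassoc_of_coactionMap`, coassociativity. -/
instance : (Comonad.comparison (cofreeAdjunction D)).EssSurj where
  mem_essImage X := by
    let N := WithScalars R A X.A
    let a : N →ₗ[Aᵐᵒᵖ] CofreeCarrier D N := X.a.hom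
    let ρ : N →ₗ[R] N ⊗[R] C := (CofreeCarrier.ofTensor D N).symm.toLinearMap ∘ₗ
      a.restrictScalars R
    have hρ : ∀ (x : A) n, ρ (op x • n) = D.diag _ (ρ n ⊗ₜ D.coact x) := fun x n =>
      congrArg (CofreeCarrier.ofTensor D N).symm (a.map_smul (op x) n)
    have hcounit : ∀ n, evalAt N (unitMap R A C) (ρ n) = n := fun n =>
      (cofreeAdjunction_counit X.A (a n)).symm.trans
        (LinearMap.congr_fun (ModuleCat.hom_ext_iff.1 X.counit) n)
    have hcoassoc : ∀ n, CofreeCarrier.coact D N (coactionMap ρ hρ n) =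
        ((coactionMap ρ hρ).restrictScalars R).rTensor C (ρ n) := fun n => by
      have h := LinearMap.congr_fun (ModuleCat.hom_ext_iff.1 X.coassoc) n
      apply (scalarsTensor (A := A) (CofreeCarrier D N)).injective
      apply (CofreeCarrier.ofTensor D _).injective
      refine (cofreeAdjunction_unit (cofreeObj D X.A) (a n)).symm.trans (h.trans ?_)
      refine (cofreeFunctor_map X.a (ρ n)).trans (congrArg _ ?_)
      exact LinearMap.rTensor_comp_apply C
        ((WithScalars.equiv R A (CofreeCarrier D N)).toLinearMap.restrictScalars R)
        ((coactionMap ρ hρ).restrictScalars R) (ρ n)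
    let M : DKModule D :=
      { carrier := N
        coact := ρ
        coassoc := fun n => coassoc_of_coactionMap ρ hρ n (hcoassoc n)
        counit := fun n => counit_of_evalAt (hcounit n)
        coact_op_smul := hρ }
    -- The isomorphism is the identity on elements; only the bookkeeping of the R-action differs.
    let e : (forgetA D).obj M ≅ X.A := (WithScalars.equiv R A X.A).symm.toModuleIso
    refine ⟨M, ⟨Comonad.Coalgebra.isoMk e (ModuleCat.hom_ext <| LinearMap.ext fun n => ?_)⟩⟩
    refine (congrArg ((cofreeFunctor D).map e.hom).toLinearMap (comparison_a M n)).trans ?_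
    refine (cofreeFunctor_map e.hom _).trans ?_
    refine congrArg (CofreeCarrier.ofTensor D N) ?_
    refine (LinearMap.rTensor_comp_apply C _
      ((WithScalars.equiv R A N).toLinearMap.restrictScalars R) (ρ n)).symm.trans ?_
    exact LinearMap.rTensor_id_apply C N (ρ n)

instance : (Comonad.comparison (cofreeAdjunction D)).IsEquivalence where

instance : ComonadicLeftAdjoint (forgetA D) where
  R := cofreeFunctor D
  adj := cofreeAdjunction D
  eqv := inferInstance

end DKModule

end Comonadic

/-! ### Flat C: abelian structure and exact filtered colimits -/

section Abelian

open Limits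

/-- A preadditive category is abelian if it has an additive functor to an abelian category that
creates finite limits and finite colimits and reflects isomorphisms. -/
abbrev abelianOfCreates {𝒳 𝒴 : Type*} [Category 𝒳] [Category 𝒴] [Preadditive 𝒳] [Abelian 𝒴]
    (F : 𝒳 ⥤ 𝒴) [F.Additive] [HasFiniteLimits 𝒳] [HasFiniteColimits 𝒳] [PreservesFiniteLimits F]
    [PreservesFiniteColimits F] [F.ReflectsIsomorphisms] : Abelian 𝒳 :=
  have : ∀ {X Y : 𝒳} (f : X ⟶ Y), IsIso (Abelian.coimageImageComparison f) := fun f => by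
    have h := Abelian.PreservesCoimage.hom_coimageImageComparison F f
    have : IsIso (F.map (Abelian.coimageImageComparison f)) := by
      rw [(Iso.eq_comp_inv _).2 h.symm]
      infer_instance
    -- F carries the comparison from coimage to image to the one in the abelian target, which is
    -- invertible.
    exact isIso_of_reflects_iso _ F
  Abelian.ofCoimageImageComparisonIsIso

variable {R H A C : Type u} [CommRing R] [Ring H] [Bialgebra R H] [Ring A] [Algebra R A]
  [AddCommGroup C] [Module R C] [Coalgebra R C] {D : DoiKoppinen R H A C}

namespace DKModule

instance : (cofreeFunctor D).Additive := (cofreeAdjunction D).right_adjoint_additive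

/-- On underlying groups the composite is the tensor product with C over R. For an additive functor
left exactness can be checked on short exact sequences, where flatness applies. -/
instance preservesFiniteLimits_cofree [Module.Flat R C] :
    PreservesFiniteLimits (cofreeFunctor D ⋙ forgetA D) := by
  refine ((cofreeFunctor D ⋙ forgetA D).preservesFiniteLimits_tfae.out 0 3).1 fun S hS => ?_
  let r := fun Y : ModuleCat.{u} Aᵐᵒᵖ => WithScalars.equiv R A Y
  let f : WithScalars R A S.X₁ →ₗ[R] WithScalars R A S.X₂ :=
    ((r _).toLinearMap ∘ₗ S.f.hom ∘ₗ (r _).symm.toLinearMap).restrictScalars R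
  let g : WithScalars R A S.X₂ →ₗ[R] WithScalars R A S.X₃ :=
    ((r _).toLinearMap ∘ₗ S.g.hom ∘ₗ (r _).symm.toLinearMap).restrictScalars R
  have hf : Function.Injective f := hS.moduleCat_injective_f
  have hfg : Function.Exact f g :=
    (ShortComplex.ShortExact.moduleCat_exact_iff_function_exact S).1 hS.exact
  constructor
  · refine (ShortComplex.ShortExact.moduleCat_exact_iff_function_exact _).2 fun y => ?_
    have e := Module.Flat.rTensor_exact C hfg y
    constructor
    · intro h
      obtain ⟨x, hx⟩ := e.1 ((cofreeFunctor_map S.g y).symm.trans h)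
      exact ⟨x, (cofreeFunctor_map S.f x).trans hx⟩
    · rintro ⟨x, hx⟩
      exact (cofreeFunctor_map S.g y).trans (e.2 ⟨x, (cofreeFunctor_map S.f x).symm.trans hx⟩)
  · rw [ModuleCat.mono_iff_injective]
    intro x y h
    refine Module.Flat.rTensor_preserves_injective_linearMap f hf ?_
    exact (cofreeFunctor_map S.f x).symm.trans (h.trans (cofreeFunctor_map S.f y))

section Flat

variable [Module.Flat R C]

/-- A comonadic functor creates the limits that its comonad preserves. -/
instance createsFiniteLimits_forgetA (J : Type) [SmallCategory J] [FinCategory J] :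
    CreatesLimitsOfShape J (forgetA D) where
  CreatesLimit {K} := by
    have : PreservesFiniteLimits (comonadicRightAdjoint (forgetA D) ⋙ forgetA D) :=
      preservesFiniteLimits_cofree
    exact comonadicCreatesLimitOfPreservesLimit _ _

instance : CreatesColimitsOfSize.{u, u} (forgetA D) := comonadicCreatesColimits _

instance : HasFiniteLimits (DKModule D) where
  out _ _ _ := hasLimitsOfShape_of_hasLimitsOfShape_createsLimitsOfShape (forgetA D)

instance : PreservesFiniteLimits (forgetA D) where
  preservesFiniteLimits _ _ _ := inferInstance

instance : HasColimitsOfSize.{u, u} (DKModule D) :=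
  hasColimits_of_hasColimits_createsColimits (forgetA D)

instance : PreservesColimitsOfSize.{u, u} (forgetA D) := inferInstance

instance : HasFiniteColimits (DKModule D) := inferInstance
instance : PreservesFiniteColimits (forgetA D) := inferInstance

instance abelian : Abelian (DKModule D) := abelianOfCreates (forgetA D)

instance : HasFilteredColimitsOfSize.{u, u} (DKModule D) where
  HasColimitsOfShape _ _ _ := inferInstance

/-- Filtered colimits and finite limits are computed on the underlying right A-modules, where
filtered colimits are exact. -/
instance : AB5OfSize.{u, u} (DKModule D) where
  ofShape J _ _ := HasExactColimitsOfShape.domain_of_functor J (forgetA D)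

end Flat

end DKModule

end Abelian

/-! ### A separator for Doi-Koppinen modules -/

section Separator

open Limits

variable {R H A C : Type u} [CommRing R] [Ring H] [Bialgebra R H] [Ring A] [Algebra R A]
  [AddCommGroup C] [Module R C] [Coalgebra R C] {D : DoiKoppinen R H A C}

namespace DKModule

variable (D) in
/-- The coactions that turn a right `A`-module into a Doi-Koppinen module. -/
structure Coaction (P : Type u) [AddCommGroup P] [Module R P] [Module Aᵐᵒᵖ P]
    [IsScalarTower R Aᵐᵒᵖ P] : Type u where
  coact : P →ₗ[R] P ⊗[R] C
  coassoc : ∀ m, TensorProduct.assoc R P C C (coact.rTensor C (coact m)) =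
    (Coalgebra.comul (R := R) (A := C)).lTensor P (coact m)
  counit : ∀ m, (Coalgebra.counit (R := R) (A := C)).lTensor P (coact m) = m ⊗ₜ[R] (1 : R)
  coact_op_smul : ∀ (a : A) m, coact (op a • m) = D.diag P (coact m ⊗ₜ D.coact a)

section Restrict

variable {P : Type u} [AddCommGroup P] [Module R P] [Module Aᵐᵒᵖ P] [IsScalarTower R Aᵐᵒᵖ P]

/-- The Doi-Koppinen module given by a coaction. -/
abbrev Coaction.toDKModule (ρ : Coaction D P) : DKModule D where
  carrier := P
  coact := ρ.coact
  coassoc := ρ.coassoc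
  counit := ρ.counit
  coact_op_smul := ρ.coact_op_smul

/-- The coaction of a Doi-Koppinen module restricts to the right `A`-submodules that it
preserves. -/
theorem exists_coaction [Module.Flat R C] (M : DKModule D) (i : P →ₗ[Aᵐᵒᵖ] M.carrier)
    (hi : Function.Injective i)
    (h : ∀ p, ∃ t, (i.restrictScalars R).rTensor C t = M.coact (i p)) :
    ∃ ρ : Coaction D P, ∀ p, M.coact (i p) = (i.restrictScalars R).rTensor C (ρ.coact p) := by
  -- Flatness makes P ⊗ C a submodule of M ⊗ C, so the restricted coaction is unique and hence
  -- linear; its axioms are checked after embedding into M, with further tensor factors treated in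
  -- the same way.
  have hj : Function.Injective ((i.restrictScalars R).rTensor C) :=
    Module.Flat.rTensor_preserves_injective_linearMap _ hi
  choose s hs using h
  let ρ : P →ₗ[R] P ⊗[R] C :=
    { toFun := s
      map_add' := fun p q => hj (by rw [map_add, hs, hs, hs, map_add, map_add])
      map_smul' := fun r p => hj (by
        rw [map_smul, hs, hs, RingHom.id_apply, ← map_smul]
        exact congrArg M.coact ((i.restrictScalars R).map_smul r p)) }
  have hρ : ∀ p, (i.restrictScalars R).rTensor C (ρ p) = M.coact (i p) := hs
  have hρ' : (i.restrictScalars R).rTensor C ∘ₗ ρ = M.coact ∘ₗ i.restrictScalars R :=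
    LinearMap.ext hs
  refine ⟨⟨ρ, fun p => ?_, fun p => ?_, fun a p => ?_⟩, fun p => (hs p).symm⟩
  · have hj2 : Function.Injective ((i.restrictScalars R).rTensor (C ⊗[R] C)) :=
      Module.Flat.rTensor_preserves_injective_linearMap _ hi
    apply hj2
    have e1 : ∀ t : (P ⊗[R] C) ⊗[R] C, (i.restrictScalars R).rTensor (C ⊗[R] C)
        (TensorProduct.assoc R P C C t) = TensorProduct.assoc R M.carrier C C
          (((i.restrictScalars R).rTensor C).rTensor C t) := fun t => by
      rw [LinearMap.rTensor_tensor]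
      simp
    have e2 : ∀ t : P ⊗[R] C, (i.restrictScalars R).rTensor (C ⊗[R] C)
        ((Coalgebra.comul (R := R) (A := C)).lTensor P t) =
        (Coalgebra.comul (R := R) (A := C)).lTensor M.carrier
          ((i.restrictScalars R).rTensor C t) := fun t => by
      rw [← LinearMap.comp_apply, LinearMap.rTensor_comp_lTensor, ← LinearMap.lTensor_comp_rTensor,
        LinearMap.comp_apply]
    rw [e1, e2, ← LinearMap.rTensor_comp_apply, hρ', LinearMap.rTensor_comp_apply, hρ, M.coassoc]
  · have hj2 : Function.Injective ((i.restrictScalars R).rTensor R) :=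
      Module.Flat.rTensor_preserves_injective_linearMap _ hi
    apply hj2
    rw [← LinearMap.comp_apply, LinearMap.rTensor_comp_lTensor, ← LinearMap.lTensor_comp_rTensor,
      LinearMap.comp_apply, hρ, M.counit]
    rfl
  · apply hj
    rw [hρ, map_smul, M.coact_op_smul, ← hρ, diag_rTensor]

end Restrict

variable (D) in
/-- The Doi-Koppinen structures on the countably generated right `A`-modules. -/
abbrev CountablyGenerated : Type u :=
  Σ K : Submodule Aᵐᵒᵖ (ℕ →₀ Aᵐᵒᵖ), Coaction D (WithScalars R A ((ℕ →₀ Aᵐᵒᵖ) ⧸ K))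

/-- The finitely many left components of an expression of `coact x`. -/
theorem exists_finset_coact (M : DKModule D) (x : M.carrier) :
    ∃ S : Finset M.carrier, ∀ (P : Type u) [AddCommGroup P] [Module R P]
      (i : P →ₗ[R] M.carrier), (∀ y ∈ S, ∃ p, i p = y) → ∃ t, i.rTensor C t = M.coact x := by
  classical
  obtain ⟨F, hF⟩ := TensorProduct.exists_finset (M.coact x)
  refine ⟨F.image Prod.fst, fun P _ _ i h => ?_⟩
  choose! s hs using h
  refine ⟨∑ f ∈ F, s f.1 ⊗ₜ f.2, ?_⟩
  rw [hF, map_sum]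
  exact Finset.sum_congr rfl fun f hf => by
    rw [LinearMap.rTensor_tmul, hs _ (Finset.mem_image_of_mem _ hf)]

/-- Every element of a Doi-Koppinen module is contained in a countable subset that contains the
left components of the coactions of its elements. -/
theorem exists_countable_closed (M : DKModule D) (m : M.carrier) :
    ∃ s : ℕ → M.carrier, m ∈ Set.range s ∧ ∀ (P : Type u) [AddCommGroup P] [Module R P]
      (i : P →ₗ[R] M.carrier), (∀ n, ∃ p, i p = s n) → ∀ n, ∃ t, i.rTensor C t = M.coact (s n) := by
  choose S hS using M.exists_finset_coact
  -- Starting from {m}, each stage collects the left components of the coactions of the previous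
  -- one; every stage is countable.
  let T : ℕ → Set M.carrier := fun n => n.rec {m} fun _ U => ⋃ x ∈ U, (S x : Set M.carrier)
  have hT : ∀ n, (T n).Countable := fun n => by
    induction n with
    | zero => exact Set.countable_singleton m
    | succ n ih => exact ih.biUnion fun x _ => (S x).countable_toSet
  have hm : m ∈ ⋃ n, T n := Set.mem_iUnion.2 ⟨0, rfl⟩
  obtain ⟨s, hs⟩ := (Set.countable_iUnion hT).exists_eq_range ⟨m, hm⟩
  refine ⟨s, hs ▸ hm, fun P _ _ i h n => hS (s n) P i fun y hy => ?_⟩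
  -- If s n occurs at stage k, its left components occur at stage k + 1, hence again in the range of
  -- s.
  obtain ⟨k, hk⟩ := Set.mem_iUnion.1 (hs ▸ Set.mem_range_self n : s n ∈ ⋃ n, T n)
  have hy' : y ∈ ⋃ n, T n := Set.mem_iUnion.2 ⟨k + 1, Set.mem_biUnion hk hy⟩
  rw [hs] at hy'
  obtain ⟨l, rfl⟩ := hy'
  exact h l

/-- If `C` is flat, every element of a Doi-Koppinen module lies in the image of a countably
generated one. -/
theorem exists_countablyGenerated [Module.Flat R C] (M : DKModule D) (m : M.carrier) :
    ∃ (G : CountablyGenerated D) (g : G.2.toDKModule ⟶ M) (x : _), g.toLinearMap x = m := by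
  obtain ⟨s, ⟨n, rfl⟩, hs⟩ := M.exists_countable_closed m
  let l : (ℕ →₀ Aᵐᵒᵖ) →ₗ[Aᵐᵒᵖ] M.carrier := Finsupp.linearCombination Aᵐᵒᵖ s
  let q : ((ℕ →₀ Aᵐᵒᵖ) ⧸ LinearMap.ker l) →ₗ[Aᵐᵒᵖ] M.carrier := (LinearMap.ker l).liftQ l le_rfl
  -- The submodule generated by the sequence s is presented as a quotient of the free module on ℕ,
  -- so that it is one of the objects of `CountablyGenerated D`.
  let i : WithScalars R A ((ℕ →₀ Aᵐᵒᵖ) ⧸ LinearMap.ker l) →ₗ[Aᵐᵒᵖ] M.carrier :=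
    q ∘ₗ (WithScalars.equiv R A _).symm.toLinearMap
  have hi : Function.Injective i := (LinearMap.ker_eq_bot.1
    (Submodule.ker_liftQ_eq_bot' _ l rfl)).comp (WithScalars.equiv R A _).symm.injective
  have hx : ∀ n, ∃ p, i p = s n := fun n =>
    ⟨WithScalars.equiv R A _ (Submodule.Quotient.mk (Finsupp.single n 1)), by
      change l _ = _
      simp [l]⟩
  have hc : ∀ p, ∃ t, (i.restrictScalars R).rTensor C t = M.coact (i p) := fun p => by
    obtain ⟨p, rfl⟩ := (WithScalars.equiv R A _).surjective p
    obtain ⟨p, rfl⟩ := Submodule.Quotient.mk_surjective _ p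
    induction p using Finsupp.induction_linear with
    | zero => exact ⟨0, by simp⟩
    | add x y hx hy =>
      obtain ⟨t, ht⟩ := hx
      obtain ⟨u, hu⟩ := hy
      exact ⟨t + u, by rw [map_add, ht, hu, ← map_add, ← map_add, ← map_add]; rfl⟩
    | single n a =>
      obtain ⟨t, ht⟩ := hs _ (i.restrictScalars R) hx n
      have : i (WithScalars.equiv R A _ (Submodule.Quotient.mk (Finsupp.single n a))) =
          op a.unop • s n := by
        change l _ = _
        simp [l]
      -- Closure extends from generators to their multiples because the coaction of s n times a is
      -- the diagonal action of a on the coaction of s n.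
      exact ⟨D.diag _ (t ⊗ₜ D.coact a.unop), by
        rw [this, M.coact_op_smul, ← ht, diag_rTensor]⟩
  obtain ⟨ρ, hρ⟩ := exists_coaction M i hi hc
  obtain ⟨p, hp⟩ := hx n
  exact ⟨⟨_, ρ⟩, ⟨i, hρ⟩, p, hp⟩

section Flat

variable [Module.Flat R C]

instance : HasSeparator (DKModule D) where
  hasSeparator := by
    -- The index type lies in the universe u, so the coproduct exists. Two morphisms that agree on
    -- all countably generated modules agree on every element.
    refine ⟨∐ fun G : CountablyGenerated D => G.2.toDKModule,
      ObjectProperty.IsSeparating.isSeparator_coproduct fun X Y f g h => ?_⟩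
    refine Hom.ext <| LinearMap.ext fun m => ?_
    obtain ⟨G, k, x, rfl⟩ := X.exists_countablyGenerated m
    exact LinearMap.congr_fun (congrArg Hom.toLinearMap (h _ ⟨G⟩ k)) x

instance isGrothendieckAbelian : IsGrothendieckAbelian.{u} (DKModule D) where

end Flat

end DKModule

end Separator

end

/-! ### The structure theorem for Doi-Koppinen modules -/

theorem mainTheorem8 {R H A C : Type u} [CommRing R] [Ring H] [Bialgebra R H]
    [Ring A] [Algebra R A] [AddCommGroup C] [Module R C] [Coalgebra R C]
    (D : DoiKoppinen R H A C) :
    (Module.Flat R C →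
      ∃ _ : Abelian (DKModule D),
        IsGrothendieckAbelian.{u} (DKModule D) ∧ EnoughInjectives (DKModule D)) ∧
    (LocallyProjective R C → ∀ T : HSubalgebra D,
      IsPureFor A T.toSubmodule → FiniteDense (T.toSubmodule : Set (Module.Dual R C)) →
        FiniteDense (Set.range (OpSmash.beta T).toLinearMap) ∧
        IsMeasuringPairing (OpSmash.kappa T).toLinearMap ∧
        AlphaCondition (OpSmash.kappa T).toLinearMap ∧
        (∃ h : ∀ M, AMod.sigma (DKCoring.opHomModule D) ((DKModule.toOpHom D).obj M),
          IsIsoOfCategories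
            ((AMod.sigma (DKCoring.opHomModule D)).lift (DKModule.toOpHom D) h)) ∧
        (∃ h : ∀ N : (AMod.sigma (DKCoring.opHomModule D)).FullSubcategory,
            AMod.sigma (DKCoring.opSmashModule T) ((AMod.restrict (OpSmash.beta T)).obj N.obj),
          IsIsoOfCategories
            ((AMod.sigma (DKCoring.opSmashModule T)).lift
              ((AMod.sigma (DKCoring.opHomModule D)).ι ⋙ AMod.restrict (OpSmash.beta T)) h))) ∧
    (Module.Finite R C → Module.Projective R C →
        (∃ h : ∀ M, AMod.unital R A (OpHom D) ((DKModule.toOpHom D).obj M),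
          IsIsoOfCategories
            ((AMod.unital R A (OpHom D)).lift (DKModule.toOpHom D) h)) ∧
        (∃ h : ∀ N : (AMod.unital R A (OpHom D)).FullSubcategory,
            AMod.unital R A (OpSmash (HSubalgebra.whole D))
              ((AMod.restrict (OpSmash.beta (HSubalgebra.whole D))).obj N.obj),
          IsIsoOfCategories
            ((AMod.unital R A (OpSmash (HSubalgebra.whole D))).lift
              ((AMod.unital R A (OpHom D)).ι ⋙
                AMod.restrict (OpSmash.beta (HSubalgebra.whole D))) h))) := by
  -- Enough injectives are a consequence of the Grothendieck property.
  refine ⟨fun _ => ⟨DKModule.abelian, DKModule.isGrothendieckAbelian, inferInstance⟩,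
    fun hC T _ hT => ?_, fun _ _ => ?_⟩
  · have hβ := OpSmash.finiteDense_beta T hC hT
    exact ⟨hβ, OpSmash.isMeasuringPairing_kappa T hC hβ, OpSmash.alphaCondition_kappa T hC hβ,
      ⟨DKModule.sigma_toOpHom, DKModule.isIso_toOpHom_sigma hC⟩,
      ⟨DKModule.sigma_restrict hC hβ, DKModule.isIso_restrict_sigma hC hβ⟩⟩
  · have hβ := OpSmash.beta_whole_bijective (D := D)
    exact ⟨⟨DKModule.unital_toOpHom, DKModule.isIso_toOpHom_unital⟩,
      ⟨DKModule.unital_restrict hβ, DKModule.isIso_restrict_unital hβ⟩⟩
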